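/- For $0<\vartheta<\pi/2$ and $r>1$ let $$\Delta(\vartheta,r)=\{z\in\mathbb C : |z|<r,\ z\neq 1,\ \vartheta<\operatorname{Arg}(z-1)<2\pi-\vartheta\}\qquad(\operatorname{Arg}\in[0,2\pi)),$$ and for $\alpha\in\mathbb C$, $k\in\mathbb Z_{\ge 0}$ let $$\sigma_{\alpha,k}(z)=(1-z)^{-\alpha}\left(\frac1z\log\frac1{1-z}\right)^{k}$$ (principal determinations). Say that a power series $f(z)=\sum_{n\ge 0}f_nz^n$ with complex coefficients is of S.A. type if, for some $0<\vartheta<\pi/2$ and $r>1$, it converges in $|z|<1$ and its sum extends to an analytic function on $\Delta(\vartheta,r)$ which has there a singular expansion in the scale $\mathcal S=\{\sigma_{\alpha,k} : \alpha\in\mathbb C,\ k\in\mathbb Z_{\ge0}\}$: for every $\omega\in\mathcal S$ there is a finite linear combination $S$ of elements of $\mathcal S$ such that $f(z)=S(z)+O(\omega(z))$ as $z\to1$, $z\in\Delta(\vartheta,r)$. Theorem. If $f(z)=\sum_n f_nz^n$ and $g(z)=\sum_n g_nz^n$ are of S.A. type, then so is their Hadamard product $(f\odot g)(z)=\sum_n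 f_ng_nz^n$. -/

import Mathlib

open Filter Topology Asymptotics

noncomputable section

namespace SingularityAnalysis

/-- The open disc `|z| < r` indented at `1`: since `Complex.arg` takes values in `(-π, π]`, the
condition `ϑ < |arg (z - 1)|` says that the argument of `z - 1` taken in `[0, 2π)` lies strictly
between `ϑ` and `2π - ϑ`. -/
def deltaDomain (ϑ r : ℝ) : Set ℂ :=
  {z : ℂ | ‖z‖ < r ∧ ϑ < |Complex.arg (z - 1)| ∧ z ≠ 1}

/-- `σ_{α,β}(z) = (1 - z)^{-α} (z⁻¹ log (1 - z)⁻¹)^β`, with principal determinations. (The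
removable singularity at `z = 0` plays no role: only germs at `z = 1` are compared.) -/
def scaleFun (α β : ℂ) (z : ℂ) : ℂ :=
  (1 - z) ^ (-α) * (1 / z * Complex.log ((1 - z)⁻¹)) ^ β

/-- The scale of all `σ_{α,k}` with `α` complex and `k` a nonnegative integer. -/
def basicScale : Set (ℂ → ℂ) :=
  {σ | ∃ (α : ℂ) (k : ℕ), σ = scaleFun α (k : ℂ)}

/-- `F` admits an asymptotic expansion in the scale as `z → 1` inside `D`: for every scale function
`ω` there is a finite linear combination `S` of scale functions with `F = S + O(ω)`. -/
def HasSingularExpansion (F : ℂ → ℂ) (D : Set ℂ) : Prop :=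
  ∀ ω ∈ basicScale, ∃ S ∈ Submodule.span ℂ basicScale,
    (fun z => F z - S z) =O[𝓝[D] 1] ω

/-- `F` is an analytic continuation to `D` (an open set containing the unit disc) of the sum of the
power series `f`. -/
def IsContinuation (f : PowerSeries ℂ) (F : ℂ → ℂ) (D : Set ℂ) : Prop :=
  DifferentiableOn ℂ F D ∧
    ∀ z : ℂ, ‖z‖ < 1 → HasSum (fun n : ℕ => PowerSeries.coeff n f * z ^ n) (F z)

/-- Functions of S.A. type (amenable to singularity analysis), given by their Taylor series at `0`:
they continue to some `Δ`-domain and admit there a singular expansion in the scale. -/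
def IsSAType (f : PowerSeries ℂ) : Prop :=
  ∃ ϑ r : ℝ, 0 < ϑ ∧ ϑ < Real.pi / 2 ∧ 1 < r ∧
    ∃ F : ℂ → ℂ, IsContinuation f F (deltaDomain ϑ r) ∧
      HasSingularExpansion F (deltaDomain ϑ r)

/-- The Hadamard (termwise) product `∑ fₙ gₙ zⁿ`. -/
def hadamardProduct (f g : PowerSeries ℂ) : PowerSeries ℂ :=
  PowerSeries.mk fun n => PowerSeries.coeff n f * PowerSeries.coeff n g

end SingularityAnalysis

end

namespace SingularityAnalysis
open Complex (I)
open Set MeasureTheory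

/-! Modulo germs at `1` of the form polynomial plus `O((1 - z)^A)`, the functions `(1 - z)^s log^k
(1 - z)` and the generalized polylogarithms `∑ n^{-b} (log n)^k z^n` span the same space. The
polylogarithmic coefficient sequences are closed under termwise multiplication. So each factor is
written as a polylogarithmic part, a polynomial and a remainder `O((1 - z)^A)` with `A` large.
Products of polylogarithmic parts are harmless, a product with a polynomial is a polynomial, and
only products involving a remainder need analysis.

For those, the Euler operator `z d/dz` multiplies coefficients by `n`. It is applied to the small
factor until that factor is merely bounded, and inverted on the other factor until that one is
bounded too. The product of two bounded functions is bounded (`Continues.exists_hadamard`). The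
coefficients now carry an extra `n^K`, and inverting the Euler operator `K` times turns boundedness
into an expansion: a polynomial plus `O((1 - z)^K)` (`Continues.exists_hadamard_nearPoly`).

The bounded case is the integral of `F(t) G(z/t) dt/(2πi t)`. On a Δ-domain the contour would have
to move with `z`. Here Δ-domains are replaced by the domains `|z| < exp (c |arg z|)`, which are
cofinal with them. Since `|arg|` is subadditive, the complement of such a domain is closed under
multiplication; hence `z/t` stays in the domain for every `z` in it and every `t` on its boundary,
and one contour serves all `z`.

The dictionary between the two scales comes from Laplace integrals `∫ w(x) / (1 - e^{-x} z) dx`. By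
Euler's beta integral and the reflection formula, `(1 - z)^s` corresponds to the weight `(e^x -
1)^s`, while polylogarithms correspond to `x^s log^j x`. Differentiation in `s` supplies the
logarithms. Only the behaviour of the weight at `x = 0` matters at `z = 1`, and there the two
families of weights expand in each other. The Euler operator then carries both inclusions to
exponents for which the integrals diverge (`liCoeff_mem_expandable`,
`logScale_mem_liFunctions_sup`). -/

/-- The domain bounded by the two arcs `exp ((c ± i) s)`, `0 ≤ s ≤ π`, of logarithmic spirals. -/
def spiralDomain (c : ℝ) : Set ℂ := {z | ‖z‖ < Real.exp (c * |z.arg|)}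

/-! ### Arguments and elementary properties of spiral domains -/

lemma abs_arg_mul_le {x y : ℂ} (hx : x ≠ 0) (hy : y ≠ 0) :
    |(x * y).arg| ≤ |x.arg| + |y.arg| := by
  -- `|arg x|` is the unoriented angle between `1` and `x`, so the claim is the triangle inequality
  -- for angles.
  have h := InnerProductGeometry.angle_le_angle_add_angle 1 x (x * y)
  rw [Complex.angle_one_left (mul_ne_zero hx hy), Complex.angle_one_left hx] at h
  have h2 : InnerProductGeometry.angle x (x * y) = |y.arg| := by
    have := Complex.angle_mul_left hx 1 y
    rw [mul_one] at this
    rw [this, Complex.angle_one_left hy]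
  rwa [h2] at h

lemma abs_arg_exp_le (u : ℂ) : |(Complex.exp u).arg| ≤ |u.im| := by
  rcases le_total Real.pi |u.im| with h | h
  · exact (Complex.abs_arg_le_pi _).trans h
  · rcases eq_or_ne u.im (-Real.pi) with h1 | h1
    · rw [h1, abs_neg, abs_of_pos Real.pi_pos]
      exact Complex.abs_arg_le_pi _
    · have h2 := abs_le.1 h
      rw [Complex.arg_exp, (toIocMod_eq_self Real.two_pi_pos).2]
      exact ⟨lt_of_le_of_ne h2.1 (Ne.symm h1), by linarith [h2.2]⟩

lemma abs_arg_eq_arctan {w : ℂ} (hw : 0 < w.re) : |w.arg| = Real.arctan (|w.im| / w.re) := by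
  have h : |w.arg| < Real.pi / 2 := Complex.abs_arg_lt_pi_div_two_iff.2 (Or.inl hw)
  have h1 : Real.tan |w.arg| = |w.im| / w.re := by
    rw [← abs_of_pos hw, ← abs_div, ← Complex.tan_arg]
    rcases abs_cases w.arg with h2 | h2
    · rw [h2.1, abs_of_nonneg (Real.tan_nonneg_of_nonneg_of_le_pi_div_two h2.2 (h2.1 ▸ h.le))]
    · rw [h2.1, Real.tan_neg, abs_of_nonpos (Real.tan_nonpos_of_nonpos_of_neg_pi_div_two_le h2.2.le
        (by linarith [h2.1 ▸ h]))]
  rw [← h1, Real.arctan_tan (by linarith [abs_nonneg w.arg, Real.pi_pos]) h]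

lemma zero_mem_spiralDomain (c : ℝ) : (0 : ℂ) ∈ spiralDomain c := by
  simp [spiralDomain]

lemma mem_spiralDomain_of_norm_lt_one {c : ℝ} (hc : 0 < c) {z : ℂ} (hz : ‖z‖ < 1) :
    z ∈ spiralDomain c :=
  hz.trans_le (Real.one_le_exp (by positivity))

lemma one_notMem_spiralDomain (c : ℝ) : (1 : ℂ) ∉ spiralDomain c := by
  simp [spiralDomain]

lemma ne_one_of_mem_spiralDomain {c : ℝ} {z : ℂ} (hz : z ∈ spiralDomain c) : z ≠ 1 :=
  fun h => one_notMem_spiralDomain c (h ▸ hz)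

lemma spiralDomain_mono {c c' : ℝ} (h : c' ≤ c) : spiralDomain c' ⊆ spiralDomain c :=
  fun _ hz => lt_of_lt_of_le hz (Real.exp_le_exp.2 (by gcongr))

lemma isOpen_spiralDomain {c : ℝ} (hc : 0 < c) : IsOpen (spiralDomain c) := by
  rw [isOpen_iff_mem_nhds]
  intro z hz
  rcases eq_or_ne z 0 with rfl | h0
  · filter_upwards [Metric.ball_mem_nhds (0 : ℂ) one_pos] with w hw
    exact mem_spiralDomain_of_norm_lt_one hc (by simpa using hw)
  · have h1 : ContinuousAt (fun w : ℂ => Real.exp (c * InnerProductGeometry.angle 1 w) - ‖w‖) z := by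
      have : ContinuousAt (fun w : ℂ => InnerProductGeometry.angle (1 : ℂ) w) z :=
        (InnerProductGeometry.continuousAt_angle (x := ((1 : ℂ), z)) one_ne_zero h0).comp
          (f := fun w : ℂ => ((1 : ℂ), w)) (by fun_prop)
      fun_prop
    have h2 : 0 < Real.exp (c * InnerProductGeometry.angle 1 z) - ‖z‖ := by
      rw [Complex.angle_one_left h0]; exact sub_pos.2 hz
    filter_upwards [h1.eventually (lt_mem_nhds h2), isOpen_ne.mem_nhds h0] with w hw hw0
    rw [Complex.angle_one_left hw0] at hw
    exact sub_pos.1 hw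

lemma norm_lt_of_mem_spiralDomain {c : ℝ} (hc : 0 < c) {z : ℂ} (hz : z ∈ spiralDomain c) :
    ‖z‖ < Real.exp (c * Real.pi) :=
  lt_of_lt_of_le hz (Real.exp_le_exp.2 (by gcongr; exact Complex.abs_arg_le_pi z))

/-- Norms multiply while `|arg|` is only subadditive, so the threshold `exp (c |arg|)` is
submultiplicative. This is the reason for working with logarithmic spirals. -/
lemma notMem_spiralDomain_mul {c : ℝ} (hc : 0 < c) {z w : ℂ} (hz : z ∉ spiralDomain c)
    (hw : w ∉ spiralDomain c) : z * w ∉ spiralDomain c := by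
  have hz0 : z ≠ 0 := fun h => hz (h ▸ zero_mem_spiralDomain c)
  have hw0 : w ≠ 0 := fun h => hw (h ▸ zero_mem_spiralDomain c)
  simp only [spiralDomain, mem_ofPred_eq, not_lt, norm_mul] at *
  calc Real.exp (c * |(z * w).arg|) ≤ Real.exp (c * |z.arg| + c * |w.arg|) := by
        rw [← mul_add]; gcongr; exact abs_arg_mul_le hz0 hw0
    _ = Real.exp (c * |z.arg|) * Real.exp (c * |w.arg|) := Real.exp_add _ _
    _ ≤ _ := by gcongr

/-- Contrapositive form of the multiplicativity of the complement. It lets a fixed contour serve in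
the Hadamard integral, where the second factor is evaluated at `z / w`. -/
lemma div_mem_spiralDomain {c : ℝ} (hc : 0 < c) {z w : ℂ} (hz : z ∈ spiralDomain c)
    (hw : w ∉ spiralDomain c) : z / w ∈ spiralDomain c := by
  have hw0 : w ≠ 0 := fun h => hw (h ▸ zero_mem_spiralDomain c)
  by_contra h
  exact notMem_spiralDomain_mul hc h hw (by rwa [div_mul_cancel₀ _ hw0])

lemma one_le_norm_of_notMem {c : ℝ} (hc : 0 < c) {w : ℂ} (hw : w ∉ spiralDomain c) : 1 ≤ ‖w‖ := by
  by_contra h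
  exact hw (mem_spiralDomain_of_norm_lt_one hc (not_le.1 h))

lemma real_mul_mem_spiralDomain {c : ℝ} {z : ℂ} (hz : z ∈ spiralDomain c)
    {t : ℝ} (h0 : 0 ≤ t) (h1 : t ≤ 1) : (t : ℂ) * z ∈ spiralDomain c := by
  rcases h0.eq_or_lt with rfl | h0
  · simpa using zero_mem_spiralDomain c
  · have hz' : ‖z‖ < Real.exp (c * |z.arg|) := hz
    simp only [spiralDomain, mem_ofPred_eq, Complex.arg_real_mul z h0, norm_mul, Complex.norm_real,
      Real.norm_of_nonneg h0.le]
    exact lt_of_le_of_lt (mul_le_of_le_one_left (norm_nonneg _) h1) hz'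

lemma exp_mem_spiralDomain {c : ℝ} {u : ℂ} (h : |u.im| ≤ Real.pi) (hu : u.re < c * |u.im|) :
    Complex.exp u ∈ spiralDomain c := by
  have h1 : |(Complex.exp u).arg| = |u.im| := by
    rcases eq_or_ne u.im (-Real.pi) with h1 | h1
    · have : Complex.exp u = -(Real.exp u.re : ℝ) := by
        rw [Complex.exp_eq_exp_re_mul_sin_add_cos, h1]; simp
      rw [this, ← Complex.ofReal_neg, Complex.arg_ofReal_of_neg (by simp [Real.exp_pos]), h1, abs_neg]
    · have h2 := abs_le.1 h
      rw [Complex.arg_exp, (toIocMod_eq_self Real.two_pi_pos).2]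
      exact ⟨lt_of_le_of_ne h2.1 (Ne.symm h1), by linarith [h2.2]⟩
  simp only [spiralDomain, mem_ofPred_eq, Complex.norm_exp, h1]
  exact Real.exp_lt_exp.2 hu

/-- No bound on `u.im` is needed: reducing the argument modulo `2π` can only decrease its absolute
value. -/
lemma exp_notMem_spiralDomain {c : ℝ} (hc : 0 < c) {u : ℂ} (hu : c * |u.im| ≤ u.re) :
    Complex.exp u ∉ spiralDomain c := by
  simp only [spiralDomain, mem_ofPred_eq, Complex.norm_exp, not_lt, Real.exp_le_exp]
  exact (mul_le_mul_of_nonneg_left (abs_arg_exp_le u) hc.le).trans hu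

lemma real_notMem_spiralDomain {c : ℝ} {x : ℝ} (hx : 1 ≤ x) : (x : ℂ) ∉ spiralDomain c := by
  simp only [spiralDomain, mem_ofPred_eq, Complex.norm_real, Complex.arg_ofReal_of_nonneg (by linarith : 0 ≤ x)]
  simpa using hx.trans (le_abs_self x)

/-- Enlarging `c` makes the inequality strict wherever `arg z ≠ 0`; on the positive real axis both
domains are cut at `1`, and `1` is the only point lost. -/
lemma mem_spiralDomain_of_le {c c' : ℝ} (h : c' < c) {z : ℂ}
    (hz : ‖z‖ ≤ Real.exp (c' * |z.arg|)) (h1 : z ≠ 1) : z ∈ spiralDomain c := by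
  rcases eq_or_ne z.arg 0 with h0 | h0
  · have h2 : ‖z‖ ≤ 1 := by simpa [h0] using hz
    have h3 : (‖z‖ : ℂ) = z := by
      have := Complex.norm_mul_exp_arg_mul_I z
      simpa [h0] using this
    have h4 : ‖z‖ ≠ 1 := fun h => h1 (by rw [← h3, h]; simp)
    simpa [spiralDomain, h0] using lt_of_le_of_ne h2 h4
  · exact lt_of_le_of_lt hz (Real.exp_lt_exp.2 (by gcongr))

lemma closure_spiralDomain_subset {c c' : ℝ} (h : c' < c) :
    closure (spiralDomain c') ⊆ insert 1 (spiralDomain c) := by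
  intro z hz
  rcases eq_or_ne z 1 with rfl | h1
  · exact mem_insert _ _
  refine mem_insert_of_mem _ ?_
  rcases eq_or_ne z 0 with rfl | h0
  · exact zero_mem_spiralDomain c
  refine mem_spiralDomain_of_le h ?_ h1
  have hcont : ContinuousAt (fun w : ℂ => Real.exp (c' * InnerProductGeometry.angle 1 w) - ‖w‖) z := by
    have : ContinuousAt (fun w : ℂ => InnerProductGeometry.angle (1 : ℂ) w) z :=
      (InnerProductGeometry.continuousAt_angle (x := ((1 : ℂ), z)) one_ne_zero h0).comp
        (f := fun w : ℂ => ((1 : ℂ), w)) (by fun_prop)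
    fun_prop
  rw [mem_closure_iff_nhdsWithin_neBot] at hz
  have h2 : 0 ≤ Real.exp (c' * InnerProductGeometry.angle 1 z) - ‖z‖ := by
    refine ge_of_tendsto (hcont.tendsto.mono_left (nhdsWithin_le_nhds (s := spiralDomain c'))) ?_
    filter_upwards [self_mem_nhdsWithin, mem_nhdsWithin_of_mem_nhds (isOpen_ne.mem_nhds h0)] with w hw hw0
    rw [Complex.angle_one_left hw0]
    exact sub_nonneg.2 (le_of_lt hw)
  rw [Complex.angle_one_left h0] at h2
  linarith

/-! ### Spiral domains and Δ-domains are cofinal -/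

/-- Every `Δ`-domain contains a spiral domain. -/
lemma exists_spiralDomain_subset_deltaDomain {ϑ r : ℝ} (h0 : 0 < ϑ) (h1 : ϑ < Real.pi / 2)
    (hr : 1 < r) : ∃ c₀ > 0, ∀ c, 0 < c → c ≤ c₀ → spiralDomain c ⊆ deltaDomain ϑ r := by
  have htan : 0 < Real.tan ϑ := Real.tan_pos_of_pos_of_lt_pi_div_two h0 h1
  -- The second bound gives `exp (c π) ≤ r`. For the first, put `x = Re z`: in the forbidden sector
  -- `|arg z| ≤ tan ϑ (x - 1) / x`, so `c |arg z| ≤ 1 - 1/x ≤ log |z|`, which contradicts membership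
  -- in the spiral domain.
  refine ⟨min (Real.tan ϑ)⁻¹ (Real.log r / Real.pi), by
    have := Real.log_pos hr
    have := Real.pi_pos
    positivity, fun c hc hcc z hz => ⟨?_, ?_, ne_one_of_mem_spiralDomain hz⟩⟩
  · refine (norm_lt_of_mem_spiralDomain hc hz).trans_le ?_
    rw [← Real.le_log_iff_exp_le (by linarith)]
    exact (le_div_iff₀ Real.pi_pos).1 (hcc.trans (min_le_right _ _))
  · by_contra h
    rw [not_lt] at h
    have hw0 : z - 1 ≠ 0 := sub_ne_zero.2 (ne_one_of_mem_spiralDomain hz)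
    have hre : 0 < (z - 1).re := by
      have := Complex.abs_arg_lt_pi_div_two_iff.1 (h.trans_lt h1)
      exact this.resolve_right hw0
    have hre' : 1 < z.re := by simpa using hre
    have hat := abs_arg_eq_arctan hre
    have h2 : |z.im| / (z.re - 1) ≤ Real.tan ϑ := by
      have := abs_arg_eq_arctan hre
      simp only [Complex.sub_re, Complex.sub_im, Complex.one_re, Complex.one_im, sub_zero] at this
      rw [this] at h
      rw [← Real.tan_arctan (|z.im| / (z.re - 1))]
      rcases h.eq_or_lt with h | h
      · rw [h]
      · exact (Real.tan_lt_tan_of_lt_of_lt_pi_div_two (Real.neg_pi_div_two_lt_arctan _) h1 h).le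
    have h3 : |z.im| ≤ Real.tan ϑ * (z.re - 1) := (div_le_iff₀ (by linarith)).1 h2
    have h4 : |z.arg| ≤ |z.im| / z.re := by
      rw [abs_arg_eq_arctan (by linarith)]
      have h5 : 0 ≤ |z.im| / z.re := div_nonneg (abs_nonneg _) (by linarith)
      have h6 := Real.le_tan (Real.arctan_nonneg.2 h5) (Real.arctan_lt_pi_div_two _)
      rwa [Real.tan_arctan] at h6
    have h5 : 1 - z.re⁻¹ ≤ Real.log ‖z‖ :=
      (Real.one_sub_inv_le_log_of_pos (by linarith)).trans
        (Real.log_le_log (by linarith) (Complex.re_le_norm z))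
    have h6 : Real.log ‖z‖ < c * |z.arg| :=
      (Real.log_lt_iff_lt_exp (by linarith [Complex.re_le_norm z])).2 hz
    have h7 : c * |z.arg| ≤ (Real.tan ϑ)⁻¹ * ((Real.tan ϑ * (z.re - 1)) / z.re) := by
      gcongr
      · exact hcc.trans (min_le_left _ _)
      · exact h4.trans (by gcongr)
    have h8 : (Real.tan ϑ)⁻¹ * ((Real.tan ϑ * (z.re - 1)) / z.re) = 1 - z.re⁻¹ := by
      have : z.re ≠ 0 := by linarith
      field_simp
    linarith

/-- Every spiral domain contains a `Δ`-domain. -/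
lemma exists_deltaDomain_subset_spiralDomain {c : ℝ} (hc : 0 < c) :
    ∃ ϑ r : ℝ, 0 < ϑ ∧ ϑ < Real.pi / 2 ∧ 1 < r ∧ deltaDomain ϑ r ⊆ spiralDomain c := by
  set η : ℝ := min (1 / 2) (c / 2)
  have hη : 0 < η := by positivity
  -- A point `z` outside the spiral domain with `|z| < exp (c η)` has `θ = |arg z| < η`. Then `|Im
  -- z| ≤ 2θ` and `Re z - 1 ≥ c θ / 2`, so the slope seen from `1` is at most `4 / c`.
  refine ⟨Real.arctan (4 / c), min 2 (Real.exp (c * η)), Real.arctan_pos.2 (by positivity),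
    Real.arctan_lt_pi_div_two _, lt_min one_lt_two (Real.one_lt_exp_iff.2 (by positivity)),
    fun z ⟨hzr, harg, hz1⟩ => ?_⟩
  by_contra hz
  have hn1 := one_le_norm_of_notMem hc hz
  simp only [spiralDomain, mem_ofPred_eq, not_lt] at hz
  set θ := |z.arg|
  have hθ0 : 0 ≤ θ := abs_nonneg _
  have hθ : θ < η := by
    have := Real.exp_lt_exp.1 (hz.trans_lt (hzr.trans_le (min_le_right _ _)))
    exact lt_of_mul_lt_mul_left this hc.le
  have hθ1 : θ ≤ 1 / 2 := hθ.le.trans (min_le_left _ _)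
  have hθ2 : θ ≤ c / 2 := hθ.le.trans (min_le_right _ _)
  have hre : z.re = ‖z‖ * Real.cos θ := by
    rw [Real.cos_abs, Complex.norm_mul_cos_arg]
  have him : |z.im| ≤ 2 * θ := by
    rw [← Complex.norm_mul_sin_arg, abs_mul, abs_of_nonneg (norm_nonneg z)]
    have : |Real.sin z.arg| ≤ |z.arg| := Real.abs_sin_le_abs
    have := hzr.le.trans (min_le_left _ _)
    gcongr
  have hre2 : c * θ / 2 ≤ z.re - 1 := by
    have h1 : 1 + c * θ ≤ ‖z‖ := by
      have := Real.add_one_le_exp (c * θ)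
      linarith
    have h2 : 1 - θ ^ 2 / 2 ≤ Real.cos θ := Real.one_sub_sq_div_two_le_cos
    have h3 : (1 + c * θ) * (1 - θ ^ 2 / 2) ≤ z.re := by
      rw [hre]
      gcongr
      nlinarith
    have h4 : θ * θ ≤ c / 2 * θ := by gcongr
    have h5 : c * θ * θ ^ 2 ≤ c * θ * (1 / 4) := by
      gcongr
      nlinarith
    nlinarith
  have hpos : 0 < (z - 1).re := by
    simp only [Complex.sub_re, Complex.one_re]
    rcases hθ0.eq_or_lt with h0 | h0
    · have h3 : (‖z‖ : ℂ) = z := by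
        have := Complex.norm_mul_exp_arg_mul_I z
        rw [abs_eq_zero.1 h0.symm] at this
        simpa using this
      have h4 : ‖z‖ ≠ 1 := fun h => hz1 (by rw [← h3, h]; simp)
      rw [hre, ← h0, Real.cos_zero, mul_one]
      exact sub_pos.2 (lt_of_le_of_ne hn1 h4.symm)
    · have : 0 < c * θ / 2 := by positivity
      linarith
  rw [abs_arg_eq_arctan hpos, Real.arctan_lt_arctan_iff] at harg
  simp only [Complex.sub_re, Complex.sub_im, Complex.one_re, Complex.one_im, sub_zero] at harg hpos
  rw [lt_div_iff₀ hpos, div_mul_eq_mul_div, div_lt_iff₀ hc] at harg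
  nlinarith

/-! ### Quantitative geometry near the vertex -/

/-- If `‖1 - v‖ ≤ 1/2` then `log v` is bounded by `‖1 - v‖`. -/
lemma norm_log_le {v : ℂ} (hv : ‖1 - v‖ ≤ 1 / 2) : ‖Complex.log v‖ ≤ 3 / 2 * ‖1 - v‖ := by
  have h := Complex.norm_log_one_add_half_le_self (z := v - 1) (by rwa [norm_sub_rev])
  rwa [add_sub_cancel, norm_sub_rev v 1] at h

lemma ne_zero_of_norm_one_sub_le {v : ℂ} (hv : ‖1 - v‖ ≤ 1 / 2) : v ≠ 0 := by
  rintro rfl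
  norm_num at hv

lemma abs_arg_le_of_norm_one_sub_le {v : ℂ} (hv : ‖1 - v‖ ≤ 1 / 2) :
    |v.arg| ≤ 3 / 2 * ‖1 - v‖ := by
  rw [← Complex.log_im]
  exact (Complex.abs_im_le_norm _).trans (norm_log_le hv)

lemma abs_log_norm_le_of_norm_one_sub_le {v : ℂ} (hv : ‖1 - v‖ ≤ 1 / 2) :
    |Real.log ‖v‖| ≤ 3 / 2 * ‖1 - v‖ := by
  rw [← Complex.log_re]
  exact (Complex.abs_re_le_norm _).trans (norm_log_le hv)

/-- For `v = q z` near `1`, both `log |v|` and `arg v = arg z` are `O(|1 - v|)`. Since `log |z| < c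
|arg z|`, this forces `-log q`, and with it `1 - q`, to be `O(|1 - v|)`. -/
lemma one_sub_le_norm_one_sub_mul {c : ℝ} (hc : 0 < c) {z : ℂ} (hz : z ∈ spiralDomain c)
    {q : ℝ} (h0 : 0 ≤ q) (h1 : q ≤ 1) : 1 - q ≤ 2 * (1 + c) * ‖1 - q * z‖ := by
  rcases le_total ‖1 - q * z‖ (1 / 2) with h | h
  · have hq0 : 0 < q := by
      rcases h0.eq_or_lt with rfl | h0
      · norm_num at h
      · exact h0
    have hz0 : z ≠ 0 := by
      rintro rfl
      norm_num at h
    have ha := abs_arg_le_of_norm_one_sub_le h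
    rw [Complex.arg_real_mul _ hq0] at ha
    have hl := (abs_le.1 (abs_log_norm_le_of_norm_one_sub_le h)).1
    rw [norm_mul, Complex.norm_real, Real.norm_of_nonneg hq0.le,
      Real.log_mul hq0.ne' (norm_ne_zero_iff.2 hz0)] at hl
    have h2 : Real.log ‖z‖ < c * |z.arg| := (Real.log_lt_iff_lt_exp (norm_pos_iff.2 hz0)).2 hz
    have h3 : Real.log q ≤ q - 1 := Real.log_le_sub_one_of_pos hq0
    have h4 : c * |z.arg| ≤ c * (3 / 2 * ‖1 - q * z‖) := by gcongr
    nlinarith [norm_nonneg (1 - q * z)]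
  · nlinarith

/-- These uniform lower bounds for `|1 - q z|` control the Laplace kernel `1 / (1 - e^{-x} z)` as
well as integrals along the radius from `0` to `z`. -/
lemma norm_one_sub_le_mul_norm_one_sub_mul {c : ℝ} (hc : 0 < c) :
    ∃ C > 0, ∀ z ∈ spiralDomain c, ∀ q : ℝ, 0 ≤ q → q ≤ 1 →
      1 - q ≤ C * ‖1 - q * z‖ ∧ ‖1 - z‖ ≤ C * ‖1 - q * z‖ := by
  refine ⟨1 + 2 * (1 + c) * Real.exp (c * Real.pi), by positivity, fun z hz q h0 h1 => ?_⟩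
  have h2 := one_sub_le_norm_one_sub_mul hc hz h0 h1
  have hE : 1 ≤ Real.exp (c * Real.pi) := Real.one_le_exp (by positivity)
  constructor
  · refine h2.trans (mul_le_mul_of_nonneg_right ?_ (norm_nonneg _))
    nlinarith
  · have h3 : ‖1 - z‖ ≤ ‖1 - q * z‖ + (1 - q) * ‖z‖ := by
      have : (1 - z) = (1 - q * z) - ((1 - q : ℝ) : ℂ) * z := by push_cast; ring
      rw [this]
      refine (norm_sub_le _ _).trans ?_
      rw [norm_mul, Complex.norm_real, Real.norm_of_nonneg (by linarith)]
    have h4 := (norm_lt_of_mem_spiralDomain hc hz).le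
    have h5 : (1 - q) * ‖z‖ ≤ 2 * (1 + c) * ‖1 - q * z‖ * Real.exp (c * Real.pi) := by
      gcongr
    nlinarith

lemma norm_one_sub_le_log {c : ℝ} (hc : 0 < c) :
    ∃ C > 0, ∀ z ∈ spiralDomain c, z ≠ 0 → ‖1 - z‖ ≤ C * ‖Complex.log z‖ := by
  refine ⟨2 + Real.exp (c * Real.pi), by positivity, fun z hz h0 => ?_⟩
  rcases le_total ‖Complex.log z‖ 1 with h | h
  · have := Complex.norm_exp_sub_one_le h
    rw [Complex.exp_log h0, norm_sub_rev] at this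
    nlinarith [norm_nonneg (Complex.log z), Real.exp_pos (c * Real.pi)]
  · have h1 : ‖1 - z‖ ≤ 1 + ‖z‖ := by simpa using norm_sub_le (1 : ℂ) z
    have := (norm_lt_of_mem_spiralDomain hc hz).le
    nlinarith [Real.exp_pos (c * Real.pi)]

/-- Points of a smaller spiral domain are far from the complement of a larger one. -/
lemma exists_ball_subset_spiralDomain {c c' : ℝ} (hc' : 0 < c') (h : c' < c) :
    ∃ κ > 0, ∀ z ∈ spiralDomain c', Metric.ball z (κ * ‖1 - z‖) ⊆ spiralDomain c := by
  have hc : 0 < c := hc'.trans h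
  obtain ⟨C, hC, hCz⟩ := norm_one_sub_le_log hc'
  set E := Real.exp (c' * Real.pi)
  have hE : 0 < E := Real.exp_pos _
  set B : ℝ := 3 * (1 + c') / (c - c')
  have hB : 0 < B := div_pos (by positivity) (by linarith)
  set A : ℝ := (1 + c') * (B + 3 / 2) + 3
  have hA : 0 < A := by positivity
  -- The first entry puts `v = z / w` within `1/2` of `1`. For the second, if `w` lies outside the
  -- larger domain, comparing the two spiral inequalities through the gap `c - c'` gives `|arg w|`,
  -- and then `log z`, of size `O(|1 - v|)`. Thus `|1 - z| ≤ C A |1 - v| ≤ C A |w - z|`, which is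
  -- impossible for `w` in the ball.
  refine ⟨min (1 / (2 * (1 + E))) (1 / (C * A)), by positivity, fun z hz w hw => ?_⟩
  by_contra hwc
  have hw1 := one_le_norm_of_notMem hc hwc
  have hw0 : w ≠ 0 := fun h => hwc (h ▸ zero_mem_spiralDomain c)
  rw [Metric.mem_ball, dist_eq_norm] at hw
  have hz1 : ‖1 - z‖ ≤ 1 + E := by
    have h1 : ‖1 - z‖ ≤ 1 + ‖z‖ := by simpa using norm_sub_le (1 : ℂ) z
    linarith [(norm_lt_of_mem_spiralDomain hc' hz).le]
  set v := z / w
  have hwv : ‖1 - v‖ ≤ ‖w - z‖ := by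
    have : 1 - v = (w - z) / w := by simp only [v]; field_simp
    rw [this, norm_div]
    exact div_le_self (norm_nonneg _) hw1
  have hv : ‖1 - v‖ ≤ 1 / 2 := by
    refine hwv.trans (hw.le.trans ?_)
    calc _ ≤ 1 / (2 * (1 + E)) * (1 + E) := by
          gcongr
          exact min_le_left _ _
      _ = 1 / 2 := by field_simp
  have hv0 := ne_zero_of_norm_one_sub_le hv
  have hzw : z = v * w := by simp only [v]; field_simp
  have hz0 : z ≠ 0 := hzw ▸ mul_ne_zero hv0 hw0
  have ha := abs_arg_le_of_norm_one_sub_le hv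
  have hl := abs_le.1 (abs_log_norm_le_of_norm_one_sub_le hv)
  set ε := ‖1 - v‖
  have hε : 0 ≤ ε := norm_nonneg _
  have harg : |z.arg| ≤ |v.arg| + |w.arg| := hzw ▸ abs_arg_mul_le hv0 hw0
  have hlz : Real.log ‖z‖ = Real.log ‖v‖ + Real.log ‖w‖ := by
    rw [hzw, norm_mul, Real.log_mul (norm_ne_zero_iff.2 hv0) (norm_ne_zero_iff.2 hw0)]
  have h1 : Real.log ‖z‖ < c' * |z.arg| := (Real.log_lt_iff_lt_exp (norm_pos_iff.2 hz0)).2 hz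
  have h2 : c * |w.arg| ≤ Real.log ‖w‖ := by
    rw [Real.le_log_iff_exp_le (norm_pos_iff.2 hw0)]
    exact not_lt.1 hwc
  have h3 : c' * |z.arg| ≤ c' * (3 / 2 * ε + |w.arg|) := by gcongr; linarith
  have h4 : |w.arg| ≤ B * ε := by
    have : (c - c') * |w.arg| ≤ 3 * (1 + c') * ε := by nlinarith
    rw [div_mul_eq_mul_div, le_div_iff₀ (by linarith)]
    linarith
  have h5 : |z.arg| ≤ (B + 3 / 2) * ε := by linarith
  have h6 : |Real.log ‖z‖| ≤ c' * (B + 3 / 2) * ε + 3 / 2 * ε := by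
    rw [abs_le]
    have h7 : c' * |z.arg| ≤ c' * ((B + 3 / 2) * ε) := by gcongr
    have h8 : 0 ≤ c * |w.arg| := by positivity
    have h9 : 0 ≤ c' * (B + 3 / 2) * ε := by positivity
    constructor <;> linarith
  have hkey : ‖Complex.log z‖ ≤ A * ε := by
    have h9 : ‖Complex.log z‖ ≤ |(Complex.log z).re| + |(Complex.log z).im| :=
      Complex.norm_le_abs_re_add_abs_im _
    rw [Complex.log_re, Complex.log_im] at h9
    simp only [A]
    nlinarith
  have h8 : ‖1 - z‖ ≤ C * (A * ε) := (hCz z hz hz0).trans (by gcongr)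
  have h9 : ‖w - z‖ < ε := by
    calc ‖w - z‖ < _ := hw
      _ ≤ 1 / (C * A) * (C * (A * ε)) := by
          gcongr
          exact min_le_right _ _
      _ = ε := by field_simp
  linarith

lemma isPreconnected_spiralDomain (c : ℝ) : IsPreconnected (spiralDomain c) := by
  refine (StarConvex.isPathConnected (a := (0 : ℂ)) ?_
    (zero_mem_spiralDomain c)).isConnected.isPreconnected
  refine starConvex_zero_iff.2 fun z hz t h0 h1 => ?_
  simpa using real_mul_mem_spiralDomain hz h0 h1

/-! ### Germs at `1` modulo polynomials -/

lemma eventually_nhdsWithin_one_iff {D : Set ℂ} {P : ℂ → Prop} :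
    (∀ᶠ z in 𝓝[D] 1, P z) ↔ ∃ ε > 0, ∀ z ∈ D, ‖1 - z‖ < ε → P z := by
  rw [Filter.Eventually, Metric.mem_nhdsWithin_iff]
  refine exists_congr fun ε => and_congr_right fun _ => ⟨fun h z hz hze => h ⟨?_, hz⟩, fun h z hz => ?_⟩
  · rwa [Metric.mem_ball, dist_comm, dist_eq_norm]
  · refine h z hz.2 ?_
    have := hz.1
    rwa [Metric.mem_ball, dist_comm, dist_eq_norm] at this

lemma isBigO_nhdsWithin_one_iff {D : Set ℂ} {E F : Type*} [NormedAddCommGroup E]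
    [NormedAddCommGroup F] {f : ℂ → E} {g : ℂ → F} :
    f =O[𝓝[D] 1] g ↔ ∃ C > 0, ∃ ε > 0, ∀ z ∈ D, ‖1 - z‖ < ε → ‖f z‖ ≤ C * ‖g z‖ := by
  rw [isBigO_iff']
  exact exists_congr fun C => and_congr_right fun _ => eventually_nhdsWithin_one_iff

lemma isBigO_one_sub_pow_of_le {D : Set ℂ} {A B : ℕ} (h : A ≤ B) :
    (fun z : ℂ => (1 - z) ^ B) =O[𝓝[D] 1] fun z : ℂ => (1 - z) ^ A := by
  refine isBigO_nhdsWithin_one_iff.2 ⟨1, one_pos, 1, one_pos, fun z _ hz => ?_⟩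
  rw [one_mul, norm_pow, norm_pow]
  exact pow_le_pow_of_le_one (norm_nonneg _) hz.le h

lemma polynomial_isBigO_one (D : Set ℂ) (p : Polynomial ℂ) :
    (fun z => p.eval z) =O[𝓝[D] 1] fun _ => (1 : ℂ) :=
  (p.continuous.continuousAt.tendsto.isBigO_one ℂ).mono nhdsWithin_le_nhds

/-- Germs at `1` in the spiral domain that are polynomial up to `O((1 - z) ^ A)`. -/
def nearPoly (c : ℝ) (A : ℕ) : Submodule ℂ (ℂ → ℂ) where
  carrier := {F | ∃ p : Polynomial ℂ,
    (fun z => F z - p.eval z) =O[𝓝[spiralDomain c] 1] fun z => (1 - z) ^ A}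
  zero_mem' := ⟨0, by simpa using isBigO_zero _ _⟩
  add_mem' := by
    rintro F G ⟨p, hp⟩ ⟨q, hq⟩
    refine ⟨p + q, (hp.add hq).congr_left fun z => ?_⟩
    simp only [Polynomial.eval_add, Pi.add_apply]; ring
  smul_mem' := by
    rintro a F ⟨p, hp⟩
    refine ⟨Polynomial.C a * p, (hp.const_mul_left a).congr_left fun z => ?_⟩
    simp only [Polynomial.eval_mul, Polynomial.eval_C, Pi.smul_apply, smul_eq_mul]; ring

variable {c c' : ℝ} {A B : ℕ} {F G : ℂ → ℂ} {a b : ℕ → ℂ}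

lemma mem_nearPoly_of_isBigO (h : F =O[𝓝[spiralDomain c] 1] fun z => (1 - z) ^ A) :
    F ∈ nearPoly c A := ⟨0, by simpa using h⟩

lemma polynomial_mem_nearPoly (p : Polynomial ℂ) : (fun z => p.eval z) ∈ nearPoly c A :=
  ⟨p, by simpa using isBigO_zero _ _⟩

lemma const_mem_nearPoly (a : ℂ) : (fun _ => a) ∈ nearPoly c A := by
  simpa using polynomial_mem_nearPoly (c := c) (A := A) (Polynomial.C a)

lemma nearPoly_anti (h : A ≤ B) : nearPoly c B ≤ nearPoly c A :=
  fun _ ⟨p, hp⟩ => ⟨p, hp.trans (isBigO_one_sub_pow_of_le h)⟩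

lemma nearPoly_congr (h : F =ᶠ[𝓝[spiralDomain c] 1] G) (hF : F ∈ nearPoly c A) :
    G ∈ nearPoly c A := by
  obtain ⟨p, hp⟩ := hF
  exact ⟨p, hp.congr' (h.mono fun z hz => by simp only [hz]) EventuallyEq.rfl⟩

lemma isBigO_one_of_mem_nearPoly (hF : F ∈ nearPoly c A) :
    F =O[𝓝[spiralDomain c] 1] fun _ => (1 : ℂ) := by
  obtain ⟨p, hp⟩ := hF
  have h1 := (hp.trans (isBigO_one_sub_pow_of_le (Nat.zero_le A))).congr_right
    (g₂ := fun _ => (1 : ℂ)) (fun z => pow_zero _)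
  exact (h1.add (polynomial_isBigO_one _ p)).congr_left fun z => by ring

lemma mul_mem_nearPoly (hF : F ∈ nearPoly c A) (hG : G ∈ nearPoly c A) :
    (fun z => F z * G z) ∈ nearPoly c A := by
  obtain ⟨p, hp⟩ := hF
  have hGb := isBigO_one_of_mem_nearPoly hG
  obtain ⟨q, hq⟩ := hG
  refine ⟨p * q, ?_⟩
  have h1 := hp.mul hGb
  have h2 := (polynomial_isBigO_one (spiralDomain c) p).mul hq
  refine ((h1.congr_right (g₂ := fun z => (1 - z) ^ A) fun z => by simp).add
    (h2.congr_right fun z => by simp)).congr_left fun z => ?_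
  simp only [Polynomial.eval_mul]; ring

lemma _root_.AnalyticAt.mem_nearPoly (hF : AnalyticAt ℂ F 1) : F ∈ nearPoly c A := by
  obtain ⟨s, hs⟩ := hF
  have h1 := hs.isBigO_sub_partialSum_pow A
  have h2 : Tendsto (fun z : ℂ => z - 1) (𝓝 1) (𝓝 0) := by
    have : ContinuousAt (fun z : ℂ => z - 1) 1 := by fun_prop
    simpa [ContinuousAt] using this
  have h3 := (h1.comp_tendsto h2).mono (nhdsWithin_le_nhds (s := spiralDomain c))
  refine ⟨∑ k ∈ Finset.range A, Polynomial.C (s.coeff k) * (Polynomial.X - 1) ^ k, ?_⟩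
  refine (h3.congr (fun z => ?_) (fun z => ?_)).trans
    (g := fun z : ℂ => ‖1 - z‖ ^ A) (isBigO_refl _ _) |>.trans
      (isBigO_of_le _ fun z => by simp)
  · simp only [Function.comp_apply, add_sub_cancel, FormalMultilinearSeries.partialSum,
      Polynomial.eval_finsetSum]
    congr 1
    refine Finset.sum_congr rfl fun k _ => ?_
    rw [FormalMultilinearSeries.apply_eq_pow_smul_coeff]
    simp [mul_comm]
  · simp [norm_sub_rev]

/-! ### Differentiation -/

/-- Cauchy's estimate on a circle about `z` of radius proportional to `|1 - z|`. Such a circle fits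
in the larger domain, which is why the domain shrinks. -/
lemma deriv_isBigO (hc' : 0 < c') (hcc : c' < c) {a : ℝ}
    (hF : DifferentiableOn ℂ F (spiralDomain c))
    (h : F =O[𝓝[spiralDomain c] 1] fun z => ‖1 - z‖ ^ a) :
    deriv F =O[𝓝[spiralDomain c'] 1] fun z => ‖1 - z‖ ^ (a - 1) := by
  obtain ⟨C, hC, ε, hε, hb⟩ := isBigO_nhdsWithin_one_iff.1 h
  obtain ⟨κ, hκ, hball⟩ := exists_ball_subset_spiralDomain hc' hcc
  set k := min (κ / 2) (1 / 2)
  have hk : 0 < k := by positivity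
  -- On the circle `|1 - w|` lies between `1/2` and `3/2` of `|1 - z|`; the sum covers both signs of
  -- `a`.
  set K : ℝ := (1 / 2) ^ a + (3 / 2) ^ a
  have hK : 0 < K := by positivity
  refine isBigO_nhdsWithin_one_iff.2 ⟨C * K / k, by positivity, ε / 2, by positivity,
    fun z hz hze => ?_⟩
  have hz0 : 0 < ‖1 - z‖ := norm_pos_iff.2 (sub_ne_zero.2 (ne_one_of_mem_spiralDomain hz).symm)
  have hsub : Metric.closedBall z (k * ‖1 - z‖) ⊆ spiralDomain c := by
    refine (Metric.closedBall_subset_ball ?_).trans (hball z hz)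
    have : k ≤ κ / 2 := min_le_left _ _
    gcongr
    linarith
  have hR : 0 < k * ‖1 - z‖ := by positivity
  have hbd : ∀ w ∈ Metric.sphere z (k * ‖1 - z‖), ‖F w‖ ≤ C * K * ‖1 - z‖ ^ a := by
    intro w hw
    have hw' := mem_sphere_iff_norm.1 hw
    have hk2 : k ≤ 1 / 2 := min_le_right _ _
    have h1 : ‖w - z‖ ≤ 1 / 2 * ‖1 - z‖ := by rw [hw']; gcongr
    have h2 : ‖1 - w‖ ≤ 3 / 2 * ‖1 - z‖ := by
      have : ‖1 - w‖ ≤ ‖1 - z‖ + ‖w - z‖ := by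
        rw [show (1 - w) = (1 - z) - (w - z) by ring]; exact norm_sub_le _ _
      linarith
    have h3 : 1 / 2 * ‖1 - z‖ ≤ ‖1 - w‖ := by
      have : ‖1 - z‖ ≤ ‖1 - w‖ + ‖w - z‖ := by
        rw [show (1 - z) = (1 - w) + (w - z) by ring]; exact norm_add_le _ _
      linarith
    have h4 := hb w (hsub (Metric.sphere_subset_closedBall hw)) (by linarith)
    rw [Real.norm_of_nonneg (by positivity)] at h4
    have h5 : ‖1 - w‖ ^ a ≤ K * ‖1 - z‖ ^ a := by
      have p1 : 0 < (1 / 2 : ℝ) ^ a := by positivity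
      have p2 : 0 < (3 / 2 : ℝ) ^ a := by positivity
      rcases le_total 0 a with ha | ha
      · calc ‖1 - w‖ ^ a ≤ (3 / 2 * ‖1 - z‖) ^ a := by gcongr
          _ = (3 / 2) ^ a * ‖1 - z‖ ^ a := Real.mul_rpow (by norm_num) hz0.le
          _ ≤ _ := by gcongr; simp only [K]; linarith
      · calc ‖1 - w‖ ^ a ≤ (1 / 2 * ‖1 - z‖) ^ a :=
              Real.rpow_le_rpow_of_nonpos (by positivity) h3 ha
          _ = (1 / 2) ^ a * ‖1 - z‖ ^ a := Real.mul_rpow (by norm_num) hz0.le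
          _ ≤ _ := by gcongr; simp only [K]; linarith
    calc ‖F w‖ ≤ C * ‖1 - w‖ ^ a := h4
      _ ≤ C * (K * ‖1 - z‖ ^ a) := by gcongr
      _ = _ := by ring
  have hd : DiffContOnCl ℂ F (Metric.ball z (k * ‖1 - z‖)) :=
    DifferentiableOn.diffContOnCl (hF.mono ((Metric.closure_ball_subset_closedBall).trans hsub))
  have := Complex.norm_deriv_le_of_forall_mem_sphere_norm_le hR hd hbd
  refine this.trans (le_of_eq ?_)
  rw [Real.norm_of_nonneg (by positivity), Real.rpow_sub_one hz0.ne']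
  field_simp

lemma isBigO_pow_iff_rpow {D : Set ℂ} {f : ℂ → ℂ} :
    (f =O[𝓝[D] 1] fun z => (1 - z) ^ A) ↔ f =O[𝓝[D] 1] fun z => ‖1 - z‖ ^ (A : ℝ) := by
  rw [← isBigO_norm_right]
  simp only [norm_pow, Real.rpow_natCast]

lemma id_mul_isBigO {D : Set ℂ} {E : Type*} [NormedAddCommGroup E] {f : ℂ → ℂ} {g : ℂ → E}
    (h : f =O[𝓝[D] 1] g) : (fun z => z * f z) =O[𝓝[D] 1] g := by
  obtain ⟨C, hC, ε, hε, hb⟩ := isBigO_nhdsWithin_one_iff.1 h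
  refine isBigO_nhdsWithin_one_iff.2 ⟨2 * C, by positivity, min ε 1, by positivity,
    fun z hz hze => ?_⟩
  have h1 := hb z hz (hze.trans_le (min_le_left _ _))
  have h2 : ‖z‖ ≤ 2 := by
    have : ‖z‖ ≤ ‖(1 : ℂ)‖ + ‖1 - z‖ := by
      nth_rewrite 1 [show z = 1 - (1 - z) by ring]; exact norm_sub_le _ _
    rw [norm_one] at this
    linarith [hze.trans_le (min_le_right _ _)]
  rw [norm_mul, mul_assoc]
  gcongr

lemma id_mul_deriv_mem_nearPoly (hc' : 0 < c') (hcc : c' < c)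
    (hF : DifferentiableOn ℂ F (spiralDomain c)) (h : F ∈ nearPoly c (A + 1)) :
    (fun z => z * deriv F z) ∈ nearPoly c' A := by
  obtain ⟨p, hp⟩ := h
  have hd : DifferentiableOn ℂ (fun z => F z - p.eval z) (spiralDomain c) :=
    hF.sub p.differentiable.differentiableOn
  have h1 := deriv_isBigO hc' hcc hd (isBigO_pow_iff_rpow.1 hp)
  refine ⟨Polynomial.X * Polynomial.derivative p, ?_⟩
  have h2 := id_mul_isBigO h1
  simp only [Nat.cast_add, Nat.cast_one, add_sub_cancel_right] at h2
  refine (isBigO_pow_iff_rpow.2 h2).congr' ?_ EventuallyEq.rfl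
  filter_upwards [self_mem_nhdsWithin] with z hz
  have hz' := (isOpen_spiralDomain (hc'.trans hcc)).mem_nhds (spiralDomain_mono hcc.le hz)
  rw [deriv_fun_sub (hF.differentiableAt hz') p.differentiable.differentiableAt, Polynomial.deriv]
  simp only [Polynomial.eval_mul, Polynomial.eval_X]; ring

/-! ### From local to global bounds -/

/-- Away from `1` the closure of the smaller domain is a compact subset of the larger one, because
the two boundaries meet only at `1`. There a continuous function needs no growth hypothesis. -/
lemma exists_bound_of_isBigO (hc' : 0 < c') (hcc : c' < c) {a : ℝ}
    (hF : ContinuousOn F (spiralDomain c))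
    (h : F =O[𝓝[spiralDomain c] 1] fun z => ‖1 - z‖ ^ a) :
    ∃ C > 0, ∀ z ∈ spiralDomain c', ‖F z‖ ≤ C * ‖1 - z‖ ^ a := by
  obtain ⟨C, hC, ε, hε, hb⟩ := isBigO_nhdsWithin_one_iff.1 h
  have hcomp : IsCompact (closure (spiralDomain c') \ Metric.ball 1 ε) := by
    refine Metric.isCompact_of_isClosed_isBounded (isClosed_closure.sdiff Metric.isOpen_ball) ?_
    refine (Bornology.IsBounded.closure ?_).subset sdiff_subset
    exact isBounded_iff_forall_norm_le.2
      ⟨_, fun z hz => (norm_lt_of_mem_spiralDomain hc' hz).le⟩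
  have hsub : closure (spiralDomain c') \ Metric.ball 1 ε ⊆ spiralDomain c := by
    rintro z ⟨hz, hz1⟩
    refine (closure_spiralDomain_subset hcc hz).resolve_left ?_
    rintro rfl
    exact hz1 (Metric.mem_ball_self hε)
  have hcont : ContinuousOn (fun z => F z / (‖1 - z‖ ^ a : ℝ))
      (closure (spiralDomain c') \ Metric.ball 1 ε) := by
    refine (hF.mono hsub).div ?_ ?_
    · refine Complex.continuous_ofReal.comp_continuousOn (ContinuousOn.rpow_const (by fun_prop) ?_)
      intro z hz
      exact Or.inl (norm_ne_zero_iff.2 (sub_ne_zero.2 (ne_one_of_mem_spiralDomain (hsub hz)).symm))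
    · intro z hz
      have := norm_pos_iff.2 (sub_ne_zero.2 (ne_one_of_mem_spiralDomain (hsub hz)).symm)
      exact Complex.ofReal_ne_zero.2 (by positivity)
  obtain ⟨C', hC'⟩ := hcomp.exists_bound_of_continuousOn hcont
  refine ⟨max C C', by positivity, fun z hz => ?_⟩
  have hz0 : 0 < ‖1 - z‖ := norm_pos_iff.2 (sub_ne_zero.2 (ne_one_of_mem_spiralDomain hz).symm)
  rcases lt_or_ge ‖1 - z‖ ε with h1 | h1
  · have := hb z (spiralDomain_mono hcc.le hz) h1
    rw [Real.norm_of_nonneg (by positivity)] at this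
    exact this.trans (by gcongr; exact le_max_left _ _)
  · have := hC' z ⟨subset_closure hz, by
      rw [Metric.mem_ball, dist_comm, dist_eq_norm]; exact not_lt.2 h1⟩
    rw [norm_div, Complex.norm_real, Real.norm_of_nonneg (by positivity : 0 ≤ ‖1 - z‖ ^ a),
      div_le_iff₀ (by positivity)] at this
    exact this.trans (by gcongr; exact le_max_right _ _)

/-! ### Integration -/

/-- The constant is the limit of `E` at `1` along the real axis. The difference `E z - ℓ` is
estimated by integrating `E'` from `t` to `t z` along `t exp (s log z)`, a path of length `O(|1 -
z|)` inside the domain, and letting `t → 1`. The length supplies the extra power of `1 - z`. -/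
lemma exists_isBigO_sub_const (hc : 0 < c) {E E' : ℂ → ℂ}
    (hE : ∀ᶠ z in 𝓝[spiralDomain c] 1, HasDerivAt E (E' z) z)
    (h : (fun z => z * E' z) =O[𝓝[spiralDomain c] 1] fun z => (1 - z) ^ A) :
    ∃ ℓ : ℂ, (fun z => E z - ℓ) =O[𝓝[spiralDomain c] 1] fun z => (1 - z) ^ (A + 1) := by
  obtain ⟨C, hC, ε₁, hε₁, hb⟩ := isBigO_nhdsWithin_one_iff.1 h
  obtain ⟨ε₂, hε₂, hd⟩ := eventually_nhdsWithin_one_iff.1 hE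
  set ε := min (min ε₁ ε₂) 1
  have hε : 0 < ε := by positivity
  have hεε₁ : ε ≤ ε₁ := (min_le_left _ _).trans (min_le_left _ _)
  have hεε₂ : ε ≤ ε₂ := (min_le_left _ _).trans (min_le_right _ _)
  have hε1 : ε ≤ 1 := min_le_right _ _
  -- Points of the path are within `1 - t + 3 |1 - z| < 4 δ` of `1`, so both local hypotheses apply;
  -- moreover `δ ≤ 1/8` keeps `z` and `t` away from `0`.
  obtain ⟨δ, hδε⟩ : ∃ δ, 8 * δ = ε := ⟨ε / 8, by ring⟩
  have hδ : 0 < δ := by linarith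
  -- comparison along the logarithmic path
  have key : ∀ z ∈ spiralDomain c, ‖1 - z‖ < δ → ∀ t : ℝ, 1 - δ < t → t < 1 →
      ‖E (t * z) - E t‖ ≤ C * (1 - t + 3 * ‖1 - z‖) ^ A * (3 / 2 * ‖1 - z‖) := by
    intro z hz hzδ t ht ht1
    have hz2 : ‖1 - z‖ ≤ 1 / 2 := by linarith
    have hz0 := ne_zero_of_norm_one_sub_le hz2
    set u := Complex.log z
    have hu := norm_log_le hz2
    have ht0 : 0 < t := by linarith
    have hure : u.re < c * |u.im| := by
      simp only [u, Complex.log_re, Complex.log_im]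
      exact (Real.log_lt_iff_lt_exp (norm_pos_iff.2 hz0)).2 hz
    have hmem : ∀ s ∈ Icc (0 : ℝ) 1, (t * Complex.exp (s * u)) ∈ spiralDomain c ∧
        ‖1 - t * Complex.exp (s * u)‖ ≤ 1 - t + 3 * ‖1 - z‖ := by
      intro s hs
      constructor
      · have : t * Complex.exp (s * u) = Complex.exp (s * u + Real.log t) := by
          rw [Complex.exp_add, ← Complex.ofReal_exp, Real.exp_log ht0, mul_comm]
        rw [this]
        have him : (s * u + Real.log t : ℂ).im = s * u.im := by simp
        have hre : (s * u + Real.log t : ℂ).re = s * u.re + Real.log t := by simp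
        apply exp_mem_spiralDomain
        · rw [him, abs_mul, abs_of_nonneg hs.1]
          have : |u.im| ≤ Real.pi := by
            simp only [u, Complex.log_im]; exact Complex.abs_arg_le_pi z
          nlinarith [hs.1, hs.2, abs_nonneg u.im]
        · rw [him, hre, abs_mul, abs_of_nonneg hs.1]
          have := Real.log_neg ht0 ht1
          nlinarith [hs.1]
      · have h1 : ‖(s * u : ℂ)‖ ≤ 3 / 2 * ‖1 - z‖ := by
          rw [norm_mul, Complex.norm_real, Real.norm_of_nonneg hs.1]
          exact (mul_le_of_le_one_left (norm_nonneg _) hs.2).trans hu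
        have h2 := Complex.norm_exp_sub_one_le (h1.trans (by linarith))
        have h3 : (1 - t * Complex.exp (s * u)) =
            ((1 - t : ℝ) : ℂ) - t * (Complex.exp (s * u) - 1) := by push_cast; ring
        rw [h3]
        refine (norm_sub_le _ _).trans ?_
        rw [norm_mul, Complex.norm_real, Complex.norm_real, Real.norm_of_nonneg ht0.le,
          Real.norm_of_nonneg (by linarith : 0 ≤ 1 - t)]
        nlinarith [norm_nonneg (Complex.exp (s * u) - 1)]
    have hderiv : ∀ s ∈ Icc (0 : ℝ) 1, HasDerivWithinAt (fun s : ℝ => E (t * Complex.exp (s * u)))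
        (E' (t * Complex.exp (s * u)) * (t * Complex.exp (s * u) * u)) (Icc 0 1) s := by
      intro s hs
      have h1 := hd _ (hmem s hs).1 ((hmem s hs).2.trans_lt (by linarith))
      have h2 : HasDerivAt (fun s : ℝ => t * Complex.exp (s * u)) (t * Complex.exp (s * u) * u) s := by
        have h3 : HasDerivAt (fun s : ℝ => (s : ℂ) * u) u s := by
          simpa using (Complex.ofRealCLM.hasDerivAt (x := s)).mul_const u
        have := (h3.cexp).const_mul (t : ℂ)
        rwa [← mul_assoc] at this
      exact (HasDerivAt.comp s h1 h2).hasDerivWithinAt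
    have := norm_image_sub_le_of_norm_deriv_le_segment_01' hderiv
      (C := C * (1 - t + 3 * ‖1 - z‖) ^ A * (3 / 2 * ‖1 - z‖)) (fun s hs => by
        have h0 := hmem s ⟨hs.1, hs.2.le⟩
        have h1 := hb _ h0.1 (h0.2.trans_lt (by linarith))
        rw [show E' (t * Complex.exp (s * u)) * (t * Complex.exp (s * u) * u) =
          (t * Complex.exp (s * u)) * E' (t * Complex.exp (s * u)) * u by ring, norm_mul]
        rw [norm_pow] at h1
        gcongr
        refine h1.trans ?_
        gcongr
        exact h0.2)
    simpa [u, Complex.exp_log hz0] using this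
  -- the limit along the real axis
  have hlip : ∀ s t : ℝ, s ∈ Ioo (1 - δ) 1 → t ∈ Ioo (1 - δ) 1 →
      ‖E t - E s‖ ≤ 2 * C * ‖t - s‖ := by
    intro s t hs ht
    have hm : ∀ x ∈ Ioo (1 - δ) 1, (x : ℂ) ∈ spiralDomain c ∧ ‖1 - (x : ℂ)‖ < ε := by
      intro x hx
      have h1 : ‖1 - (x : ℂ)‖ = 1 - x := by
        rw [← Complex.ofReal_one, ← Complex.ofReal_sub, Complex.norm_real,
          Real.norm_of_nonneg (by linarith [hx.2])]
      refine ⟨mem_spiralDomain_of_norm_lt_one hc ?_, by rw [h1]; linarith [hx.1]⟩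
      rw [Complex.norm_real, Real.norm_of_nonneg (by linarith [hx.1])]
      exact hx.2
    refine Convex.norm_image_sub_le_of_norm_hasDerivWithin_le (f := fun x : ℝ => E x)
      (f' := fun x : ℝ => E' x) (s := Ioo (1 - δ) 1) (fun x hx => ?_) (fun x hx => ?_)
      (convex_Ioo _ _) hs ht
    · exact ((hd x (hm x hx).1 ((hm x hx).2.trans_le hεε₂)).comp_ofReal).hasDerivWithinAt
    · have h1 := hb x (hm x hx).1 ((hm x hx).2.trans_le hεε₁)
      have h2 : ‖(1 - (x : ℂ)) ^ A‖ ≤ 1 := by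
        rw [norm_pow]
        exact pow_le_one₀ (norm_nonneg _) ((hm x hx).2.le.trans hε1)
      rw [norm_mul, Complex.norm_real, Real.norm_of_nonneg (by linarith [hx.1])] at h1
      have : 1 / 2 ≤ x := by linarith [hx.1]
      nlinarith [norm_nonneg (E' x)]
  set r : ℕ → ℝ := fun n => 1 - δ / (n + 2)
  have hr : ∀ n, r n ∈ Ioo (1 - δ) 1 := fun n => by
    have h1 : 0 < δ / ((n : ℝ) + 2) := by positivity
    have h2 : δ / ((n : ℝ) + 2) < δ := div_lt_self hδ (by linarith [(Nat.cast_nonneg n : (0:ℝ) ≤ n)])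
    constructor <;> simp only [r] <;> linarith
  have hr1 : Tendsto r atTop (𝓝 1) := by
    have : Tendsto (fun n : ℕ => δ / ((n : ℝ) + 2)) atTop (𝓝 0) :=
      tendsto_const_nhds.div_atTop (tendsto_natCast_atTop_atTop.atTop_add tendsto_const_nhds)
    simpa [r] using tendsto_const_nhds.sub this
  have hcs : CauchySeq fun n => E (r n) := by
    have h1 : LipschitzOnWith (Real.toNNReal (2 * C)) (fun x : ℝ => E x) (Ioo (1 - δ) 1) :=
      LipschitzOnWith.of_dist_le_mul fun s hs t ht => by
        rw [dist_eq_norm, dist_eq_norm, Real.coe_toNNReal _ (by positivity)]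
        exact hlip t s ht hs
    refine Metric.cauchySeq_iff'.2 fun e he => ?_
    obtain ⟨N, hN⟩ := Metric.cauchySeq_iff'.1 hr1.cauchySeq (e / (2 * C)) (by positivity)
    refine ⟨N, fun n hn => ?_⟩
    have h2 := h1.dist_le_mul _ (hr n) _ (hr N)
    rw [Real.coe_toNNReal _ (by positivity)] at h2
    have h3 := hN n hn
    rw [lt_div_iff₀ (by positivity), mul_comm] at h3
    exact h2.trans_lt h3
  obtain ⟨ℓ, hℓ⟩ := cauchySeq_tendsto_of_complete hcs
  refine ⟨ℓ, isBigO_nhdsWithin_one_iff.2 ⟨C * 3 ^ A * (3 / 2), by positivity, δ, hδ,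
    fun z hz hzδ => ?_⟩⟩
  have hr1' : Tendsto (fun n => (r n : ℂ)) atTop (𝓝 1) := by
    simpa [Function.comp_def] using (Complex.continuous_ofReal.tendsto 1).comp hr1
  have hEz : ContinuousAt E z := (hd z hz (by linarith)).continuousAt
  have hl : Tendsto (fun n => ‖E (r n * z) - E (r n)‖) atTop (𝓝 ‖E z - ℓ‖) := by
    refine (Tendsto.sub (hEz.tendsto.comp ?_) hℓ).norm
    simpa using hr1'.mul_const z
  have hrhs : Tendsto (fun n => C * (1 - r n + 3 * ‖1 - z‖) ^ A * (3 / 2 * ‖1 - z‖)) atTop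
      (𝓝 (C * (1 - 1 + 3 * ‖1 - z‖) ^ A * (3 / 2 * ‖1 - z‖))) := by
    refine Tendsto.mul_const _ (Tendsto.const_mul _ (Tendsto.pow (Tendsto.add_const _ ?_) _))
    exact tendsto_const_nhds.sub hr1
  have := le_of_tendsto_of_tendsto' hl hrhs fun n => key z hz hzδ _ (hr n).1 (hr n).2
  refine this.trans (le_of_eq ?_)
  rw [norm_pow]
  ring

lemma exists_polynomial_X_mul_derivative (p : Polynomial ℂ) :
    ∃ P : Polynomial ℂ, Polynomial.X * Polynomial.derivative P + Polynomial.C (p.coeff 0) = p := by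
  induction p using Polynomial.induction_on' with
  | add p q hp hq =>
    obtain ⟨P, hP⟩ := hp
    obtain ⟨Q, hQ⟩ := hq
    refine ⟨P + Q, ?_⟩
    simp only [Polynomial.derivative_add, Polynomial.coeff_add, Polynomial.C_add]
    linear_combination hP + hQ
  | monomial n a =>
    rcases n with _ | n
    · exact ⟨0, by simp⟩
    · refine ⟨Polynomial.monomial (n + 1) (a / (n + 1)), ?_⟩
      have : (n + 1 : ℂ) ≠ 0 := Nat.cast_add_one_ne_zero n
      simp [Polynomial.X_mul_monomial, Polynomial.coeff_monomial, this]

/-- A polynomial without constant term is `z P'` for a polynomial `P`. The constant term integrates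
to a multiple of `log z`, which is analytic at `1` and therefore again polynomial up to any order.
-/
lemma mem_nearPoly_of_id_mul_deriv (hc : 0 < c) (hG : DifferentiableOn ℂ G (spiralDomain c))
    (h : (fun z => z * deriv G z) ∈ nearPoly c A) : G ∈ nearPoly c (A + 1) := by
  obtain ⟨p, hp⟩ := h
  obtain ⟨P, hP⟩ := exists_polynomial_X_mul_derivative p
  have hnear : ∀ᶠ z : ℂ in 𝓝[spiralDomain c] 1, z ∈ Complex.slitPlane :=
    nhdsWithin_le_nhds (Complex.isOpen_slitPlane.mem_nhds Complex.one_mem_slitPlane)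
  have hE : ∀ᶠ z in 𝓝[spiralDomain c] 1, HasDerivAt
      (fun z => G z - P.eval z - p.coeff 0 * Complex.log z)
      (deriv G z - P.derivative.eval z - p.coeff 0 * z⁻¹) z := by
    filter_upwards [hnear, self_mem_nhdsWithin] with z hz hzD
    exact ((hG.differentiableAt ((isOpen_spiralDomain hc).mem_nhds hzD)).hasDerivAt.sub
      (P.hasDerivAt z)).sub ((Complex.hasDerivAt_log hz).const_mul _)
  obtain ⟨ℓ, hℓ⟩ := exists_isBigO_sub_const (A := A) hc hE (by
    refine hp.congr' ?_ EventuallyEq.rfl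
    filter_upwards [hnear] with z hz
    have hz0 : z ≠ 0 := Complex.slitPlane_ne_zero hz
    nth_rewrite 1 [← hP]
    simp only [Polynomial.eval_add, Polynomial.eval_mul, Polynomial.eval_X, Polynomial.eval_C]
    field_simp
    ring)
  have h1 : (fun z => p.coeff 0 * Complex.log z) ∈ nearPoly c (A + 1) :=
    AnalyticAt.mem_nearPoly (analyticAt_const.mul (analyticAt_clog Complex.one_mem_slitPlane))
  have h2 := add_mem (add_mem (mem_nearPoly_of_isBigO hℓ) h1)
    (add_mem (polynomial_mem_nearPoly P) (const_mem_nearPoly ℓ))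
  refine nearPoly_congr (Eventually.of_forall fun z => ?_) h2
  simp only [Pi.add_apply]
  ring

/-! ### Holomorphic parameter integrals -/

section ParametricIntegral

variable {α : Type*} [MeasurableSpace α] {μ : Measure α} {U : Set ℂ} {f : ℂ → α → ℂ}

/-- Domination of `f` itself suffices: Cauchy's estimate turns it into domination of the derivative
on a smaller disc. -/
lemma hasDerivAt_integral_of_holomorphic (hU : IsOpen U)
    (hmeas : ∀ z ∈ U, AEStronglyMeasurable (f z) μ)
    (hdiff : ∀ᵐ x ∂μ, DifferentiableOn ℂ (fun z => f z x) U) {z₀ : ℂ} (hz₀ : z₀ ∈ U)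
    (hbound : ∃ V ∈ 𝓝 z₀, ∃ g : α → ℝ, Integrable g μ ∧ ∀ᵐ x ∂μ, ∀ z ∈ V, ‖f z x‖ ≤ g x) :
    HasDerivAt (fun z => ∫ x, f z x ∂μ) (∫ x, deriv (fun z => f z x) z₀ ∂μ) z₀ := by
  obtain ⟨V, hV, g, hg, hfg⟩ := hbound
  obtain ⟨r, hr, hball⟩ := Metric.mem_nhds_iff.1 (inter_mem hV (hU.mem_nhds hz₀))
  have hsubV : Metric.ball z₀ r ⊆ V := hball.trans inter_subset_left
  have hsubU : Metric.ball z₀ r ⊆ U := hball.trans inter_subset_right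
  have hderiv_le : ∀ᵐ x ∂μ, ∀ z ∈ Metric.ball z₀ (r / 2),
      ‖deriv (fun z => f z x) z‖ ≤ g x / (r / 4) := by
    filter_upwards [hdiff, hfg] with x hx hgx z hz
    have hsub : Metric.closedBall z (r / 4) ⊆ Metric.ball z₀ r := by
      intro w hw
      rw [Metric.mem_closedBall] at hw
      rw [Metric.mem_ball] at hz ⊢
      linarith [dist_triangle w z z₀]
    refine Complex.norm_deriv_le_of_forall_mem_sphere_norm_le (by linarith)
      (DifferentiableOn.diffContOnCl (hx.mono
        ((Metric.closure_ball_subset_closedBall).trans (hsub.trans hsubU)))) fun w hw => ?_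
    exact hgx w (hsubV (hsub (Metric.sphere_subset_closedBall hw)))
  refine (hasDerivAt_integral_of_dominated_loc_of_deriv_le (bound := fun x => g x / (r / 4))
    (Metric.ball_mem_nhds z₀ (half_pos hr)) ?_ ?_ ?_ hderiv_le (hg.div_const _) ?_).2
  · filter_upwards [hU.mem_nhds hz₀] with z hz using hmeas z hz
  · refine hg.mono' (hmeas z₀ hz₀) ?_
    filter_upwards [hfg] with x hx using hx z₀ (mem_of_mem_nhds hV)
  -- The derivative is measurable in `x` as a limit of difference quotients along a real sequence
  -- tending to `0`.
  · set s : ℕ → ℂ := fun n => ((r / 2 / (n + 1) : ℝ) : ℂ)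
    have hs0 : ∀ n, s n ≠ 0 := fun n => by
      simp only [s]; exact Complex.ofReal_ne_zero.2 (by positivity)
    have hs : Tendsto s atTop (𝓝 0) := by
      have h1 : Tendsto (fun n : ℕ => r / 2 / ((n : ℝ) + 1)) atTop (𝓝 0) :=
        tendsto_const_nhds.div_atTop (tendsto_natCast_atTop_atTop.atTop_add tendsto_const_nhds)
      have h2 := (Complex.continuous_ofReal.tendsto 0).comp h1
      rwa [Complex.ofReal_zero] at h2
    have hmem : ∀ n, z₀ + s n ∈ U := fun n => hsubU (by
      have h2 : r / 2 / ((n : ℝ) + 1) ≤ r / 2 :=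
        div_le_self (by linarith) (by linarith [(Nat.cast_nonneg n : (0 : ℝ) ≤ n)])
      rw [Metric.mem_ball, dist_eq_norm, add_sub_cancel_left, Complex.norm_real,
        Real.norm_of_nonneg (by positivity)]
      linarith)
    refine aestronglyMeasurable_of_tendsto_ae (f := fun n x => (s n)⁻¹ * (f (z₀ + s n) x - f z₀ x))
      atTop (fun n => ((hmeas _ (hmem n)).sub (hmeas _ hz₀)).const_mul _) ?_
    filter_upwards [hdiff] with x hx
    have h1 := (hx.differentiableAt (hU.mem_nhds hz₀)).hasDerivAt.tendsto_slope_zero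
    exact h1.comp (tendsto_nhdsWithin_iff.2 ⟨hs, Eventually.of_forall hs0⟩)
  · filter_upwards [hdiff] with x hx z hz
    exact (hx.differentiableAt (hU.mem_nhds (hsubU
      (Metric.ball_subset_ball (by linarith) hz)))).hasDerivAt

lemma differentiableOn_integral_of_holomorphic (hU : IsOpen U)
    (hmeas : ∀ z ∈ U, AEStronglyMeasurable (f z) μ)
    (hdiff : ∀ᵐ x ∂μ, DifferentiableOn ℂ (fun z => f z x) U)
    (hbound : ∀ z₀ ∈ U,
      ∃ V ∈ 𝓝 z₀, ∃ g : α → ℝ, Integrable g μ ∧ ∀ᵐ x ∂μ, ∀ z ∈ V, ‖f z x‖ ≤ g x) :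
    DifferentiableOn ℂ (fun z => ∫ x, f z x ∂μ) U := fun z₀ hz₀ =>
  (hasDerivAt_integral_of_holomorphic hU hmeas hdiff hz₀
    (hbound z₀ hz₀)).differentiableAt.differentiableWithinAt

end ParametricIntegral

/-! ### Primitives on spiral domains -/

/-- The primitive vanishing at `0` of a function holomorphic on a domain star-shaped at `0`. -/
noncomputable def radialPrimitive (F : ℂ → ℂ) (z : ℂ) : ℂ := ∫ t in (0 : ℝ)..1, z * F (t * z)

lemma continuousOn_radial (hF : ContinuousOn F (spiralDomain c)) {z : ℂ} (hz : z ∈ spiralDomain c) :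
    ContinuousOn (fun t : ℝ => F (t * z)) (Icc 0 1) :=
  hF.comp (by fun_prop) fun _ ht => real_mul_mem_spiralDomain hz ht.1 ht.2

lemma hasDerivAt_radialPrimitive (hc : 0 < c) (hF : DifferentiableOn ℂ F (spiralDomain c))
    {z₀ : ℂ} (hz₀ : z₀ ∈ spiralDomain c) : HasDerivAt (radialPrimitive F) (F z₀) z₀ := by
  have hU := isOpen_spiralDomain hc
  have hmeas : ∀ z ∈ spiralDomain c,
      AEStronglyMeasurable (fun t : ℝ => z * F (t * z)) (volume.restrict (Ioc 0 1)) := by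
    intro z hz
    exact ((continuousOn_const.mul (continuousOn_radial hF.continuousOn hz)).mono
      Ioc_subset_Icc_self).aestronglyMeasurable measurableSet_Ioc
  have hdiff : ∀ t ∈ Ioc (0 : ℝ) 1,
      DifferentiableOn ℂ (fun z => z * F (t * z)) (spiralDomain c) := by
    intro t ht
    exact differentiableOn_id.mul (hF.comp (by fun_prop)
      fun z hz => real_mul_mem_spiralDomain hz ht.1.le ht.2)
  have hbound : ∃ V ∈ 𝓝 z₀, ∃ g : ℝ → ℝ, Integrable g (volume.restrict (Ioc (0 : ℝ) 1)) ∧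
      ∀ᵐ t : ℝ ∂(volume.restrict (Ioc (0 : ℝ) 1)), ∀ z ∈ V, ‖z * F (t * z)‖ ≤ g t := by
    obtain ⟨K, hK, hKD⟩ := exists_compact_subset hU hz₀
    have hcomp : IsCompact ((fun p : ℝ × ℂ => (p.1 : ℂ) * p.2) '' (Icc (0 : ℝ) 1 ×ˢ K)) :=
      (isCompact_Icc.prod hK).image (by fun_prop)
    obtain ⟨C, hC⟩ := hcomp.exists_bound_of_continuousOn (hF.continuousOn.mono (by
      rintro _ ⟨⟨t, z⟩, ⟨ht, hz⟩, rfl⟩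
      exact real_mul_mem_spiralDomain (hKD.2 hz) ht.1 ht.2))
    obtain ⟨C', hC'⟩ := hK.exists_bound_of_continuousOn continuousOn_id
    refine ⟨interior K, isOpen_interior.mem_nhds hKD.1, fun _ => C' * C, integrable_const _, ?_⟩
    filter_upwards [ae_restrict_mem measurableSet_Ioc] with t ht z hz
    have hz := interior_subset hz
    rw [norm_mul]
    have h1 := hC' z hz
    have h2 := hC _ ⟨(t, z), ⟨⟨ht.1.le, ht.2⟩, hz⟩, rfl⟩
    exact mul_le_mul h1 h2 (norm_nonneg _) ((norm_nonneg _).trans h1)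
  have h := hasDerivAt_integral_of_holomorphic hU hmeas
    ((ae_restrict_mem measurableSet_Ioc).mono hdiff) hz₀ hbound
  -- The `z`-derivative of `z F(t z)` equals the `t`-derivative of `t F(t z)`, so the fundamental
  -- theorem of calculus evaluates the integral.
  have h2 : ∫ t in Ioc (0 : ℝ) 1, deriv (fun z => z * F (t * z)) z₀ = F z₀ := by
    have hder : ∀ t ∈ Icc (0 : ℝ) 1, HasDerivAt (fun t : ℝ => (t : ℂ) * F (t * z₀))
        (F (t * z₀) + t * (deriv F (t * z₀) * z₀)) t := by
      intro t ht
      have h3 := (hF.differentiableAt (hU.mem_nhds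
        (real_mul_mem_spiralDomain hz₀ ht.1 ht.2))).hasDerivAt
      have h4 : HasDerivAt (fun t : ℝ => (t : ℂ) * z₀) z₀ t := by
        simpa using (Complex.ofRealCLM.hasDerivAt (x := t)).mul_const z₀
      have h5 : HasDerivAt (fun t : ℝ => (t : ℂ) * F (t * z₀))
          (1 * F (t * z₀) + t * (deriv F (t * z₀) * z₀)) t :=
        (Complex.ofRealCLM.hasDerivAt (x := t)).mul (HasDerivAt.comp (h₂ := F) t h3 h4)
      rwa [one_mul] at h5
    have hcont : ContinuousOn (fun t : ℝ => F (t * z₀) + t * (deriv F (t * z₀) * z₀)) (Icc 0 1) := by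
      have h3 := continuousOn_radial hF.continuousOn hz₀
      have h4 := continuousOn_radial (hF.deriv hU).continuousOn hz₀
      exact h3.add (ContinuousOn.mul (by fun_prop) (h4.mul continuousOn_const))
    have h6 := intervalIntegral.integral_eq_sub_of_hasDerivAt
      (f := fun t : ℝ => (t : ℂ) * F (t * z₀)) (a := 0) (b := 1)
      (fun t ht => hder t (by rwa [uIcc_of_le zero_le_one] at ht))
      (ContinuousOn.intervalIntegrable (by rwa [uIcc_of_le zero_le_one]))
    rw [intervalIntegral.integral_of_le zero_le_one] at h6
    simp only [Complex.ofReal_one, one_mul, Complex.ofReal_zero, zero_mul, sub_zero] at h6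
    rw [← h6]
    refine setIntegral_congr_fun measurableSet_Ioc fun t ht => ?_
    have h3 := (hF.differentiableAt (hU.mem_nhds
        (real_mul_mem_spiralDomain hz₀ ht.1.le ht.2))).hasDerivAt
    have h4 : HasDerivAt (fun z : ℂ => (t : ℂ) * z) t z₀ := by
      simpa using (hasDerivAt_id z₀).const_mul (t : ℂ)
    have h5 := (hasDerivAt_id z₀).mul (HasDerivAt.comp (h₂ := F) z₀ h3 h4)
    have h7 : deriv (fun z => z * F (t * z)) z₀ = 1 * F (t * z₀) + z₀ * (deriv F (t * z₀) * t) :=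
      h5.deriv
    simp only [h7]
    ring
  rw [h2] at h
  refine h.congr_of_eventuallyEq (Eventually.of_forall fun z => ?_)
  simp only [radialPrimitive, intervalIntegral.integral_of_le zero_le_one]

/-! ### Continuation of power series to spiral domains -/

/-- `F` is holomorphic on the spiral domain and is the sum of `∑ aₙ zⁿ` in the unit disc. -/
def Continues (c : ℝ) (a : ℕ → ℂ) (F : ℂ → ℂ) : Prop :=
  DifferentiableOn ℂ F (spiralDomain c) ∧ ∀ z : ℂ, ‖z‖ < 1 → HasSum (fun n => a n * z ^ n) (F z)

namespace Continues

lemma mono (h : c' ≤ c) (hF : Continues c a F) : Continues c' a F :=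
  ⟨hF.1.mono (spiralDomain_mono h), hF.2⟩

lemma add (hF : Continues c a F) (hG : Continues c b G) : Continues c (a + b) (F + G) :=
  ⟨hF.1.add hG.1, fun z hz => by simpa [add_mul] using (hF.2 z hz).add (hG.2 z hz)⟩

lemma smul (k : ℂ) (hF : Continues c a F) : Continues c (k • a) (k • F) :=
  ⟨hF.1.const_smul k, fun z hz => by simpa [mul_assoc] using (hF.2 z hz).mul_left k⟩

lemma sub (hF : Continues c a F) (hG : Continues c b G) : Continues c (a - b) (F - G) := by
  simpa [sub_eq_add_neg] using hF.add (hG.smul (-1))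

lemma polynomial (p : Polynomial ℂ) : Continues c p.coeff fun z => p.eval z := by
  refine ⟨p.differentiable.differentiableOn, fun z _ => ?_⟩
  simp only [Polynomial.eval_eq_sum_range]
  exact hasSum_sum_of_ne_finset_zero fun n hn => by
    rw [Polynomial.coeff_eq_zero_of_natDegree_lt (by simpa using hn), zero_mul]

lemma const (k : ℂ) : Continues c (Pi.single 0 k) fun _ => k := by
  convert polynomial (c := c) (Polynomial.C k) using 1
  · ext n; simp [Polynomial.coeff_C, Pi.single_apply]
  · simp

lemma apply_zero (hF : Continues c a F) : F 0 = a 0 := by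
  refine (hF.2 0 (by simp)).unique ?_
  convert hasSum_ite_eq (0 : ℕ) (a 0) using 2 with n
  split_ifs with h <;> simp [h]

lemma congr_fun_zero_series (hF : Continues c a F) (h : ∀ n, a n = b n) : Continues c b F := by
  rwa [← funext h]

lemma summable_norm (hF : Continues c a F) {r : ℝ} (h0 : 0 ≤ r) (h1 : r < 1) :
    Summable fun n => ‖a n‖ * r ^ n := by
  have := (hF.2 r (by rwa [Complex.norm_real, Real.norm_of_nonneg h0])).summable.norm
  simpa [abs_of_nonneg h0] using this

lemma deriv_hasSum (hF : Continues c a F) {z : ℂ} (hz : ‖z‖ < 1) :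
    HasSum (fun n => a (n + 1) * (n + 1) * z ^ n) (deriv F z) := by
  obtain ⟨r, hzr, hr1⟩ := exists_between hz
  have hr0 := (norm_nonneg z).trans hzr.le
  have h := Complex.hasSum_deriv_of_summable_norm (F := fun n w => a n * w ^ n)
    (U := Metric.ball 0 r) (hF.summable_norm hr0 hr1) (fun n => by fun_prop) Metric.isOpen_ball
    (fun n w hw => by
      rw [norm_mul, norm_pow]
      gcongr
      exact (by simpa using hw : ‖w‖ < r).le) (z := z) (by simpa using hzr)
  have h2 : deriv (fun w : ℂ => ∑' n, a n * w ^ n) z = deriv F z := by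
    refine EventuallyEq.deriv_eq ?_
    filter_upwards [Metric.isOpen_ball.mem_nhds (show z ∈ Metric.ball (0 : ℂ) 1 by simpa using hz)]
      with w hw
    exact (hF.2 w (by simpa using hw)).tsum_eq
  rw [h2, ← hasSum_nat_add_iff' 1] at h
  simpa [mul_assoc] using h

/-- Removing the constant term and dividing by `z`. -/
lemma shift (hc : 0 < c) (hF : Continues c a F) :
    Continues c (fun n => a (n + 1)) (dslope F 0) ∧ ∀ z, F z = a 0 + z * dslope F 0 z := by
  have h0 : spiralDomain c ∈ 𝓝 (0 : ℂ) := (isOpen_spiralDomain hc).mem_nhds (zero_mem_spiralDomain c)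
  have h1 : ∀ z, F z = a 0 + z * dslope F 0 z := by
    intro z
    have := sub_smul_dslope F 0 z
    rw [hF.apply_zero, sub_zero, smul_eq_mul] at this
    rw [this]; ring
  refine ⟨⟨(Complex.differentiableOn_dslope h0).2 hF.1, fun z hz => ?_⟩, h1⟩
  rcases eq_or_ne z 0 with rfl | hz0
  · rw [dslope_same]
    have h2 := (hF.deriv_hasSum (z := 0) (by simp)).unique
      (hasSum_single 0 fun n hn => by simp [hn])
    rw [h2]
    convert hasSum_single (f := fun n => a (n + 1) * (0 : ℂ) ^ n) 0 fun n hn => by simp [hn] using 1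
    simp
  · have h2 := (hasSum_nat_add_iff' 1).2 (hF.2 z hz)
    have h3 := h2.mul_left z⁻¹
    have h4 : z⁻¹ * (F z - ∑ i ∈ Finset.range 1, a i * z ^ i) = dslope F 0 z := by
      rw [h1 z]; simp; field_simp
    rw [h4] at h3
    refine h3.congr_fun fun n => ?_
    field_simp
    ring

/-- The Euler operator `z d/dz`. -/
lemma euler (hc : 0 < c) (hF : Continues c a F) :
    Continues c (fun n => n * a n) fun z => z * deriv F z := by
  refine ⟨differentiableOn_id.mul (hF.1.deriv (isOpen_spiralDomain hc)), fun z hz => ?_⟩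
  rw [← hasSum_nat_add_iff' 1]
  have := (hF.deriv_hasSum hz).mul_left z
  simp only [Finset.range_one, Finset.sum_singleton, Nat.cast_zero, zero_mul, sub_zero]
  refine this.congr_fun fun n => ?_
  push_cast; ring

lemma radialPrimitive_hasSum (hF : Continues c a F) {z : ℂ} (hz : ‖z‖ < 1) :
    HasSum (fun n => a n / (n + 1) * z ^ (n + 1)) (radialPrimitive F z) := by
  have h := intervalIntegral.hasSum_integral_of_dominated_convergence (μ := volume) (a := 0) (b := 1)
    (F := fun n (t : ℝ) => z * (a n * (t * z) ^ n)) (f := fun t : ℝ => z * F (t * z))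
    (fun n _ => ‖z‖ * (‖a n‖ * ‖z‖ ^ n))
    (fun n => (by fun_prop : Continuous fun t : ℝ => z * (a n * (t * z) ^ n)).aestronglyMeasurable)
    (fun n => Eventually.of_forall fun t ht => ?_)
    (Eventually.of_forall fun t _ => (hF.summable_norm (norm_nonneg z) hz).mul_left _)
    intervalIntegrable_const
    (Eventually.of_forall fun t ht => (hF.2 (t * z) ?_).mul_left z)
  · refine h.congr_fun fun n => ?_
    have h1 : ∀ t : ℝ, z * (a n * (t * z) ^ n) = a n * z ^ (n + 1) * ((t ^ n : ℝ) : ℂ) := by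
      intro t; push_cast; ring
    simp only [h1]
    rw [intervalIntegral.integral_const_mul, intervalIntegral.integral_ofReal, integral_pow]
    push_cast
    simp
    ring
  all_goals
    rw [uIoc_of_le zero_le_one] at ht
    have h1 : ‖(t : ℂ) * z‖ ≤ ‖z‖ := by
      rw [norm_mul, Complex.norm_real, Real.norm_of_nonneg ht.1.le]
      exact mul_le_of_le_one_left (norm_nonneg _) ht.2
  · rw [norm_mul, norm_mul, norm_pow]
    gcongr
  · exact h1.trans_lt hz

/-- Uniqueness of analytic continuation to a spiral domain. -/
lemma eqOn (hc : 0 < c) (hF : Continues c a F) (hG : Continues c a G) :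
    EqOn F G (spiralDomain c) := by
  have hU := isOpen_spiralDomain hc
  refine (hF.1.analyticOnNhd hU).eqOn_of_preconnected_of_eventuallyEq (hG.1.analyticOnNhd hU)
    (isPreconnected_spiralDomain c) (zero_mem_spiralDomain c) ?_
  filter_upwards [Metric.ball_mem_nhds (0 : ℂ) one_pos] with z hz
  exact (hF.2 z (by simpa using hz)).unique (hG.2 z (by simpa using hz))

/-- Inverting the Euler operator. -/
lemma exists_antiEuler (hc : 0 < c) (hF : Continues c a F) : ∃ G, Continues c (fun n => a n / n) G ∧
    (∀ z ∈ spiralDomain c, z * deriv G z = F z - a 0) ∧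
    ∀ z, G z = radialPrimitive (dslope F 0) z := by
  obtain ⟨hS, hFS⟩ := hF.shift hc
  refine ⟨radialPrimitive (dslope F 0), ⟨fun z hz =>
    (hasDerivAt_radialPrimitive hc hS.1 hz).differentiableAt.differentiableWithinAt, fun z hz => ?_⟩,
    fun z hz => ?_, fun _ => rfl⟩
  -- The coefficient of index `0` is `a 0 / 0 = 0`, so the sum may start at `1`.
  · rw [← hasSum_nat_add_iff' 1]
    simpa using hS.radialPrimitive_hasSum hz
  · rw [(hasDerivAt_radialPrimitive hc hS.1 hz).deriv, hFS z]; ring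

/-- In the radial integral `|1 - t z|^{-(r + 1/2)}` is at most a constant times `|1 - z|^{-r} (1 -
t)^{-1/2}`, and the last factor is integrable. A gain of one half is not optimal, but it holds
uniformly for `r ≥ 0` without logarithmic cases, and it can be iterated. -/
lemma exists_antiEuler_growth (hc' : 0 < c') (hcc : c' < c) (hF : Continues c a F) {r : ℝ}
    (hr : 0 ≤ r) (h : F =O[𝓝[spiralDomain c] 1] fun z => ‖1 - z‖ ^ (-(r + 1 / 2))) :
    ∃ G, Continues c' (fun n => a n / n) G ∧
      G =O[𝓝[spiralDomain c'] 1] fun z => ‖1 - z‖ ^ (-r) := by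
  have hc := hc'.trans hcc
  obtain ⟨G, hG, -, hGP⟩ := hF.exists_antiEuler hc
  obtain ⟨hS, hFS⟩ := hF.shift hc
  refine ⟨G, hG.mono hcc.le, ?_⟩
  have hloc : (dslope F 0) =O[𝓝[spiralDomain c] 1] fun z => ‖1 - z‖ ^ (-(r + 1 / 2)) := by
    have h1 : (fun _ : ℂ => a 0) =O[𝓝[spiralDomain c] 1] fun z => ‖1 - z‖ ^ (-(r + 1 / 2)) := by
      refine isBigO_nhdsWithin_one_iff.2 ⟨‖a 0‖ + 1, by positivity, 1, one_pos, fun z hz hz1 => ?_⟩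
      have hz0 : 0 < ‖1 - z‖ := norm_pos_iff.2 (sub_ne_zero.2 (ne_one_of_mem_spiralDomain hz).symm)
      rw [Real.norm_of_nonneg (by positivity)]
      have : 1 ≤ ‖1 - z‖ ^ (-(r + 1 / 2)) :=
        Real.one_le_rpow_of_pos_of_le_one_of_nonpos hz0 hz1.le (by linarith)
      nlinarith [norm_nonneg (a 0)]
    have h2 := h.sub h1
    obtain ⟨C, hC, ε, hε, hb⟩ := isBigO_nhdsWithin_one_iff.1 h2
    refine isBigO_nhdsWithin_one_iff.2 ⟨2 * C, by positivity, min ε (1 / 2), by positivity,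
      fun z hz hze => ?_⟩
    have h3 := hb z hz (hze.trans_le (min_le_left _ _))
    have h4 : 1 / 2 ≤ ‖z‖ := by
      have : ‖(1 : ℂ)‖ ≤ ‖1 - z‖ + ‖z‖ := by
        nth_rewrite 1 [show (1 : ℂ) = (1 - z) + z by ring]; exact norm_add_le _ _
      rw [norm_one] at this
      linarith [hze.trans_le (min_le_right _ _)]
    have h5 : F z - a 0 = z * dslope F 0 z := by rw [hFS z]; ring
    rw [h5, norm_mul] at h3
    nlinarith [norm_nonneg (dslope F 0 z)]
  obtain ⟨C, hC, hb⟩ := exists_bound_of_isBigO hc' hcc hS.1.continuousOn hloc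
  obtain ⟨K, hK, hKz⟩ := norm_one_sub_le_mul_norm_one_sub_mul hc'
  have hint : IntervalIntegrable (fun t : ℝ => (1 - t) ^ (-(1 / 2) : ℝ)) volume 0 1 := by
    have := (intervalIntegral.intervalIntegrable_rpow' (a := 1) (b := 0) (r := (-(1 / 2) : ℝ))
      (by norm_num)).comp_sub_left 1
    simpa using this
  set M := ∫ t in (0 : ℝ)..1, (1 - t) ^ (-(1 / 2) : ℝ)
  refine isBigO_nhdsWithin_one_iff.2
    ⟨max 1 (2 * C * (K ^ r * K ^ (1 / 2 : ℝ)) * M), by positivity, 1, one_pos, fun z hz hz1 => ?_⟩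
  have hz0 : 0 < ‖1 - z‖ := norm_pos_iff.2 (sub_ne_zero.2 (ne_one_of_mem_spiralDomain hz).symm)
  have hz2 : ‖z‖ ≤ 2 := by
    have : ‖z‖ ≤ ‖(1 : ℂ)‖ + ‖1 - z‖ := by
      nth_rewrite 1 [show z = 1 - (1 - z) by ring]; exact norm_sub_le _ _
    rw [norm_one] at this
    linarith
  rw [hGP, radialPrimitive, Real.norm_of_nonneg (by positivity)]
  have h1 := intervalIntegral.norm_integral_le_of_norm_le (μ := volume) (f := fun t : ℝ => z * dslope F 0 (t * z))
    (g := fun t => 2 * C * (K ^ r * K ^ (1 / 2 : ℝ)) * ‖1 - z‖ ^ (-r) * (1 - t) ^ (-(1 / 2) : ℝ))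
    zero_le_one ?_ (hint.const_mul _)
  · refine h1.trans ?_
    rw [intervalIntegral.integral_const_mul]
    calc _ = (2 * C * (K ^ r * K ^ (1 / 2 : ℝ)) * M) * ‖1 - z‖ ^ (-r) := by ring
      _ ≤ _ := by gcongr; exact le_max_right _ _
  -- At `t = 1` the majorant takes the default value `0 ^ (-1/2) = 0`, so this null set is
  -- discarded.
  · have hne : ∀ᵐ t : ℝ, t ≠ 1 := by simp [ae_iff]
    filter_upwards [hne] with t ht1 ht
    have ht2 : t < 1 := lt_of_le_of_ne ht.2 ht1
    have h2 := hb _ (real_mul_mem_spiralDomain hz ht.1.le ht.2)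
    obtain ⟨h3, h4⟩ := hKz z hz t ht.1.le ht.2
    have h5 : 0 < ‖1 - t * z‖ := by
      by_contra h
      have : ‖1 - t * z‖ = 0 := le_antisymm (not_lt.1 h) (norm_nonneg _)
      rw [this] at h3; linarith
    have h6 : ‖1 - t * z‖ ^ (-r) ≤ K ^ r * ‖1 - z‖ ^ (-r) := by
      have := Real.rpow_le_rpow_of_nonpos (z := -r) hz0 h4 (by linarith)
      rw [Real.mul_rpow hK.le h5.le, Real.rpow_neg hK.le] at this
      have hKr : 0 < K ^ r := by positivity
      rw [inv_mul_le_iff₀ hKr] at this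
      exact this
    have h7 : ‖1 - t * z‖ ^ (-(1 / 2) : ℝ) ≤ K ^ (1 / 2 : ℝ) * (1 - t) ^ (-(1 / 2) : ℝ) := by
      have := Real.rpow_le_rpow_of_nonpos (z := -(1 / 2)) (by linarith : 0 < 1 - t) h3 (by norm_num)
      rw [Real.mul_rpow hK.le h5.le, Real.rpow_neg hK.le] at this
      have hKr : 0 < K ^ (1 / 2 : ℝ) := by positivity
      rw [inv_mul_le_iff₀ hKr] at this
      exact this
    rw [norm_mul]
    rw [neg_add, Real.rpow_add h5] at h2
    have h8 : 0 ≤ (1 - t) ^ (-(1 / 2) : ℝ) := Real.rpow_nonneg (by linarith) _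
    calc ‖z‖ * ‖dslope F 0 (t * z)‖
        ≤ 2 * (C * ((K ^ r * ‖1 - z‖ ^ (-r)) * (K ^ (1 / 2 : ℝ) * (1 - t) ^ (-(1 / 2) : ℝ)))) := by
          gcongr
          refine h2.trans ?_
          gcongr
      _ = _ := by ring

lemma exists_antiEuler_nearPoly (hc : 0 < c) (hF : Continues c a F) (h : F ∈ nearPoly c A) :
    ∃ G, Continues c (fun n => a n / n) G ∧ G ∈ nearPoly c (A + 1) := by
  obtain ⟨G, hG, hGF, -⟩ := hF.exists_antiEuler hc
  refine ⟨G, hG, mem_nearPoly_of_id_mul_deriv hc hG.1 ?_⟩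
  refine nearPoly_congr ?_ (sub_mem h (const_mem_nearPoly (a 0)))
  filter_upwards [self_mem_nhdsWithin] with z hz
  simp [hGF z hz]

lemma exists_iterate_antiEuler_nearPoly (hc : 0 < c) (K : ℕ) (hF : Continues c a F)
    (h : F ∈ nearPoly c A) : ∃ G, Continues c (fun n => a n / n ^ K) G ∧ G ∈ nearPoly c (A + K) := by
  induction K with
  | zero => exact ⟨F, by simpa using hF, h⟩
  | succ K ih =>
    obtain ⟨G, hG, hGn⟩ := ih
    obtain ⟨H, hH, hHn⟩ := hG.exists_antiEuler_nearPoly hc hGn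
    refine ⟨H, ?_, hHn⟩
    convert hH using 2 with n
    rw [pow_succ, div_div]

/-- Each inversion gains one half in the exponent and shrinks the domain a little. This explains the
exponent `m / 2` and the quantification over `c` inside the induction. -/
lemma exists_iterate_antiEuler_bounded (hc' : 0 < c') (m : ℕ) : ∀ {c : ℝ} {a : ℕ → ℂ} {F : ℂ → ℂ},
    c' < c → Continues c a F →
    (F =O[𝓝[spiralDomain c] 1] fun z => ‖1 - z‖ ^ (-(m / 2) : ℝ)) →
    ∃ G, Continues c' (fun n => a n / n ^ m) G ∧
      G =O[𝓝[spiralDomain c'] 1] fun z => ‖1 - z‖ ^ (0 : ℝ) := by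
  induction m with
  | zero =>
    intro c a F hcc hF h
    refine ⟨F, by simpa using hF.mono hcc.le, ?_⟩
    simpa using h.mono (nhdsWithin_mono _ (spiralDomain_mono hcc.le))
  | succ m ih =>
    intro c a F hcc hF h
    obtain ⟨d, hd1, hd2⟩ := exists_between hcc
    obtain ⟨G, hG, hGb⟩ := hF.exists_antiEuler_growth (hc'.trans hd1) hd2 (r := m / 2) (by positivity)
      (by convert h using 3; push_cast; ring)
    obtain ⟨H, hH, hHb⟩ := ih hd1 hG hGb
    refine ⟨H, ?_, hHb⟩
    convert hH using 2 with n
    rw [pow_succ', div_div]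

lemma exists_iterate_euler (hc' : 0 < c') (k : ℕ) : ∀ {c : ℝ} {a : ℕ → ℂ} {F : ℂ → ℂ} {r : ℝ},
    c' < c → Continues c a F → (F =O[𝓝[spiralDomain c] 1] fun z => ‖1 - z‖ ^ r) →
    ∃ G, Continues c' (fun n => n ^ k * a n) G ∧
      G =O[𝓝[spiralDomain c'] 1] fun z => ‖1 - z‖ ^ (r - k) := by
  induction k with
  | zero =>
    intro c a F r hcc hF h
    refine ⟨F, by simpa using hF.mono hcc.le, ?_⟩
    simpa using h.mono (nhdsWithin_mono _ (spiralDomain_mono hcc.le))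
  | succ k ih =>
    intro c a F r hcc hF h
    obtain ⟨d, hd1, hd2⟩ := exists_between hcc
    have hd0 := hc'.trans hd1
    have hG := (hF.euler (hd0.trans hd2)).mono hd2.le
    obtain ⟨H, hH, hHb⟩ := ih hd1 hG (id_mul_isBigO (deriv_isBigO hd0 hd2 hF.1 h))
    refine ⟨H, ?_, ?_⟩
    · convert hH using 2 with n
      ring
    · convert hHb using 3
      push_cast; ring

end Continues

/-! ### Integration along the boundary of a spiral domain -/

/-- The integral of `Φ(t) dt / t` along the arc `t = exp (d y)`, `0 ≤ y ≤ π`. -/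
noncomputable def arcIntegral (d : ℂ) (Φ : ℂ → ℂ) : ℂ :=
  ∫ y in (0 : ℝ)..Real.pi, Φ (Complex.exp (d * y)) * d

/-- The integral of `Φ(t) dt / t` along the boundary of `spiralDomain c`. -/
noncomputable def loopIntegral (c : ℝ) (Φ : ℂ → ℂ) : ℂ :=
  arcIntegral (c + I) Φ - arcIntegral (c - I) Φ

section Arc

variable {d : ℂ} {y : ℝ}

lemma arc_mem (hcc : c' < c) (hre : d.re = c') (him : |d.im| = 1)
    (hy : y ∈ Ioc 0 Real.pi) : Complex.exp (d * y) ∈ spiralDomain c := by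
  have h1 : |(d * y).im| = y := by simp [abs_mul, him, abs_of_pos hy.1]
  refine exp_mem_spiralDomain (by rw [h1]; exact hy.2) ?_
  rw [h1]
  simp only [Complex.mul_re, Complex.ofReal_re, Complex.ofReal_im, mul_zero, sub_zero, hre]
  exact mul_lt_mul_of_pos_right hcc hy.1

lemma arc_notMem (hc' : 0 < c') (hre : d.re = c') (him : |d.im| = 1) (hy : 0 ≤ y) :
    Complex.exp (d * y) ∉ spiralDomain c' := by
  refine exp_notMem_spiralDomain hc' ?_
  simp [abs_mul, him, abs_of_nonneg hy, hre]

lemma real_mul_arc_mem (hcc : c' < c) (hre : d.re = c') (him : |d.im| = 1)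
    (hy : y ∈ Icc 0 Real.pi) {s : ℝ} (hs0 : 0 < s) (hs1 : s < 1) :
    s * Complex.exp (d * y) ∈ spiralDomain c := by
  have h0 : s * Complex.exp (d * y) = Complex.exp (d * y + Real.log s) := by
    rw [Complex.exp_add, ← Complex.ofReal_exp, Real.exp_log hs0, mul_comm]
  have h1 : |(d * y + Real.log s : ℂ).im| = y := by simp [abs_mul, him, abs_of_nonneg hy.1]
  rw [h0]
  refine exp_mem_spiralDomain (by rw [h1]; exact hy.2) ?_
  rw [h1]
  simp only [Complex.add_re, Complex.mul_re, Complex.ofReal_re, Complex.ofReal_im, mul_zero,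
    sub_zero, hre]
  have := Real.log_neg hs0 hs1
  have := mul_le_mul_of_nonneg_right hcc.le hy.1
  linarith

/-- Continuity and boundedness on the part of the spiral domain outside the unit disc. -/
def BoundedOutside (c : ℝ) (Φ : ℂ → ℂ) : Prop :=
  ContinuousOn Φ (spiralDomain c ∩ {t | 1 ≤ ‖t‖}) ∧
    ∃ C, ∀ t ∈ spiralDomain c, 1 ≤ ‖t‖ → ‖Φ t‖ ≤ C

lemma BoundedOutside.mul {Φ Ψ : ℂ → ℂ} (h₁ : BoundedOutside c Φ) (h₂ : BoundedOutside c Ψ) :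
    BoundedOutside c (fun t => Φ t * Ψ t) := by
  obtain ⟨h₁, C₁, hC₁⟩ := h₁
  obtain ⟨h₂, C₂, hC₂⟩ := h₂
  refine ⟨h₁.mul h₂, C₁ * C₂, fun t ht ht1 => ?_⟩
  rw [norm_mul]
  exact mul_le_mul (hC₁ t ht ht1) (hC₂ t ht ht1) (norm_nonneg _)
    ((norm_nonneg _).trans (hC₁ t ht ht1))

lemma boundedOutside_const (k : ℂ) : BoundedOutside c fun _ => k :=
  ⟨continuousOn_const, ‖k‖, fun _ _ _ => le_rfl⟩

lemma boundedOutside_id (hc : 0 < c) : BoundedOutside c fun t => t :=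
  ⟨continuousOn_id, _, fun _ ht _ => (norm_lt_of_mem_spiralDomain hc ht).le⟩

lemma boundedOutside_inv_pow (n : ℕ) : BoundedOutside c fun t => t⁻¹ ^ n := by
  refine ⟨ContinuousOn.pow (continuousOn_id.inv₀ fun t ht h => ?_) n, 1, fun t _ ht => ?_⟩
  · have := ht.2
    simp only [id] at h
    rw [h] at this
    norm_num at this
  · rw [norm_pow, norm_inv]
    exact pow_le_one₀ (by positivity) (inv_le_one_of_one_le₀ ht)

lemma BoundedOutside.continuousOn_arc {Φ : ℂ → ℂ} (h : BoundedOutside c Φ) (hc' : 0 < c')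
    (hcc : c' < c) (hre : d.re = c') (him : |d.im| = 1) :
    ContinuousOn (fun y : ℝ => Φ (Complex.exp (d * y)) * d) (Ioc 0 Real.pi) :=
  (h.1.comp (by fun_prop) fun _ hy => ⟨arc_mem hcc hre him hy,
    one_le_norm_of_notMem hc' (arc_notMem hc' hre him hy.1.le)⟩).mul continuousOn_const

lemma BoundedOutside.intervalIntegrable {Φ : ℂ → ℂ} (h : BoundedOutside c Φ) (hc' : 0 < c')
    (hcc : c' < c) (hre : d.re = c') (him : |d.im| = 1) :
    IntervalIntegrable (fun y : ℝ => Φ (Complex.exp (d * y)) * d) volume 0 Real.pi := by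
  have h1 := h.continuousOn_arc hc' hcc hre him
  obtain ⟨-, C, hC⟩ := h
  rw [intervalIntegrable_iff_integrableOn_Ioc_of_le Real.pi_pos.le]
  refine Integrable.mono' (g := fun _ => C * ‖d‖) (integrable_const _)
    (h1.aestronglyMeasurable measurableSet_Ioc) ?_
  filter_upwards [ae_restrict_mem measurableSet_Ioc] with y hy
  rw [norm_mul]
  gcongr
  exact hC _ (arc_mem hcc hre him hy)
    (one_le_norm_of_notMem hc' (arc_notMem hc' hre him hy.1.le))

end Arc

lemma abs_im_add_I (c : ℝ) : |((c : ℂ) + I).im| = 1 := by simp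

lemma abs_im_sub_I (c : ℝ) : |((c : ℂ) - I).im| = 1 := by simp

lemma exp_add_I_mul_pi (c : ℝ) :
    Complex.exp ((c + I) * Real.pi) = Complex.exp ((c - I) * Real.pi) := by
  rw [show ((c : ℂ) + I) * Real.pi = (c - I) * Real.pi + 2 * Real.pi * I by ring,
    Complex.exp_add, Complex.exp_two_pi_mul_I, mul_one]

lemma loopIntegral_add (hc' : 0 < c') (hcc : c' < c) {Φ Ψ : ℂ → ℂ} (hΦ : BoundedOutside c Φ)
    (hΨ : BoundedOutside c Ψ) :
    loopIntegral c' (fun t => Φ t + Ψ t) = loopIntegral c' Φ + loopIntegral c' Ψ := by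
  have key : ∀ d : ℂ, d.re = c' → |d.im| = 1 →
      arcIntegral d (fun t => Φ t + Ψ t) = arcIntegral d Φ + arcIntegral d Ψ := by
    intro d hre him
    simp only [arcIntegral, add_mul]
    exact intervalIntegral.integral_add (hΦ.intervalIntegrable hc' hcc hre him)
      (hΨ.intervalIntegrable hc' hcc hre him)
  simp only [loopIntegral]
  rw [key _ (by simp) (abs_im_add_I _), key _ (by simp) (abs_im_sub_I _)]
  ring

lemma loopIntegral_const_mul (c : ℝ) (k : ℂ) (Φ : ℂ → ℂ) :
    loopIntegral c (fun t => k * Φ t) = k * loopIntegral c Φ := by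
  simp only [loopIntegral, arcIntegral, mul_assoc, intervalIntegral.integral_const_mul]
  rw [mul_sub]

lemma loopIntegral_one (c : ℝ) : loopIntegral c (fun _ => 1) = 2 * Real.pi * I := by
  simp only [loopIntegral, arcIntegral, one_mul, intervalIntegral.integral_const, sub_zero]
  simp only [Complex.real_smul]
  ring

/-- The integrand has an explicit primitive, and the two arcs share both endpoints. -/
lemma loopIntegral_inv_pow_succ (hc : 0 < c) (n : ℕ) :
    loopIntegral c (fun t => t⁻¹ ^ (n + 1)) = 0 := by
  have key : ∀ d : ℂ, d ≠ 0 → arcIntegral d (fun t => t⁻¹ ^ (n + 1)) =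
      (-(n + 1 : ℂ))⁻¹ * (Complex.exp (d * Real.pi))⁻¹ ^ (n + 1) - (-(n + 1 : ℂ))⁻¹ := by
    intro d hd
    have hn : (n + 1 : ℂ) ≠ 0 := Nat.cast_add_one_ne_zero n
    have he : ∀ y : ℝ, (Complex.exp (d * y))⁻¹ ^ (n + 1) = Complex.exp (-(n + 1) * d * y) := by
      intro y
      rw [← Complex.exp_neg, ← Complex.exp_nat_mul]
      congr 1; push_cast; ring
    have h := intervalIntegral.integral_eq_sub_of_hasDerivAt (a := 0) (b := Real.pi)
      (f := fun y : ℝ => (-(n + 1 : ℂ))⁻¹ * Complex.exp (-(n + 1) * d * y))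
      (f' := fun y : ℝ => (Complex.exp (d * y))⁻¹ ^ (n + 1) * d) (fun y _ => by
        have h1 : HasDerivAt (fun y : ℝ => -(n + 1 : ℂ) * d * y) (-(n + 1) * d) y := by
          simpa using (Complex.ofRealCLM.hasDerivAt (x := y)).const_mul (-(n + 1 : ℂ) * d)
        refine ((h1.cexp).const_mul (-(n + 1 : ℂ))⁻¹).congr_deriv ?_
        rw [he]
        field_simp)
      (Continuous.intervalIntegrable (by simp only [he]; fun_prop) _ _)
    simp only [arcIntegral]
    rw [h, he]
    simp
  have h1 : (c : ℂ) + I ≠ 0 := fun h => by simpa [hc.ne'] using congrArg Complex.re h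
  have h2 : (c : ℂ) - I ≠ 0 := fun h => by simpa [hc.ne'] using congrArg Complex.re h
  rw [loopIntegral, key _ h1, key _ h2, exp_add_I_mul_pi]
  ring

/-- Cauchy's theorem for a contour through the possibly singular point `1`. The contour is first
contracted by a factor `s < 1`, where a primitive exists and both arcs have common endpoints; then
`s → 1` by dominated convergence. The contracted contour stays in `|z| ≥ 1/2`, the only place where
a bound on `F` is needed. -/
lemma loopIntegral_id_mul (hc' : 0 < c') (hcc : c' < c) (hF : DifferentiableOn ℂ F (spiralDomain c))
    (hb : ∃ C, ∀ z ∈ spiralDomain c, 1 / 2 ≤ ‖z‖ → ‖F z‖ ≤ C) :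
    loopIntegral c' (fun t => t * F t) = 0 := by
  have hc := hc'.trans hcc
  set s : ℕ → ℝ := fun n => 1 - 1 / (n + 2)
  have hs : ∀ n, 1 / 2 ≤ s n ∧ s n < 1 := fun n => by
    have h0 : (0 : ℝ) ≤ n := Nat.cast_nonneg n
    have h1 : 0 < 1 / ((n : ℝ) + 2) := by positivity
    have h2 : 1 / ((n : ℝ) + 2) ≤ 1 / 2 := one_div_le_one_div_of_le (by norm_num) (by linarith)
    constructor <;> simp only [s] <;> linarith
  have hs1 : Tendsto (fun n => (s n : ℂ)) atTop (𝓝 1) := by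
    have h1 : Tendsto (fun n : ℕ => 1 / ((n : ℝ) + 2)) atTop (𝓝 0) :=
      tendsto_const_nhds.div_atTop (tendsto_natCast_atTop_atTop.atTop_add tendsto_const_nhds)
    have h2 : Tendsto s atTop (𝓝 (1 - 0)) := tendsto_const_nhds.sub h1
    have h3 := (Complex.continuous_ofReal.tendsto _).comp h2
    rwa [sub_zero, Complex.ofReal_one] at h3
  obtain ⟨C, hC⟩ := hb
  have key : ∀ d : ℂ, d.re = c' → |d.im| = 1 → Tendsto (fun n =>
      radialPrimitive F (s n * Complex.exp (d * Real.pi)) - radialPrimitive F (s n)) atTop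
      (𝓝 (arcIntegral d (fun t => t * F t))) := by
    intro d hre him
    have hval : ∀ n, ∫ y in (0 : ℝ)..Real.pi,
        (s n * Complex.exp (d * y)) * F (s n * Complex.exp (d * y)) * d =
        radialPrimitive F (s n * Complex.exp (d * Real.pi)) - radialPrimitive F (s n) := by
      intro n
      have hs0 : 0 < s n := by linarith [(hs n).1]
      have hmem : ∀ y ∈ uIcc 0 Real.pi, s n * Complex.exp (d * y) ∈ spiralDomain c := by
        intro y hy
        rw [uIcc_of_le Real.pi_pos.le] at hy
        exact real_mul_arc_mem hcc hre him hy hs0 (hs n).2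
      have h := intervalIntegral.integral_eq_sub_of_hasDerivAt (a := 0) (b := Real.pi)
        (f := fun y : ℝ => radialPrimitive F (s n * Complex.exp (d * y)))
        (f' := fun y : ℝ => (s n * Complex.exp (d * y)) * F (s n * Complex.exp (d * y)) * d)
        (fun y hy => by
          have h1 := hasDerivAt_radialPrimitive hc hF (hmem y hy)
          have h2 : HasDerivAt (fun y : ℝ => s n * Complex.exp (d * y))
              (s n * (Complex.exp (d * y) * d)) y := by
            have h3 : HasDerivAt (fun y : ℝ => d * (y : ℂ)) d y := by
              simpa using (Complex.ofRealCLM.hasDerivAt (x := y)).const_mul d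
            exact (h3.cexp).const_mul _
          refine (HasDerivAt.comp y h1 h2).congr_deriv ?_
          ring)
        (ContinuousOn.intervalIntegrable (ContinuousOn.mul (ContinuousOn.mul (by fun_prop)
          (hF.continuousOn.comp (by fun_prop) hmem)) continuousOn_const))
      rw [h]
      simp
    simp only [← hval, arcIntegral]
    refine intervalIntegral.tendsto_integral_filter_of_dominated_convergence
      (fun _ => Real.exp (c * Real.pi) * C * ‖d‖) (Eventually.of_forall fun n => ?_)
      (Eventually.of_forall fun n => Eventually.of_forall fun y hy => ?_)
      intervalIntegrable_const (Eventually.of_forall fun y hy => ?_)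
    all_goals rw [uIoc_of_le Real.pi_pos.le] at *
    · refine ContinuousOn.aestronglyMeasurable (ContinuousOn.mul (ContinuousOn.mul (by fun_prop)
          (hF.continuousOn.comp (by fun_prop) fun y hy => ?_)) continuousOn_const) measurableSet_Ioc
      exact real_mul_arc_mem hcc hre him ⟨hy.1.le, hy.2⟩ (by linarith [(hs n).1]) (hs n).2
    · have hm := real_mul_arc_mem hcc hre him ⟨hy.1.le, hy.2⟩ (by linarith [(hs n).1]) (hs n).2
      rw [norm_mul, norm_mul]
      gcongr
      · exact (norm_lt_of_mem_spiralDomain hc hm).le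
      · refine hC _ hm ?_
        rw [norm_mul, Complex.norm_real, Real.norm_of_nonneg (by linarith [(hs n).1])]
        nlinarith [one_le_norm_of_notMem hc' (arc_notMem hc' hre him hy.1.le), (hs n).1]
    · have hm := arc_mem hcc hre him hy
      have h1 : Tendsto (fun n => s n * Complex.exp (d * y)) atTop (𝓝 (Complex.exp (d * y))) := by
        simpa using hs1.mul_const (Complex.exp (d * y))
      have h2 := (hF.differentiableAt ((isOpen_spiralDomain hc).mem_nhds hm)).continuousAt
      exact (h1.mul (h2.tendsto.comp h1)).mul_const d
  have h1 := (key (c' + I) (by simp) (abs_im_add_I _)).sub (key (c' - I) (by simp) (abs_im_sub_I _))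
  simp only [exp_add_I_mul_pi, sub_self] at h1
  exact tendsto_nhds_unique h1 tendsto_const_nhds

/-- Cauchy's formula for the coefficients, on the boundary of a spiral domain. -/
lemma Continues.loopIntegral_coeff (hc' : 0 < c') (hcc : c' < c) (n : ℕ) :
    ∀ {a : ℕ → ℂ} {F : ℂ → ℂ}, Continues c a F →
    (∃ C, ∀ z ∈ spiralDomain c, 1 / 2 ≤ ‖z‖ → ‖F z‖ ≤ C) →
    loopIntegral c' (fun t => F t * t⁻¹ ^ n) = 2 * Real.pi * I * a n := by
  have hc := hc'.trans hcc
  have hbd : ∀ {a : ℕ → ℂ} {F : ℂ → ℂ}, Continues c a F →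
      (∃ C, ∀ z ∈ spiralDomain c, 1 / 2 ≤ ‖z‖ → ‖F z‖ ≤ C) → BoundedOutside c F :=
    fun hF ⟨C, hC⟩ => ⟨hF.1.continuousOn.mono inter_subset_left, C,
      fun t ht ht1 => hC t ht (by linarith)⟩
  -- Bounding only on `|z| ≥ 1/2` is what makes the hypothesis stable under removing the constant
  -- term and dividing by `z`, so that the induction on `n` can run.
  have hshift : ∀ {a : ℕ → ℂ} {F : ℂ → ℂ}, Continues c a F →
      (∃ C, ∀ z ∈ spiralDomain c, 1 / 2 ≤ ‖z‖ → ‖F z‖ ≤ C) →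
      (∃ C, ∀ z ∈ spiralDomain c, 1 / 2 ≤ ‖z‖ → ‖dslope F 0 z‖ ≤ C) := by
    rintro a F hF ⟨C, hC⟩
    refine ⟨2 * (C + ‖a 0‖), fun z hz hz1 => ?_⟩
    have h1 : z * dslope F 0 z = F z - a 0 := by rw [(hF.shift hc).2 z]; ring
    have h2 : ‖z‖ * ‖dslope F 0 z‖ ≤ C + ‖a 0‖ := by
      rw [← norm_mul, h1]
      exact (norm_sub_le _ _).trans (by gcongr; exact hC z hz hz1)
    nlinarith [norm_nonneg (dslope F 0 z)]
  induction n with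
  | zero =>
    intro a F hF hb
    obtain ⟨hS, hFS⟩ := hF.shift hc
    have h1 : (fun t => F t * t⁻¹ ^ 0) = fun t => a 0 * 1 + t * dslope F 0 t := by
      ext t; rw [hFS t]; simp
    rw [h1, loopIntegral_add hc' hcc (boundedOutside_const _)
      ((boundedOutside_id hc).mul (hbd hS (hshift hF hb))), loopIntegral_const_mul,
      loopIntegral_one, loopIntegral_id_mul hc' hcc hS.1 (hshift hF hb)]
    ring
  | succ n ih =>
    intro a F hF hb
    obtain ⟨hS, hFS⟩ := hF.shift hc
    have h1 : ∀ t ≠ 0, F t * t⁻¹ ^ (n + 1) = a 0 * t⁻¹ ^ (n + 1) + dslope F 0 t * t⁻¹ ^ n := by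
      intro t ht
      rw [hFS t, pow_succ]
      field_simp
    have h2 : loopIntegral c' (fun t => F t * t⁻¹ ^ (n + 1)) =
        loopIntegral c' (fun t => a 0 * t⁻¹ ^ (n + 1) + dslope F 0 t * t⁻¹ ^ n) := by
      simp only [loopIntegral, arcIntegral, h1 _ (Complex.exp_ne_zero _)]
    rw [h2, loopIntegral_add hc' hcc ((boundedOutside_const _).mul (boundedOutside_inv_pow _))
      ((hbd hS (hshift hF hb)).mul (boundedOutside_inv_pow _)), loopIntegral_const_mul,
      loopIntegral_inv_pow_succ hc', ih hS (hshift hF hb)]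
    ring

/-! ### Hadamard products by contour integration -/

/-- The Hadamard product of two bounded functions continues to a smaller spiral domain,
where it is bounded. -/
theorem Continues.exists_hadamard (hc' : 0 < c') (hcc : c' < c) (hF : Continues c a F)
    (hG : Continues c b G) (hFb : ∃ C, ∀ z ∈ spiralDomain c, ‖F z‖ ≤ C)
    (hGb : ∃ C, ∀ z ∈ spiralDomain c, ‖G z‖ ≤ C) :
    ∃ H, Continues c' (fun n => a n * b n) H ∧ ∃ C, ∀ z ∈ spiralDomain c', ‖H z‖ ≤ C := by
  have hc := hc'.trans hcc
  have hloop := fun n => hF.loopIntegral_coeff hc' hcc n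
    (hFb.imp fun C hC z hz _ => hC z hz)
  obtain ⟨C₁, hC₁⟩ := hFb
  obtain ⟨C₂, hC₂⟩ := hGb
  have hC₁0 : 0 ≤ C₁ := (norm_nonneg _).trans (hC₁ 0 (zero_mem_spiralDomain c))
  have hC₂0 : 0 ≤ C₂ := (norm_nonneg _).trans (hC₂ 0 (zero_mem_spiralDomain c))
  have hdiv : ∀ {d : ℂ}, d.re = c' → |d.im| = 1 → ∀ y ∈ Ioc 0 Real.pi, ∀ z ∈ spiralDomain c',
      z / Complex.exp (d * y) ∈ spiralDomain c := fun hre him y hy z hz =>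
    spiralDomain_mono hcc.le (div_mem_spiralDomain hc' hz (arc_notMem hc' hre him hy.1.le))
  have hmeas : ∀ {d : ℂ}, d.re = c' → |d.im| = 1 → ∀ z ∈ spiralDomain c', AEStronglyMeasurable
      (fun y : ℝ => F (Complex.exp (d * y)) * G (z / Complex.exp (d * y)) * d)
      (volume.restrict (Ioc 0 Real.pi)) := by
    intro d hre him z hz
    refine ContinuousOn.aestronglyMeasurable (ContinuousOn.mul (ContinuousOn.mul
      (hF.1.continuousOn.comp (by fun_prop) fun y hy => arc_mem hcc hre him hy)
      (hG.1.continuousOn.comp (ContinuousOn.div (by fun_prop) (by fun_prop)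
        fun _ _ => Complex.exp_ne_zero _) fun y hy => hdiv hre him y hy z hz))
      continuousOn_const) measurableSet_Ioc
  have hbound : ∀ {d : ℂ}, d.re = c' → |d.im| = 1 → ∀ y ∈ Ioc 0 Real.pi, ∀ z ∈ spiralDomain c',
      ‖F (Complex.exp (d * y)) * G (z / Complex.exp (d * y)) * d‖ ≤ C₁ * C₂ * ‖d‖ := by
    intro d hre him y hy z hz
    rw [norm_mul, norm_mul]
    gcongr
    · exact hC₁ _ (arc_mem hcc hre him hy)
    · exact hC₂ _ (hdiv hre him y hy z hz)
  have hdiff : ∀ d : ℂ, d.re = c' → |d.im| = 1 → DifferentiableOn ℂ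
      (fun z => arcIntegral d (fun t => F t * G (z / t))) (spiralDomain c') := by
    intro d hre him
    simp only [arcIntegral, intervalIntegral.integral_of_le Real.pi_pos.le]
    refine differentiableOn_integral_of_holomorphic (isOpen_spiralDomain hc') (hmeas hre him)
      ?_ fun z₀ hz₀ => ⟨spiralDomain c', (isOpen_spiralDomain hc').mem_nhds hz₀,
        fun _ => C₁ * C₂ * ‖d‖, integrable_const _, ?_⟩
    · filter_upwards [ae_restrict_mem measurableSet_Ioc] with y hy
      exact ((hG.1.comp (by fun_prop) fun z hz => hdiv hre him y hy z hz).const_mul _).mul_const _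
    · filter_upwards [ae_restrict_mem measurableSet_Ioc] with y hy z hz
      exact hbound hre him y hy z hz
  have hsum : ∀ d : ℂ, d.re = c' → |d.im| = 1 → ∀ z : ℂ, ‖z‖ < 1 → HasSum
      (fun n => b n * z ^ n * arcIntegral d (fun t => F t * t⁻¹ ^ n))
      (arcIntegral d (fun t => F t * G (z / t))) := by
    intro d hre him z hz
    have hn : ∀ y ∈ Ioc 0 Real.pi, 1 ≤ ‖Complex.exp (d * y)‖ := fun y hy =>
      one_le_norm_of_notMem hc' (arc_notMem hc' hre him hy.1.le)
    have h := intervalIntegral.hasSum_integral_of_dominated_convergence (μ := volume)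
      (a := 0) (b := Real.pi)
      (F := fun n (y : ℝ) => b n * z ^ n * (F (Complex.exp (d * y)) * (Complex.exp (d * y))⁻¹ ^ n * d))
      (f := fun y : ℝ => F (Complex.exp (d * y)) * G (z / Complex.exp (d * y)) * d)
      (fun n _ => ‖b n‖ * ‖z‖ ^ n * (C₁ * ‖d‖))
      (fun n => ?_) (fun n => Eventually.of_forall fun y hy => ?_)
      (Eventually.of_forall fun y _ => (hG.summable_norm (norm_nonneg z) hz).mul_right _)
      intervalIntegrable_const (Eventually.of_forall fun y hy => ?_)
    · simpa only [arcIntegral, intervalIntegral.integral_const_mul] using h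
    all_goals rw [uIoc_of_le Real.pi_pos.le] at *
    · refine AEStronglyMeasurable.const_mul (ContinuousOn.aestronglyMeasurable
        (BoundedOutside.continuousOn_arc (c := c) (Φ := fun t => F t * t⁻¹ ^ n) (BoundedOutside.mul
          ⟨hF.1.continuousOn.mono inter_subset_left, C₁, fun t ht _ => hC₁ t ht⟩
          (boundedOutside_inv_pow n)) hc' hcc hre him) measurableSet_Ioc) _
    · have h1 : ‖(Complex.exp (d * y))⁻¹ ^ n‖ ≤ 1 := by
        rw [norm_pow, norm_inv]
        exact pow_le_one₀ (by positivity) (inv_le_one_of_one_le₀ (hn y hy))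
      rw [norm_mul, norm_mul, norm_pow, norm_mul, norm_mul]
      gcongr
      calc _ ≤ C₁ * 1 := by gcongr; exact hC₁ _ (arc_mem hcc hre him hy)
        _ = C₁ := mul_one _
    · have h1 : ‖z / Complex.exp (d * y)‖ < 1 := by
        rw [norm_div]
        exact lt_of_le_of_lt (div_le_self (norm_nonneg _) (hn y hy)) hz
      refine (((hG.2 _ h1).mul_left (F (Complex.exp (d * y)))).mul_right d).congr_fun fun n => ?_
      rw [div_pow, inv_pow]
      ring
  have hpi : (2 * Real.pi * I : ℂ) ≠ 0 := Complex.two_pi_I_ne_zero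
  -- The contour is the boundary of the smaller domain and does not depend on `z`: by `hdiv`, `z /
  -- t` stays where `G` is holomorphic and bounded.
  refine ⟨fun z => (2 * Real.pi * I)⁻¹ * loopIntegral c' (fun t => F t * G (z / t)),
    ⟨?_, fun z hz => ?_⟩, ?_⟩
  · exact ((hdiff _ (by simp) (abs_im_add_I c')).sub
      (hdiff _ (by simp) (abs_im_sub_I c'))).const_mul _
  · have h := ((hsum _ (by simp) (abs_im_add_I c') z hz).sub
      (hsum _ (by simp) (abs_im_sub_I c') z hz)).mul_left (2 * Real.pi * I)⁻¹
    refine h.congr_fun fun n => ?_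
    rw [← mul_sub]
    have h2 := hloop n
    rw [loopIntegral] at h2
    rw [h2]
    field_simp
  · have hnorm : ∀ d : ℂ, d.re = c' → |d.im| = 1 → ∀ z ∈ spiralDomain c',
        ‖arcIntegral d (fun t => F t * G (z / t))‖ ≤ C₁ * C₂ * ‖d‖ * Real.pi := by
      intro d hre him z hz
      have := intervalIntegral.norm_integral_le_of_norm_le_const (a := 0) (b := Real.pi)
        (f := fun y : ℝ => F (Complex.exp (d * y)) * G (z / Complex.exp (d * y)) * d)
        (C := C₁ * C₂ * ‖d‖) (fun y hy => hbound hre him y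
          (by rwa [uIoc_of_le Real.pi_pos.le] at hy) z hz)
      simpa [arcIntegral, abs_of_pos Real.pi_pos] using this
    refine ⟨‖(2 * Real.pi * I : ℂ)⁻¹‖ * (C₁ * C₂ * ‖(c' + I : ℂ)‖ * Real.pi +
      C₁ * C₂ * ‖(c' - I : ℂ)‖ * Real.pi), fun z hz => ?_⟩
    rw [norm_mul]
    gcongr
    exact (norm_sub_le _ _).trans (add_le_add (hnorm _ (by simp) (abs_im_add_I c') z hz)
      (hnorm _ (by simp) (abs_im_sub_I c') z hz))

/-- The Hadamard product with a function that is small at `1` is polynomial at `1`, up to a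
small remainder. -/
theorem Continues.exists_hadamard_nearPoly (hc' : 0 < c') (hcc : c' < c) {m K : ℕ} (hm : 0 < m)
    (hK : 0 < K) (hF : Continues c a F) (hG : Continues c b G)
    (hFO : F =O[𝓝[spiralDomain c] 1] fun z => (1 - z) ^ (m + K))
    (hGO : G =O[𝓝[spiralDomain c] 1] fun z => ‖1 - z‖ ^ (-(m / 2) : ℝ)) :
    ∃ H, Continues c' (fun n => a n * b n) H ∧ H ∈ nearPoly c' K := by
  obtain ⟨d, hd1, hd2⟩ := exists_between hcc
  obtain ⟨e, he1, he2⟩ := exists_between hd1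
  have he0 := hc'.trans he1
  have hd0 := he0.trans he2
  -- The coefficients become `n^{m+K} a_n` and `n^{-m} b_n`, both with bounded sums, and their
  -- product is `n^K a_n b_n`. The last `K` inversions of the Euler operator then yield order `K`.
  obtain ⟨G₁, hG₁, hG₁b⟩ := Continues.exists_iterate_antiEuler_bounded hd0 m hd2 hG hGO
  obtain ⟨F₁, hF₁, hF₁b⟩ := Continues.exists_iterate_euler hd0 (m + K) hd2 hF
    (isBigO_pow_iff_rpow.1 hFO)
  rw [sub_self] at hF₁b
  have hF₂ : ∃ C, ∀ z ∈ spiralDomain e, ‖F₁ z‖ ≤ C := by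
    obtain ⟨C, -, hC⟩ := exists_bound_of_isBigO he0 he2 hF₁.1.continuousOn hF₁b
    exact ⟨C, fun z hz => by simpa using hC z hz⟩
  have hG₂ : ∃ C, ∀ z ∈ spiralDomain e, ‖G₁ z‖ ≤ C := by
    obtain ⟨C, -, hC⟩ := exists_bound_of_isBigO he0 he2 hG₁.1.continuousOn hG₁b
    exact ⟨C, fun z hz => by simpa using hC z hz⟩
  obtain ⟨H, hH, C, hC⟩ := (hF₁.mono he2.le).exists_hadamard hc' he1 (hG₁.mono he2.le) hF₂ hG₂
  have hH0 : H ∈ nearPoly c' 0 := mem_nearPoly_of_isBigO (by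
    refine isBigO_nhdsWithin_one_iff.2 ⟨max C 1, by positivity, 1, one_pos, fun z hz _ => ?_⟩
    simpa using Or.inl (hC z hz))
  obtain ⟨H₁, hH₁, hH₁n⟩ := hH.exists_iterate_antiEuler_nearPoly hc' K hH0
  rw [zero_add] at hH₁n
  -- The coefficient of index `0` was lost in dividing by `0 ^ K = 0`; it is restored by a constant.
  refine ⟨H₁ + fun _ => a 0 * b 0, (hH₁.add (Continues.const (a 0 * b 0))).congr_fun_zero_series
    fun n => ?_, add_mem hH₁n (const_mem_nearPoly _)⟩
  rcases n with _ | n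
  · simp [hK.ne', hm.ne']
  · have : ((n + 1 : ℕ) : ℂ) ≠ 0 := Nat.cast_ne_zero.2 (Nat.succ_ne_zero n)
    simp only [Pi.add_apply, Pi.single_apply, Nat.succ_ne_zero, if_false, add_zero]
    field_simp
    ring

/-! ### Laplace-type integrals -/

/-- The function `∑_{n ≥ N} zⁿ ∫₀^∞ w(x) e^{-nx} dx`. -/
noncomputable def laplaceSeries (N : ℕ) (w : ℝ → ℂ) (z : ℂ) : ℂ :=
  ∫ x in Ioi (0 : ℝ), w x * ((Real.exp (-x) * z) ^ N / (1 - Real.exp (-x) * z))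

/-- The version of `laplaceSeries` for the restriction of the weight to `(0, 1]`. -/
noncomputable def cutLaplaceSeries (w : ℝ → ℂ) : ℂ → ℂ :=
  laplaceSeries 0 ((Ioc 0 1).indicator w)

lemma exp_neg_mem {x : ℝ} (hx : 0 < x) : 0 < Real.exp (-x) ∧ Real.exp (-x) < 1 :=
  ⟨Real.exp_pos _, Real.exp_lt_one_iff.2 (by linarith)⟩

lemma one_sub_exp_neg_mul_ne_zero (hc : 0 < c) {z : ℂ} (hz : z ∈ spiralDomain c) {x : ℝ}
    (hx : 0 < x) : 1 - Real.exp (-x) * z ≠ 0 := by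
  have h := one_sub_le_norm_one_sub_mul hc hz (exp_neg_mem hx).1.le (exp_neg_mem hx).2.le
  intro h0
  rw [h0, norm_zero, mul_zero] at h
  linarith [(exp_neg_mem hx).2]

lemma norm_kernel_le {C : ℝ} {z : ℂ} (hz1 : z ≠ 1)
    (hC : ∀ q : ℝ, 0 ≤ q → q ≤ 1 → 1 - q ≤ C * ‖1 - q * z‖ ∧ ‖1 - z‖ ≤ C * ‖1 - q * z‖)
    {x : ℝ} (hx : 0 < x) : ‖(1 - Real.exp (-x) * z)⁻¹‖ ≤ C / ‖1 - z‖ := by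
  have h := (hC _ (exp_neg_mem hx).1.le (exp_neg_mem hx).2.le).2
  have h0 : 0 < ‖1 - z‖ := norm_pos_iff.2 (sub_ne_zero.2 hz1.symm)
  rw [norm_inv, le_div_iff₀ h0, inv_mul_le_iff₀]
  · linarith
  · by_contra h1
    rw [le_antisymm (not_lt.1 h1) (norm_nonneg _)] at h
    linarith

lemma aestronglyMeasurable_kernel (hc : 0 < c) {z : ℂ} (hz : z ∈ spiralDomain c) :
    AEStronglyMeasurable (fun x : ℝ => (1 - Real.exp (-x) * z)⁻¹) (volume.restrict (Ioi 0)) := by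
  refine ContinuousOn.aestronglyMeasurable (ContinuousOn.inv₀ (by fun_prop) fun x hx => ?_)
    measurableSet_Ioi
  exact one_sub_exp_neg_mul_ne_zero hc hz hx

lemma integrableOn_mul_kernel (hc : 0 < c) {w : ℝ → ℂ} (hw : IntegrableOn w (Ioi 0)) {z : ℂ}
    (hz : z ∈ spiralDomain c) :
    IntegrableOn (fun x => w x * (1 - Real.exp (-x) * z)⁻¹) (Ioi 0) := by
  obtain ⟨C, -, hC⟩ := norm_one_sub_le_mul_norm_one_sub_mul hc
  refine Integrable.mono' (g := fun x => ‖w x‖ * (C / ‖1 - z‖)) (hw.norm.mul_const _)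
    (hw.aestronglyMeasurable.mul (aestronglyMeasurable_kernel hc hz)) ?_
  filter_upwards [ae_restrict_mem measurableSet_Ioi] with x hx
  rw [norm_mul]
  gcongr
  exact norm_kernel_le (ne_one_of_mem_spiralDomain hz) (hC z hz) hx

lemma laplaceSeries_zero_eq (w : ℝ → ℂ) (z : ℂ) :
    laplaceSeries 0 w z = ∫ x in Ioi (0 : ℝ), w x * (1 - Real.exp (-x) * z)⁻¹ := by
  simp [laplaceSeries]

lemma laplaceSeries_zero_add (hc : 0 < c) {w₁ w₂ : ℝ → ℂ} (h₁ : IntegrableOn w₁ (Ioi 0))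
    (h₂ : IntegrableOn w₂ (Ioi 0)) {z : ℂ} (hz : z ∈ spiralDomain c) :
    laplaceSeries 0 (w₁ + w₂) z = laplaceSeries 0 w₁ z + laplaceSeries 0 w₂ z := by
  simp only [laplaceSeries_zero_eq, Pi.add_apply, add_mul]
  exact integral_add (integrableOn_mul_kernel hc h₁ hz) (integrableOn_mul_kernel hc h₂ hz)

lemma laplaceSeries_smul (N : ℕ) (k : ℂ) (w : ℝ → ℂ) :
    laplaceSeries N (k • w) = k • laplaceSeries N w := by
  ext z
  simp only [laplaceSeries, Pi.smul_apply, smul_eq_mul, mul_assoc, integral_const_mul]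

lemma laplaceSeries_eq_pow_mul (N : ℕ) (w : ℝ → ℂ) (z : ℂ) :
    laplaceSeries N w z = z ^ N * laplaceSeries 0 (fun x => w x * (Real.exp (-x) : ℂ) ^ N) z := by
  rw [laplaceSeries_zero_eq, laplaceSeries, ← integral_const_mul]
  refine integral_congr_ae (Eventually.of_forall fun x => ?_)
  simp only [mul_pow]
  ring

/-- The Taylor expansion at `1` of the Laplace series of a weight vanishing to high order. -/
lemma laplaceSeries_zero_mem_nearPoly (hc : 0 < c) {w : ℝ → ℂ}
    (hw : IntegrableOn (fun x => w x * ((1 - Real.exp (-x) : ℝ) : ℂ)⁻¹ ^ (A + 1)) (Ioi 0)) :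
    laplaceSeries 0 w ∈ nearPoly c A := by
  obtain ⟨C, hC0, hC⟩ := norm_one_sub_le_mul_norm_one_sub_mul hc
  set v : ℝ → ℂ := fun x => w x * ((1 - Real.exp (-x) : ℝ) : ℂ)⁻¹ ^ (A + 1)
  set u : ℕ → ℝ → ℂ := fun m x => (Real.exp (-x) : ℂ) ^ m * ((1 - Real.exp (-x) : ℝ) : ℂ) ^ (A - m)
  have hu : ∀ m x, 0 < x → ‖u m x‖ ≤ 1 := by
    intro m x hx
    have h := exp_neg_mem hx
    simp only [u]
    rw [norm_mul, norm_pow, norm_pow, Complex.norm_real, Complex.norm_real,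
      Real.norm_of_nonneg h.1.le, Real.norm_of_nonneg (by linarith)]
    exact mul_le_one₀ (pow_le_one₀ h.1.le h.2.le) (pow_nonneg (by linarith) _)
      (pow_le_one₀ (by linarith) (by linarith))
  have huc : ∀ m, Continuous (u m) := fun m => by fun_prop
  have hvu : ∀ m, IntegrableOn (fun x => v x * u m x) (Ioi 0) := fun m => by
    refine Integrable.mono' hw.norm (hw.aestronglyMeasurable.mul
      (huc m).aestronglyMeasurable) ?_
    filter_upwards [ae_restrict_mem measurableSet_Ioi] with x hx
    rw [norm_mul]
    exact mul_le_of_le_one_right (norm_nonneg _) (hu m x hx)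
  set k : ℕ → ℂ := fun m => ∫ x in Ioi (0 : ℝ), v x * u m x
  refine ⟨∑ m ∈ Finset.range A, Polynomial.C (k m) * (Polynomial.X - 1) ^ m, ?_⟩
  have hint0 : 0 ≤ ∫ x in Ioi (0 : ℝ), ‖v x‖ := integral_nonneg fun _ => norm_nonneg _
  refine isBigO_nhdsWithin_one_iff.2 ⟨C * ((∫ x in Ioi (0 : ℝ), ‖v x‖) + 1), by positivity, 1,
    one_pos, fun z hz _ => ?_⟩
  -- With `q = e^{-x}` and `p = 1 - q`, the denominator is `p - (z - 1) q`, and a finite geometric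
  -- sum expands its inverse in powers of `z - 1`. The remainder keeps the factor `p / (1 - q z)`,
  -- which is bounded on the spiral domain, so integrability of `w / p^{A+1}` is enough.
  have hpt : ∀ x ∈ Ioi (0 : ℝ), w x * (1 - Real.exp (-x) * z)⁻¹ =
      (∑ m ∈ Finset.range A, (z - 1) ^ m * (v x * u m x)) + (z - 1) ^ A *
        (v x * u A x * (((1 - Real.exp (-x) : ℝ) : ℂ) * (1 - Real.exp (-x) * z)⁻¹)) := by
    intro x hx
    have hne := one_sub_exp_neg_mul_ne_zero hc hz hx
    have hp : ((1 - Real.exp (-x) : ℝ) : ℂ) ≠ 0 :=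
      Complex.ofReal_ne_zero.2 (by linarith [(exp_neg_mem hx).2])
    set p : ℂ := ((1 - Real.exp (-x) : ℝ) : ℂ)
    set q : ℂ := (Real.exp (-x) : ℂ)
    have hpq : 1 - q * z = p - (z - 1) * q := by simp only [p, q]; push_cast; ring
    have hw' : w x = v x * p ^ (A + 1) := by
      simp only [v]
      rw [mul_assoc, ← mul_pow, inv_mul_cancel₀ hp, one_pow, mul_one]
    have hgeom : (∑ m ∈ Finset.range A, (z - 1) ^ m * (v x * u m x)) * (p - (z - 1) * q) =
        v x * p * (p ^ A - ((z - 1) * q) ^ A) := by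
      have h1 := (Commute.all ((z - 1) * q) p).geom_sum₂_mul A
      have h2 : ∑ m ∈ Finset.range A, (z - 1) ^ m * (v x * u m x) =
          v x * p * ∑ m ∈ Finset.range A, ((z - 1) * q) ^ m * p ^ (A - 1 - m) := by
        rw [Finset.mul_sum]
        refine Finset.sum_congr rfl fun m hm => ?_
        have h3 : A - m = (A - 1 - m) + 1 := by have := Finset.mem_range.1 hm; omega
        simp only [u]
        rw [h3, pow_succ, mul_pow]
        ring
      rw [h2]
      linear_combination -(v x * p) * h1
    rw [hpq] at hne ⊢
    have hu' : u A x = q ^ A := by simp [u, q]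
    rw [hw', hu', eq_comm, eq_mul_inv_iff_mul_eq₀ hne, add_mul, hgeom, mul_pow]
    field_simp
    ring
  have hrem : IntegrableOn (fun x => v x * u A x *
      (((1 - Real.exp (-x) : ℝ) : ℂ) * (1 - Real.exp (-x) * z)⁻¹)) (Ioi 0) ∧
      ∀ x ∈ Ioi (0 : ℝ), ‖v x * u A x *
        (((1 - Real.exp (-x) : ℝ) : ℂ) * (1 - Real.exp (-x) * z)⁻¹)‖ ≤ C * ‖v x‖ := by
    have hle : ∀ x ∈ Ioi (0 : ℝ), ‖v x * u A x *
        (((1 - Real.exp (-x) : ℝ) : ℂ) * (1 - Real.exp (-x) * z)⁻¹)‖ ≤ C * ‖v x‖ := by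
      intro x hx
      have hq := exp_neg_mem hx
      have h1 := (hC z hz _ hq.1.le hq.2.le).1
      have h2 := norm_pos_iff.2 (one_sub_exp_neg_mul_ne_zero hc hz hx)
      have h3 : ‖((1 - Real.exp (-x) : ℝ) : ℂ) * (1 - Real.exp (-x) * z)⁻¹‖ ≤ C := by
        rw [norm_mul, norm_inv, ← div_eq_mul_inv, div_le_iff₀ h2, Complex.norm_real,
          Real.norm_of_nonneg (by linarith)]
        exact h1
      rw [norm_mul, norm_mul]
      calc ‖v x‖ * ‖u A x‖ * _ ≤ ‖v x‖ * 1 * C := by gcongr; exact hu A x hx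
        _ = _ := by ring
    refine ⟨Integrable.mono' (hw.norm.const_mul C) ((hvu A).aestronglyMeasurable.mul
      (AEStronglyMeasurable.mul (by fun_prop : Continuous fun x : ℝ =>
        ((1 - Real.exp (-x) : ℝ) : ℂ)).aestronglyMeasurable
        (aestronglyMeasurable_kernel hc hz))) ?_, hle⟩
    filter_upwards [ae_restrict_mem measurableSet_Ioi] with x hx using hle x hx
  have heq : laplaceSeries 0 w z - Polynomial.eval z
      (∑ m ∈ Finset.range A, Polynomial.C (k m) * (Polynomial.X - 1) ^ m) = (z - 1) ^ A *
        ∫ x in Ioi (0 : ℝ), v x * u A x *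
          (((1 - Real.exp (-x) : ℝ) : ℂ) * (1 - Real.exp (-x) * z)⁻¹) := by
    rw [laplaceSeries_zero_eq, setIntegral_congr_fun measurableSet_Ioi hpt, integral_add,
      integral_finsetSum, integral_const_mul, Polynomial.eval_finsetSum]
    · simp only [integral_const_mul, Polynomial.eval_mul, Polynomial.eval_C, Polynomial.eval_pow,
        Polynomial.eval_sub, Polynomial.eval_X, Polynomial.eval_one]
      have hsum : ∑ m ∈ Finset.range A, (z - 1) ^ m * ∫ x in Ioi (0 : ℝ), v x * u m x =
          ∑ m ∈ Finset.range A, k m * (z - 1) ^ m :=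
        Finset.sum_congr rfl fun m _ => mul_comm _ _
      rw [hsum]
      ring
    · exact fun m _ => (hvu m).const_mul _
    · exact integrable_finsetSum _ fun m _ => (hvu m).const_mul _
    · exact hrem.1.const_mul _
  rw [heq, norm_mul, norm_pow, norm_pow, norm_sub_rev z 1, mul_comm]
  gcongr
  refine (norm_integral_le_of_norm_le (hw.norm.const_mul C) ?_).trans ?_
  · filter_upwards [ae_restrict_mem measurableSet_Ioi] with x hx using hrem.2 x hx
  · rw [integral_const_mul]
    gcongr
    linarith

lemma integrableOn_indicator_Ioc {w : ℝ → ℂ} (hw : IntegrableOn w (Ioc 0 1)) :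
    IntegrableOn ((Ioc 0 1).indicator w) (Ioi 0) :=
  ((integrable_indicator_iff measurableSet_Ioc).2 hw).integrableOn

lemma cutLaplaceSeries_add (hc : 0 < c) {w₁ w₂ : ℝ → ℂ} (h₁ : IntegrableOn w₁ (Ioc 0 1))
    (h₂ : IntegrableOn w₂ (Ioc 0 1)) {z : ℂ} (hz : z ∈ spiralDomain c) :
    cutLaplaceSeries (w₁ + w₂) z = cutLaplaceSeries w₁ z + cutLaplaceSeries w₂ z := by
  rw [cutLaplaceSeries, indicator_add']
  exact laplaceSeries_zero_add hc (integrableOn_indicator_Ioc h₁) (integrableOn_indicator_Ioc h₂) hz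

lemma cutLaplaceSeries_smul (k : ℂ) (w : ℝ → ℂ) :
    cutLaplaceSeries (k • w) = k • cutLaplaceSeries w := by
  rw [cutLaplaceSeries, cutLaplaceSeries, ← laplaceSeries_smul]
  congr 1
  exact indicator_const_smul _ k w

/-- Only the behaviour of the weight at `0` matters at the singularity. -/
lemma laplaceSeries_sub_cutLaplaceSeries_mem_nearPoly (hc : 0 < c) (N : ℕ) {w : ℝ → ℂ}
    (hw : IntegrableOn (fun x => w x * (Real.exp (-x) : ℂ) ^ N) (Ioi 0)) :
    IntegrableOn w (Ioc 0 1) ∧ laplaceSeries N w - cutLaplaceSeries w ∈ nearPoly c A := by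
  have hq : ∀ x : ℝ, (Real.exp (-x) : ℂ) ≠ 0 := fun x => Complex.ofReal_ne_zero.2 (Real.exp_pos _).ne'
  set v : ℝ → ℂ := fun x => w x * (Real.exp (-x) : ℂ) ^ N
  have hwv : w = fun x => v x * (Real.exp x : ℂ) ^ N := by
    ext x
    simp only [v]
    rw [mul_assoc, ← mul_pow, ← Complex.ofReal_mul, ← Real.exp_add]
    simp
  have hw1 : IntegrableOn w (Ioc 0 1) := by
    rw [hwv]
    refine Integrable.mono' (g := fun x => ‖v x‖ * Real.exp 1 ^ N)
      ((hw.mono_set Ioc_subset_Ioi_self).norm.mul_const _)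
      ((hw.mono_set Ioc_subset_Ioi_self).aestronglyMeasurable.mul
        (by fun_prop : Continuous fun x : ℝ => (Real.exp x : ℂ) ^ N).aestronglyMeasurable) ?_
    filter_upwards [ae_restrict_mem measurableSet_Ioc] with x hx
    rw [norm_mul, norm_pow, Complex.norm_real, Real.norm_of_nonneg (Real.exp_pos x).le]
    gcongr
    exact hx.2
  refine ⟨hw1, ?_⟩
  have hv1 : IntegrableOn ((Ioc 0 1).indicator v) (Ioi 0) :=
    integrableOn_indicator_Ioc (hw.mono_set Ioc_subset_Ioi_self)
  have hv2 : IntegrableOn ((Ioi 1).indicator v) (Ioi 0) :=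
    ((integrable_indicator_iff measurableSet_Ioi).2
      (hw.mono_set (Ioi_subset_Ioi zero_le_one))).integrableOn
  -- the part away from `0`
  have hfar : laplaceSeries 0 ((Ioi 1).indicator v) ∈ nearPoly c A := by
    refine laplaceSeries_zero_mem_nearPoly hc ?_
    refine Integrable.mono' (g := fun x => ‖(Ioi 1).indicator v x‖ * (1 - Real.exp (-1))⁻¹ ^ (A + 1))
      (hv2.norm.mul_const _) (hv2.aestronglyMeasurable.mul
        (ContinuousOn.aestronglyMeasurable (ContinuousOn.pow (ContinuousOn.inv₀ (by fun_prop)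
          fun x hx => Complex.ofReal_ne_zero.2 (by linarith [(exp_neg_mem hx).2])) _)
          measurableSet_Ioi)) ?_
    filter_upwards [ae_restrict_mem measurableSet_Ioi] with x hx
    rw [norm_mul]
    by_cases h : x ∈ Ioi (1 : ℝ)
    · have h1 : Real.exp (-x) ≤ Real.exp (-1) := Real.exp_le_exp.2 (by linarith [mem_Ioi.1 h])
      have h2 := (exp_neg_mem one_pos).2
      have h3 : 0 < 1 - Real.exp (-1) := by linarith
      have h4 : 0 < 1 - Real.exp (-x) := by linarith
      rw [norm_pow, norm_inv, Complex.norm_real, Real.norm_of_nonneg h4.le]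
      gcongr
    · simp [indicator_of_notMem h]
  -- the part near `0`
  have hnear : ∀ z ∈ spiralDomain c, z ^ N * laplaceSeries 0 ((Ioc 0 1).indicator v) z =
      cutLaplaceSeries w z - ∑ n ∈ Finset.range N,
        (∫ x in Ioc (0 : ℝ) 1, w x * (Real.exp (-x) : ℂ) ^ n) * z ^ n := by
    intro z hz
    have hwint : ∀ n, IntegrableOn (fun x => w x * (Real.exp (-x) : ℂ) ^ n) (Ioc 0 1) := fun n => by
      refine Integrable.mono' hw1.norm (hw1.aestronglyMeasurable.mul
        (by fun_prop : Continuous fun x : ℝ => (Real.exp (-x) : ℂ) ^ n).aestronglyMeasurable) ?_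
      filter_upwards [ae_restrict_mem measurableSet_Ioc] with x hx
      have hq := exp_neg_mem hx.1
      rw [norm_mul, norm_pow, Complex.norm_real, Real.norm_of_nonneg hq.1.le]
      exact mul_le_of_le_one_right (norm_nonneg _) (pow_le_one₀ hq.1.le hq.2.le)
    have hset : ∀ f : ℝ → ℂ, (∫ x in Ioi (0 : ℝ), (Ioc 0 1).indicator f x *
        (1 - Real.exp (-x) * z)⁻¹) = ∫ x in Ioc (0 : ℝ) 1, f x * (1 - Real.exp (-x) * z)⁻¹ := by
      intro f
      have h1 : (fun x => (Ioc 0 1).indicator f x * (1 - Real.exp (-x) * z)⁻¹) =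
          (Ioc (0 : ℝ) 1).indicator fun x => f x * (1 - Real.exp (-x) * z)⁻¹ := by
        ext x
        by_cases h : x ∈ Ioc (0 : ℝ) 1 <;> simp [h]
      rw [h1, setIntegral_indicator measurableSet_Ioc,
        inter_eq_self_of_subset_right Ioc_subset_Ioi_self]
    have hint : IntegrableOn (fun x => w x * (1 - Real.exp (-x) * z)⁻¹) (Ioc 0 1) := by
      refine ((integrableOn_mul_kernel hc (integrableOn_indicator_Ioc hw1) hz).mono_set
        Ioc_subset_Ioi_self).congr_fun (fun x hx => ?_) measurableSet_Ioc
      simp only [indicator_of_mem hx]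
    rw [cutLaplaceSeries, laplaceSeries_zero_eq, laplaceSeries_zero_eq, hset, hset,
      ← integral_const_mul]
    simp only [← integral_mul_const]
    rw [← integral_finsetSum _ fun n _ => (hwint n).mul_const _, ← integral_sub hint
      (integrable_finsetSum _ fun n _ => (hwint n).mul_const _)]
    refine setIntegral_congr_fun measurableSet_Ioc fun x hx => ?_
    have hne := one_sub_exp_neg_mul_ne_zero hc hz hx.1
    have h1 := geom_sum_mul ((Real.exp (-x) : ℂ) * z) N
    have h2 : ∑ n ∈ Finset.range N, w x * (Real.exp (-x) : ℂ) ^ n * z ^ n =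
        w x * ∑ n ∈ Finset.range N, ((Real.exp (-x) : ℂ) * z) ^ n := by
      rw [Finset.mul_sum]
      exact Finset.sum_congr rfl fun n _ => by rw [mul_pow]; ring
    simp only [h2, v]
    -- On `(0, 1]` the numerator `(e^{-x} z)^N` may be replaced by `1`: the finite geometric sum
    -- contributes only a polynomial in `z`.
    have h3 : z ^ N * (Real.exp (-x) : ℂ) ^ N = 1 -
        (∑ n ∈ Finset.range N, ((Real.exp (-x) : ℂ) * z) ^ n) * (1 - Real.exp (-x) * z) := by
      rw [mul_comm (z ^ N), ← mul_pow]
      linear_combination -h1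
    calc _ = w x * (z ^ N * (Real.exp (-x) : ℂ) ^ N) * (1 - Real.exp (-x) * z)⁻¹ := by ring
      _ = _ := by rw [h3]; field_simp
  set P : Polynomial ℂ := ∑ n ∈ Finset.range N,
    Polynomial.C (∫ x in Ioc (0 : ℝ) 1, w x * (Real.exp (-x) : ℂ) ^ n) * Polynomial.X ^ n
  refine nearPoly_congr (F := fun z => (Polynomial.X ^ N : Polynomial ℂ).eval z *
    laplaceSeries 0 ((Ioi 1).indicator v) z + (-P).eval z) ?_
    (add_mem (mul_mem_nearPoly (polynomial_mem_nearPoly _) hfar) (polynomial_mem_nearPoly _))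
  filter_upwards [self_mem_nhdsWithin] with z hz
  have hv : v = (Ioc 0 1).indicator v + (Ioi 1).indicator v + (Iic 0).indicator v := by
    ext x
    rcases le_or_gt x 0 with h | h
    · simp [h, h.not_gt, (h.trans zero_le_one).not_gt]
    · rcases le_or_gt x 1 with h' | h'
      · simp [h, h', h.not_ge, h'.not_gt]
      · simp [h', h.not_ge, h'.not_ge]
  have hsplit : laplaceSeries 0 v z = laplaceSeries 0 ((Ioc 0 1).indicator v) z +
      laplaceSeries 0 ((Ioi 1).indicator v) z := by
    rw [← laplaceSeries_zero_add hc hv1 hv2 hz, laplaceSeries_zero_eq, laplaceSeries_zero_eq]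
    refine setIntegral_congr_fun measurableSet_Ioi fun x hx => ?_
    nth_rewrite 1 [hv]
    simp [(mem_Ioi.1 hx).not_ge]
  rw [Pi.sub_apply, laplaceSeries_eq_pow_mul N w, hsplit, mul_add, hnear z hz]
  simp only [P, Polynomial.eval_neg, Polynomial.eval_finsetSum, Polynomial.eval_mul,
    Polynomial.eval_C, Polynomial.eval_pow, Polynomial.eval_X]
  ring

/-- The factor `x^{A+1}` compensates `(1 - e^{-x})^{-(A+1)} ≤ (2 / x)^{A+1}`, which makes the Taylor
expansion at `z = 1` to order `A` legitimate. -/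
lemma cutLaplaceSeries_mem_nearPoly (hc : 0 < c) {w : ℝ → ℂ} (hw : IntegrableOn w (Ioc 0 1))
    (hO : w =O[𝓝[>] 0] fun x : ℝ => x ^ (A + 1)) : cutLaplaceSeries w ∈ nearPoly c A := by
  refine laplaceSeries_zero_mem_nearPoly hc ?_
  obtain ⟨C, hC, hb⟩ := hO.exists_pos
  obtain ⟨ε, hε, hbε⟩ := mem_nhdsGT_iff_exists_Ioo_subset.1 hb.bound
  set g : ℝ → ℂ := (Ioc 0 1).indicator w
  have hg : IntegrableOn g (Ioi 0) := integrableOn_indicator_Ioc hw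
  set M := (1 - Real.exp (-ε))⁻¹ ^ (A + 1)
  have hlow : ∀ x ∈ Ioc (0 : ℝ) 1, x / 2 ≤ 1 - Real.exp (-x) := by
    intro x hx
    have h1 := Real.add_one_le_exp x
    have h2 : Real.exp (-x) ≤ (1 + x)⁻¹ := by
      rw [Real.exp_neg]
      exact inv_anti₀ (by linarith [hx.1]) (by linarith)
    have h3 : (1 + x)⁻¹ ≤ 1 - x / 2 := by
      rw [inv_le_iff_one_le_mul₀ (by linarith [hx.1])]
      nlinarith [hx.1, hx.2]
    linarith
  refine Integrable.mono' (g := fun x => ‖g x‖ * M + (Ioc (0 : ℝ) 1).indicator (fun _ => C * 2 ^ (A + 1)) x)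
    ((hg.norm.mul_const _).add ((integrable_indicator_iff measurableSet_Ioc).2
      (integrableOn_const (by simp))).integrableOn)
    (hg.aestronglyMeasurable.mul (ContinuousOn.aestronglyMeasurable (ContinuousOn.pow
      (ContinuousOn.inv₀ (by fun_prop) fun x hx =>
        Complex.ofReal_ne_zero.2 (by linarith [(exp_neg_mem hx).2])) _) measurableSet_Ioi)) ?_
  have hεM : 0 < 1 - Real.exp (-ε) := by linarith [(exp_neg_mem hε).2]
  filter_upwards [ae_restrict_mem measurableSet_Ioi] with x hx
  by_cases h : x ∈ Ioc (0 : ℝ) 1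
  · have h0 : 0 < 1 - Real.exp (-x) := by linarith [(exp_neg_mem hx).2]
    rw [norm_mul, norm_pow, norm_inv, Complex.norm_real, Real.norm_of_nonneg h0.le,
      indicator_of_mem h]
    simp only [g, indicator_of_mem h]
    rcases lt_or_ge x ε with hxε | hxε
    · have h1 : ‖w x‖ ≤ C * ‖x ^ (A + 1)‖ := hbε ⟨hx, hxε⟩
      have h2 : (1 - Real.exp (-x))⁻¹ ≤ 2 / x := by
        rw [inv_le_comm₀ h0 (by have := h.1; positivity), inv_div]
        exact hlow x h
      have h3 : ‖w x‖ * (1 - Real.exp (-x))⁻¹ ^ (A + 1) ≤ C * x ^ (A + 1) * (2 / x) ^ (A + 1) := by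
        rw [Real.norm_of_nonneg (pow_nonneg h.1.le _)] at h1
        exact mul_le_mul h1 (pow_le_pow_left₀ (inv_pos.2 h0).le h2 _)
          (pow_nonneg (inv_pos.2 h0).le _) ((norm_nonneg _).trans h1)
      have h4 : C * x ^ (A + 1) * (2 / x) ^ (A + 1) = C * 2 ^ (A + 1) := by
        rw [mul_assoc, ← mul_pow]
        congr 2
        field_simp [h.1.ne']
      have h5 : 0 ≤ ‖w x‖ * M := by positivity
      linarith
    · have h1 : (1 - Real.exp (-x))⁻¹ ^ (A + 1) ≤ M := by
        simp only [M]
        gcongr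
      have h2 : 0 ≤ C * 2 ^ (A + 1) := by positivity
      have h3 := mul_le_mul_of_nonneg_left h1 (norm_nonneg (w x))
      linarith
  · simp [g, h]

/-- Weights integrable at `0` whose transforms belong to a given space of germs. -/
noncomputable def weightsInto (c : ℝ) (hc : 0 < c) (A : ℕ) (S : Submodule ℂ (ℂ → ℂ)) :
    Submodule ℂ (ℝ → ℂ) where
  carrier := {w | IntegrableOn w (Ioc 0 1) ∧ cutLaplaceSeries w ∈ S ⊔ nearPoly c A}
  zero_mem' := ⟨integrableOn_zero, by
    have : cutLaplaceSeries 0 = 0 := by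
      have := cutLaplaceSeries_smul 0 (0 : ℝ → ℂ)
      simpa using this
    rw [this]; exact zero_mem _⟩
  add_mem' := by
    rintro w₁ w₂ ⟨h₁, h₁'⟩ ⟨h₂, h₂'⟩
    refine ⟨h₁.add h₂, ?_⟩
    have h3 : cutLaplaceSeries (w₁ + w₂) - (cutLaplaceSeries w₁ + cutLaplaceSeries w₂) ∈
        nearPoly c A := by
      refine nearPoly_congr (F := 0) ?_ (zero_mem _)
      filter_upwards [self_mem_nhdsWithin] with z hz
      simp [cutLaplaceSeries_add hc h₁ h₂ hz]
    have h4 := add_mem (add_mem h₁' h₂') (Submodule.mem_sup_right (S := S) h3)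
    rwa [add_sub_cancel] at h4
  smul_mem' := by
    rintro k w ⟨h, h'⟩
    exact ⟨h.smul k, by rw [cutLaplaceSeries_smul]; exact Submodule.smul_mem _ k h'⟩

/-- The Laplace series continues the power series of moments. -/
lemma laplaceSeries_one_continues (hc : 0 < c) {w : ℝ → ℂ}
    (hw : IntegrableOn (fun x => w x * (Real.exp (-x) : ℂ)) (Ioi 0)) :
    Continues c (fun n => if n = 0 then 0 else ∫ x in Ioi (0 : ℝ), w x * (Real.exp (-x) : ℂ) ^ n)
      (laplaceSeries 1 w) := by
  set v : ℝ → ℂ := fun x => w x * (Real.exp (-x) : ℂ)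
  have heq : laplaceSeries 1 w = fun z : ℂ => z * ∫ x in Ioi (0 : ℝ), v x * (1 - Real.exp (-x) * z)⁻¹ := by
    ext z
    rw [laplaceSeries_eq_pow_mul, laplaceSeries_zero_eq]
    simp [v]
  obtain ⟨C, hC0, hC⟩ := norm_one_sub_le_mul_norm_one_sub_mul hc
  rw [heq]
  constructor
  · refine differentiableOn_id.mul (differentiableOn_integral_of_holomorphic
      (isOpen_spiralDomain hc) (fun z hz => (integrableOn_mul_kernel hc hw hz).aestronglyMeasurable)
      ?_ fun z₀ hz₀ => ?_)
    · filter_upwards [ae_restrict_mem measurableSet_Ioi] with x hx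
      refine DifferentiableOn.const_mul (DifferentiableOn.inv (by fun_prop) fun z hz => ?_) _
      exact one_sub_exp_neg_mul_ne_zero hc hz hx
    · have h0 : 0 < ‖1 - z₀‖ :=
        norm_pos_iff.2 (sub_ne_zero.2 (ne_one_of_mem_spiralDomain hz₀).symm)
      have h1 : ∀ᶠ z in 𝓝 z₀, ‖1 - z₀‖ / 2 < ‖1 - z‖ :=
        (by fun_prop : ContinuousAt (fun z : ℂ => ‖1 - z‖) z₀).eventually
          (lt_mem_nhds (half_lt_self h0))
      refine ⟨_, inter_mem h1 ((isOpen_spiralDomain hc).mem_nhds hz₀),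
        fun x => ‖v x‖ * (C / (‖1 - z₀‖ / 2)), hw.norm.mul_const _, ?_⟩
      filter_upwards [ae_restrict_mem measurableSet_Ioi] with x hx z hz
      rw [norm_mul]
      gcongr
      refine (norm_kernel_le (ne_one_of_mem_spiralDomain hz.2) (hC z hz.2) hx).trans ?_
      have := hz.1
      gcongr
      exact (show ‖1 - z₀‖ / 2 < ‖1 - z‖ from this).le
  · intro z hz
    rw [← hasSum_nat_add_iff' 1]
    simp only [Finset.range_one, Finset.sum_singleton, if_true, zero_mul, sub_zero]
    have h := hasSum_integral_of_dominated_convergence (μ := volume.restrict (Ioi (0 : ℝ)))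
      (F := fun n (x : ℝ) => v x * ((Real.exp (-x) : ℂ) ^ n * z ^ n))
      (f := fun x : ℝ => v x * (1 - Real.exp (-x) * z)⁻¹)
      (fun n x => ‖v x‖ * ‖z‖ ^ n)
      (fun n => hw.aestronglyMeasurable.mul (by fun_prop : Continuous fun x : ℝ =>
        (Real.exp (-x) : ℂ) ^ n * z ^ n).aestronglyMeasurable)
      (fun n => ?_) ?_ ?_ ?_
    · refine (h.mul_left z).congr_fun fun n => ?_
      simp only [Nat.succ_ne_zero, if_false, ← integral_const_mul, ← integral_mul_const]
      refine integral_congr_ae (Eventually.of_forall fun x => ?_)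
      simp only [v]
      ring
    · filter_upwards [ae_restrict_mem measurableSet_Ioi] with x hx
      have hq := exp_neg_mem hx
      rw [norm_mul]
      refine mul_le_mul_of_nonneg_left ?_ (norm_nonneg _)
      rw [norm_mul, norm_pow, norm_pow, Complex.norm_real, Real.norm_of_nonneg hq.1.le]
      exact mul_le_of_le_one_left (by positivity) (pow_le_one₀ hq.1.le hq.2.le)
    · exact Eventually.of_forall fun x =>
        (summable_geometric_of_lt_one (norm_nonneg z) hz).mul_left _
    · simp only [tsum_mul_left]
      exact hw.norm.mul_const _
    · filter_upwards [ae_restrict_mem measurableSet_Ioi] with x hx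
      have hq := exp_neg_mem hx
      have h1 : ‖(Real.exp (-x) : ℂ) * z‖ < 1 := by
        rw [norm_mul, Complex.norm_real, Real.norm_of_nonneg hq.1.le]
        exact lt_of_le_of_lt (mul_le_of_le_one_left (norm_nonneg _) hq.2.le) hz
      refine ((hasSum_geometric_of_norm_lt_one h1).mul_left (v x)).congr_fun fun n => ?_
      rw [mul_pow]

/-! ### The weights `x^s log^j x` and their substitutes -/

/-- The function `x^s (log x)^j` on the positive half-line. -/
noncomputable def powLog (s : ℂ) (j : ℕ) (x : ℝ) : ℂ := (x : ℂ) ^ s * (Real.log x : ℂ) ^ j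

/-- The function `(e^x - 1)^s (log (e^x - 1))^j` on the positive half-line. -/
noncomputable def expPowLog (s : ℂ) (j : ℕ) (x : ℝ) : ℂ := powLog s j (Real.exp x - 1)

lemma norm_powLog {s : ℂ} {j : ℕ} {x : ℝ} (hx : 0 < x) :
    ‖powLog s j x‖ = x ^ s.re * |Real.log x| ^ j := by
  rw [powLog, norm_mul, norm_pow, Complex.norm_cpow_eq_rpow_re_of_pos hx, Complex.norm_real,
    Real.norm_eq_abs]

lemma exp_sub_one_pos {x : ℝ} (hx : 0 < x) : 0 < Real.exp x - 1 :=
  sub_pos.2 (Real.one_lt_exp_iff.2 hx)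

lemma continuousOn_powLog (s : ℂ) (j : ℕ) : ContinuousOn (powLog s j) (Ioi 0) := by
  refine ContinuousOn.mul (fun x hx => ContinuousAt.continuousWithinAt ?_)
    ((Complex.continuous_ofReal.comp_continuousOn (Real.continuousOn_log.mono fun x hx =>
      (ne_of_gt hx : x ≠ 0))).pow j)
  exact Complex.continuousAt_ofReal_cpow_const x s (Or.inr (ne_of_gt hx))

lemma continuousOn_expPowLog (s : ℂ) (j : ℕ) : ContinuousOn (expPowLog s j) (Ioi 0) :=
  (continuousOn_powLog s j).comp (by fun_prop) fun _ hx => exp_sub_one_pos hx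

lemma rpow_le_add_rpow {x r p q : ℝ} (hx : 0 < x) (hp : p ≤ r) (hq : r ≤ q) :
    x ^ r ≤ x ^ p + x ^ q := by
  rcases le_total x 1 with h | h
  · linarith [Real.rpow_le_rpow_of_exponent_ge hx h hp, Real.rpow_pos_of_pos hx q]
  · linarith [Real.rpow_le_rpow_of_exponent_le h hq, Real.rpow_pos_of_pos hx p]

lemma abs_log_pow_le (j : ℕ) {ε : ℝ} (hε : 0 < ε) :
    ∃ C > 0, ∀ x : ℝ, 0 < x → |Real.log x| ^ j ≤ C * (x ^ (-ε) + x ^ ε) := by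
  set δ := ε / (j + 1)
  have hδ : 0 < δ := by positivity
  refine ⟨(1 / δ) ^ j, by positivity, fun x hx => ?_⟩
  have h1 : ∀ y : ℝ, 1 ≤ y → |Real.log y| ^ j ≤ (1 / δ) ^ j * y ^ ε := by
    intro y hy
    have hy0 : 0 < y := by linarith
    rw [abs_of_nonneg (Real.log_nonneg hy)]
    have h2 := Real.log_le_rpow_div hy0.le hδ
    calc Real.log y ^ j ≤ (y ^ δ / δ) ^ j := pow_le_pow_left₀ (Real.log_nonneg hy) h2 j
      _ = (1 / δ) ^ j * y ^ (δ * j) := by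
          rw [Real.rpow_mul hy0.le, Real.rpow_natCast, ← mul_pow]; congr 1; ring
      _ ≤ (1 / δ) ^ j * y ^ ε := by
          refine mul_le_mul_of_nonneg_left (Real.rpow_le_rpow_of_exponent_le hy ?_) (by positivity)
          rw [div_mul_eq_mul_div, div_le_iff₀ (by positivity)]
          nlinarith
  rcases le_total 1 x with h | h
  · refine (h1 x h).trans ?_
    gcongr
    linarith [Real.rpow_pos_of_pos hx (-ε)]
  · have h2 := h1 x⁻¹ ((one_le_inv₀ hx).2 h)
    rw [Real.log_inv, abs_neg, Real.inv_rpow hx.le, ← Real.rpow_neg hx.le] at h2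
    refine h2.trans ?_
    gcongr
    linarith [Real.rpow_pos_of_pos hx ε]

lemma norm_powLog_le (j : ℕ) {p q σ τ : ℝ} (hp : p < σ) (hq : τ < q) :
    ∃ C > 0, ∀ s : ℂ, σ ≤ s.re → s.re ≤ τ → ∀ x : ℝ, 0 < x →
      ‖powLog s j x‖ ≤ C * (x ^ p + x ^ q) := by
  set ε := min (σ - p) (q - τ)
  have hε : 0 < ε := lt_min (by linarith) (by linarith)
  have hε1 : ε ≤ σ - p := min_le_left _ _
  have hε2 : ε ≤ q - τ := min_le_right _ _
  obtain ⟨C, hC, h⟩ := abs_log_pow_le j hε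
  refine ⟨2 * C, by positivity, fun s h1 h2 x hx => ?_⟩
  rw [norm_powLog hx]
  calc x ^ s.re * |Real.log x| ^ j ≤ x ^ s.re * (C * (x ^ (-ε) + x ^ ε)) := by
        gcongr; exact h x hx
    _ = C * (x ^ (s.re + -ε) + x ^ (s.re + ε)) := by
        rw [Real.rpow_add hx, Real.rpow_add hx]; ring
    _ ≤ C * ((x ^ p + x ^ q) + (x ^ p + x ^ q)) := by
        gcongr
        · exact rpow_le_add_rpow hx (by linarith) (by linarith)
        · exact rpow_le_add_rpow hx (by linarith) (by linarith)
    _ = _ := by ring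

lemma powLog_isBigO {s : ℂ} {r : ℝ} (hr : r < s.re) (j : ℕ) :
    powLog s j =O[𝓝[>] 0] fun x : ℝ => x ^ r := by
  obtain ⟨C, hC, h⟩ := norm_powLog_le j hr (lt_add_one s.re)
  refine IsBigO.of_bound (2 * C) ?_
  filter_upwards [Ioc_mem_nhdsGT one_pos] with x hx
  have h1 := h s le_rfl le_rfl x hx.1
  have h2 := Real.rpow_le_rpow_of_exponent_ge hx.1 hx.2 (by linarith : r ≤ s.re + 1)
  rw [Real.norm_of_nonneg (Real.rpow_pos_of_pos hx.1 r).le]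
  nlinarith

lemma integrableOn_powLog_mul_exp {s : ℂ} (hs : -1 < s.re) (j : ℕ) :
    IntegrableOn (fun x => powLog s j x * (Real.exp (-x) : ℂ)) (Ioi 0) := by
  obtain ⟨p, hp, hps⟩ := exists_between hs
  obtain ⟨C, hC, h⟩ := norm_powLog_le j hps (lt_add_one s.re)
  have h1 := Real.GammaIntegral_convergent (s := p + 1) (by linarith)
  have h2 := Real.GammaIntegral_convergent (s := s.re + 1 + 1) (by linarith)
  refine Integrable.mono' ((h1.add h2).const_mul C) (ContinuousOn.aestronglyMeasurable
    ((continuousOn_powLog s j).mul (by fun_prop)) measurableSet_Ioi) ?_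
  filter_upwards [ae_restrict_mem measurableSet_Ioi] with x hx
  rw [norm_mul, Complex.norm_real, Real.norm_of_nonneg (Real.exp_pos _).le]
  have h3 := mul_le_mul_of_nonneg_right (h s le_rfl le_rfl x hx) (Real.exp_pos (-x)).le
  simp only [Pi.add_apply, add_sub_cancel_right]
  linarith

/-- An integrable majorant for the weights `expPowLog`, locally uniform in the exponent. -/
lemma norm_expPowLog_mul_le (j : ℕ) {N : ℕ} (hN : 1 ≤ N) {σ τ : ℝ} (hσ : -1 < σ) (hστ : σ ≤ τ)
    (hτ : τ < N) :
    ∃ g : ℝ → ℝ, IntegrableOn g (Ioi 0) ∧ ∀ s : ℂ, σ ≤ s.re → s.re ≤ τ → ∀ x : ℝ, 0 < x →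
      ‖expPowLog s j x * (Real.exp (-x) : ℂ) ^ N‖ ≤ g x := by
  have hN' : (1 : ℝ) ≤ N := by exact_mod_cast hN
  -- The signs `p < 0 < q` allow `e^x - 1 ≥ x` to be used in the first power and `e^x - 1 ≤ e^x` in
  -- the second; `p > -1` and `q < N` give integrability at `0` and at infinity.
  obtain ⟨p, hp, hp2⟩ := exists_between (lt_min hσ (by norm_num : (-1 : ℝ) < 0))
  obtain ⟨q, hq2, hq⟩ := exists_between (max_lt hτ (by linarith : (0 : ℝ) < N))
  obtain ⟨hpσ, hp0⟩ := lt_min_iff.1 hp2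
  obtain ⟨hτq, hq0⟩ := max_lt_iff.1 hq2
  obtain ⟨C, hC, h⟩ := norm_powLog_le j hpσ hτq
  have h1 := Real.GammaIntegral_convergent (s := p + 1) (by linarith)
  have h2 := exp_neg_integrableOn_Ioi 0 (by linarith : 0 < N - q)
  refine ⟨_, (h1.add h2).const_mul C, fun s hs1 hs2 x hx => ?_⟩
  have hy := exp_sub_one_pos hx
  have h3 : (Real.exp x - 1) ^ p ≤ x ^ p :=
    Real.rpow_le_rpow_of_nonpos hx (by linarith [Real.add_one_le_exp x]) hp0.le
  have h4 : (Real.exp x - 1) ^ q ≤ Real.exp (x * q) := by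
    rw [Real.exp_mul]
    exact Real.rpow_le_rpow hy.le (by linarith) hq0.le
  have h5 : Real.exp (-x) ^ N ≤ Real.exp (-x) :=
    pow_le_of_le_one (Real.exp_pos _).le (exp_neg_mem hx).2.le (by omega)
  have h6 : Real.exp (x * q) * Real.exp (-x) ^ N = Real.exp (-(N - q) * x) := by
    rw [← Real.exp_nat_mul, ← Real.exp_add]
    congr 1
    ring
  rw [norm_mul, norm_pow, Complex.norm_real, Real.norm_of_nonneg (Real.exp_pos _).le]
  simp only [Pi.add_apply, add_sub_cancel_right]
  calc ‖expPowLog s j x‖ * Real.exp (-x) ^ N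
      ≤ (C * (x ^ p + Real.exp (x * q))) * Real.exp (-x) ^ N := by
        refine mul_le_mul_of_nonneg_right ((h s hs1 hs2 _ hy).trans ?_) (by positivity)
        gcongr
    _ = C * (Real.exp (-x) ^ N * x ^ p + Real.exp (x * q) * Real.exp (-x) ^ N) := by ring
    _ ≤ C * (Real.exp (-x) * x ^ p + Real.exp (-(N - q) * x)) := by
        rw [h6]
        gcongr

lemma integrableOn_expPowLog_mul {s : ℂ} (hs : -1 < s.re) (j : ℕ) {N : ℕ} (hN : 1 ≤ N)
    (hsN : s.re < N) :
    IntegrableOn (fun x => expPowLog s j x * (Real.exp (-x) : ℂ) ^ N) (Ioi 0) := by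
  obtain ⟨g, hg, h⟩ := norm_expPowLog_mul_le j hN hs le_rfl hsN
  refine Integrable.mono' hg (ContinuousOn.aestronglyMeasurable
    ((continuousOn_expPowLog s j).mul (by fun_prop)) measurableSet_Ioi) ?_
  filter_upwards [ae_restrict_mem measurableSet_Ioi] with x hx
  exact h s le_rfl le_rfl x hx

/-! ### Expansions at `0` -/

/-- The span of the functions `x^{s+m} log^i x`, `m, i ≥ 0`. -/
noncomputable def powLogSpan (s : ℂ) : Submodule ℂ (ℝ → ℂ) :=
  Submodule.span ℂ (range fun p : ℕ × ℕ => powLog (s + p.1) p.2)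

lemma exists_polynomial_isBigO_of_analyticAt {H : ℂ → ℂ} (hH : AnalyticAt ℂ H 0) (M : ℕ) :
    ∃ p : Polynomial ℂ, (fun x : ℝ => H x - p.eval (x : ℂ)) =O[𝓝[>] 0] fun x : ℝ => x ^ M := by
  obtain ⟨s, hs⟩ := hH
  have h1 := hs.isBigO_sub_partialSum_pow M
  have h2 : Tendsto (fun x : ℝ => (x : ℂ)) (𝓝[>] 0) (𝓝 0) := by
    have : ContinuousAt (fun x : ℝ => (x : ℂ)) 0 := by fun_prop
    simpa [ContinuousAt] using this.mono_left nhdsWithin_le_nhds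
  have h3 := h1.comp_tendsto h2
  refine ⟨∑ k ∈ Finset.range M, Polynomial.C (s.coeff k) * Polynomial.X ^ k, ?_⟩
  refine (h3.congr (fun x => ?_) (fun x => ?_)).trans
    (g := fun x : ℝ => ‖x‖ ^ M) (isBigO_refl _ _) |>.trans (isBigO_of_le _ fun x => by simp)
  · simp only [Function.comp_apply, zero_add, FormalMultilinearSeries.partialSum,
      Polynomial.eval_finsetSum]
    congr 1
    refine Finset.sum_congr rfl fun k _ => ?_
    rw [FormalMultilinearSeries.apply_eq_pow_smul_coeff, Polynomial.eval_mul, Polynomial.eval_C,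
      Polynomial.eval_pow, Polynomial.eval_X, smul_eq_mul, mul_comm]
  · simp

lemma powLog_add_nat {s : ℂ} {j m : ℕ} {x : ℝ} (hx : 0 < x) :
    powLog (s + m) j x = powLog s j x * (x : ℂ) ^ m := by
  rw [powLog, Complex.cpow_add _ _ (Complex.ofReal_ne_zero.2 hx.ne'), Complex.cpow_natCast, powLog]
  ring

lemma exists_expansion_powLog_mul {H : ℂ → ℂ} (hH : AnalyticAt ℂ H 0) (s : ℂ) (j : ℕ) (B : ℕ) :
    ∃ w ∈ powLogSpan s, (fun x : ℝ => powLog s j x * H x - w x) =O[𝓝[>] 0] fun x : ℝ => x ^ B := by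
  -- One unit of the exponent is sacrificed to absorb the logarithms, so the Taylor remainder must
  -- have order at least `B - (Re s - 1)`.
  obtain ⟨M, hM⟩ := exists_nat_ge (B - (s.re - 1))
  obtain ⟨p, hp⟩ := exists_polynomial_isBigO_of_analyticAt hH M
  refine ⟨∑ k ∈ p.support, p.coeff k • powLog (s + k) j, Submodule.sum_mem _ fun k _ =>
    Submodule.smul_mem _ _ (Submodule.subset_span ⟨(k, j), rfl⟩), ?_⟩
  have h1 := (powLog_isBigO (by linarith : s.re - 1 < s.re) j).mul hp
  refine (h1.congr' ?_ EventuallyEq.rfl).trans (IsBigO.of_bound 1 ?_)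
  · filter_upwards [self_mem_nhdsWithin] with x hx
    rw [mul_sub]
    congr 1
    simp only [Finset.sum_apply, Pi.smul_apply, smul_eq_mul, Polynomial.eval_eq_sum,
      Polynomial.sum, Finset.mul_sum]
    refine Finset.sum_congr rfl fun k _ => ?_
    rw [powLog_add_nat hx]
    ring
  · filter_upwards [Ioc_mem_nhdsGT one_pos] with x hx
    rw [one_mul, ← Real.rpow_natCast, ← Real.rpow_natCast, ← Real.rpow_add hx.1,
      Real.norm_of_nonneg (Real.rpow_pos_of_pos hx.1 _).le,
      Real.norm_of_nonneg (Real.rpow_pos_of_pos hx.1 _).le]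
    exact Real.rpow_le_rpow_of_exponent_ge hx.1 hx.2 (by linarith)

/-- From `ψ = x g` come `ψ^s = x^s g^s` and `log ψ = log x + log g`. Since `g(0) = 1`, the factors
involving `g` are analytic at `0`, and the binomial formula separates the powers of `log x`. It is
applied to `e^x - 1` and to its inverse function. -/
lemma exists_expansion_powLog_comp {ψ : ℝ → ℝ} {g : ℂ → ℂ} (hg : AnalyticAt ℂ g 0) (hg0 : g 0 = 1)
    (hψ : ∀ᶠ x in 𝓝[>] 0, 0 < ψ x ∧ (ψ x : ℂ) = x * g x) (s : ℂ) (j : ℕ) (B : ℕ) :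
    ∃ w ∈ powLogSpan s, (fun x : ℝ => powLog s j (ψ x) - w x) =O[𝓝[>] 0] fun x : ℝ => x ^ B := by
  have hslit : g 0 ∈ Complex.slitPlane := hg0 ▸ Complex.one_mem_slitPlane
  have hH : ∀ i, AnalyticAt ℂ
      (fun z => g z ^ s * Complex.log (g z) ^ (j - i) * (j.choose i : ℂ)) 0 := fun i =>
    ((hg.cpow analyticAt_const hslit).mul ((hg.clog hslit).pow _)).mul analyticAt_const
  choose w hw hwO using fun i => exists_expansion_powLog_mul (hH i) s i B
  refine ⟨∑ i ∈ Finset.range (j + 1), w i, Submodule.sum_mem _ fun i _ => hw i, ?_⟩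
  refine (IsBigO.sum fun i (_ : i ∈ Finset.range (j + 1)) => hwO i).congr' ?_ EventuallyEq.rfl
  filter_upwards [hψ, self_mem_nhdsWithin] with x hx hx0
  rw [Finset.sum_apply, Finset.sum_apply, Finset.sum_sub_distrib]
  congr 1
  have hx0' : (x : ℂ) ≠ 0 := Complex.ofReal_ne_zero.2 (ne_of_gt hx0)
  have hgx : g x ≠ 0 := fun h0 => by
    rw [h0, mul_zero] at hx
    exact hx.1.ne' (Complex.ofReal_eq_zero.1 hx.2)
  have hlog : (Real.log (ψ x) : ℂ) = Real.log x + Complex.log (g x) := by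
    rw [Complex.ofReal_log hx.1.le, hx.2, Complex.log_ofReal_mul hx0 hgx]
  have hpow : (ψ x : ℂ) ^ s = (x : ℂ) ^ s * g x ^ s := by
    rw [hx.2, Complex.cpow_def_of_ne_zero (mul_ne_zero hx0' hgx), Complex.log_ofReal_mul hx0 hgx,
      add_mul, Complex.exp_add, Complex.cpow_def_of_ne_zero hx0', Complex.cpow_def_of_ne_zero hgx,
      Complex.ofReal_log hx0.le]
  rw [powLog, hlog, hpow, add_pow, Finset.mul_sum]
  refine Finset.sum_congr rfl fun i _ => ?_
  rw [powLog]
  ring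

lemma analyticAt_dslope_zero {h : ℂ → ℂ} (hh : ∀ᶠ z in 𝓝 0, DifferentiableAt ℂ h z) :
    AnalyticAt ℂ (dslope h 0) 0 := by
  obtain ⟨s, hs, hs'⟩ := hh.exists_mem
  refine DifferentiableOn.analyticAt ((Complex.differentiableOn_dslope hs).2 fun z hz =>
    (hs' z hz).differentiableWithinAt) hs

lemma exists_expansion_expPowLog (s : ℂ) (j : ℕ) (B : ℕ) :
    ∃ w ∈ powLogSpan s, (fun x : ℝ => expPowLog s j x - w x) =O[𝓝[>] 0] fun x : ℝ => x ^ B := by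
  refine exists_expansion_powLog_comp (ψ := fun x => Real.exp x - 1) (g := dslope Complex.exp 0)
    (analyticAt_dslope_zero (Eventually.of_forall fun z => by fun_prop)) (by simp [dslope_same]) ?_
    s j B
  filter_upwards [self_mem_nhdsWithin] with x hx
  refine ⟨exp_sub_one_pos hx, ?_⟩
  have := sub_smul_dslope Complex.exp 0 (x : ℂ)
  simp only [sub_zero, smul_eq_mul, Complex.exp_zero] at this
  rw [this]
  push_cast
  rfl

/-- The span of the functions `expPowLog (s + m) i`, `m, i ≥ 0`. -/
noncomputable def expPowLogSpan (s : ℂ) : Submodule ℂ (ℝ → ℂ) :=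
  Submodule.span ℂ (range fun p : ℕ × ℕ => expPowLog (s + p.1) p.2)

lemma comp_mem_expPowLogSpan {s : ℂ} {w : ℝ → ℂ} (hw : w ∈ powLogSpan s) :
    (fun x => w (Real.exp x - 1)) ∈ expPowLogSpan s := by
  induction hw using Submodule.span_induction with
  | mem w h =>
    obtain ⟨p, rfl⟩ := h
    exact Submodule.subset_span ⟨p, rfl⟩
  | zero => exact zero_mem _
  | add u v _ _ hu hv => exact add_mem hu hv
  | smul k u _ hu => exact Submodule.smul_mem _ k hu

lemma exists_expansion_powLog (s : ℂ) (j : ℕ) (B : ℕ) :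
    ∃ w ∈ expPowLogSpan s, (fun x : ℝ => powLog s j x - w x) =O[𝓝[>] 0] fun x : ℝ => x ^ B := by
  have hd : ∀ᶠ z : ℂ in 𝓝 0, DifferentiableAt ℂ (fun z => Complex.log (1 + z)) z := by
    have h1 : ContinuousAt (fun z : ℂ => 1 + z) 0 := by fun_prop
    filter_upwards [h1.eventually (Complex.isOpen_slitPlane.mem_nhds
      (by simp : (1 : ℂ) + 0 ∈ Complex.slitPlane))] with z hz
    exact (by fun_prop : DifferentiableAt ℂ (fun z : ℂ => 1 + z) z).clog hz
  have hder : HasDerivAt (fun z : ℂ => Complex.log (1 + z)) 1 0 := by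
    have h := ((hasDerivAt_id (0 : ℂ)).const_add 1).clog (by simp)
    simpa using h
  obtain ⟨w, hw, hO⟩ := exists_expansion_powLog_comp (ψ := fun y => Real.log (1 + y))
    (g := dslope (fun z => Complex.log (1 + z)) 0) (analyticAt_dslope_zero hd)
    (by rw [dslope_same, hder.deriv]) (by
      filter_upwards [self_mem_nhdsWithin] with y hy
      have hy' : 0 < y := hy
      refine ⟨Real.log_pos (by linarith), ?_⟩
      have := sub_smul_dslope (fun z => Complex.log (1 + z)) 0 (y : ℂ)
      simp only [sub_zero, smul_eq_mul, add_zero, Complex.log_one] at this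
      rw [this, Complex.ofReal_log (by linarith)]
      push_cast
      rfl) s j B
  have ht : Tendsto (fun x : ℝ => Real.exp x - 1) (𝓝[>] 0) (𝓝[>] 0) := by
    refine tendsto_nhdsWithin_iff.2 ⟨?_, ?_⟩
    · have : ContinuousAt (fun x : ℝ => Real.exp x - 1) 0 := by fun_prop
      simpa [ContinuousAt] using this.mono_left nhdsWithin_le_nhds
    · filter_upwards [self_mem_nhdsWithin] with x hx using exp_sub_one_pos hx
  refine ⟨_, comp_mem_expPowLogSpan hw, ((hO.comp_tendsto ht).congr (fun x => ?_) fun x => rfl).trans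
    (IsBigO.pow ?_ B)⟩
  · simp
  · have h := (Real.hasDerivAt_exp 0).isBigO_sub
    simp only [Real.exp_zero, sub_zero] at h
    exact h.mono nhdsWithin_le_nhds

/-! ### The binomial series as a Laplace series -/

/-- The function `(1 - z)^s (log (1 - z))^k`. -/
noncomputable def logScale (s : ℂ) (k : ℕ) (z : ℂ) : ℂ := (1 - z) ^ s * Complex.log (1 - z) ^ k

/-- The `n`-th Taylor coefficient of `(1 - z)^s` at `0`. -/
noncomputable def binomCoeff (n : ℕ) (s : ℂ) : ℂ := (ascPochhammer ℂ n).eval (-s) / n.factorial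

lemma hasSum_binomCoeff (s : ℂ) {z : ℂ} (hz : ‖z‖ < 1) :
    HasSum (fun n => binomCoeff n s * z ^ n) ((1 - z) ^ s) := by
  have h := (Complex.one_div_one_sub_cpow_hasFPowerSeriesOnBall_zero (-s)).hasSum
    (y := z) (by simpa [← ofReal_norm] using hz)
  simp only [zero_add, Complex.cpow_neg, one_div, inv_inv] at h
  refine h.congr_fun fun n => ?_
  have h1 : Ring.choose (-s + n - 1) n = binomCoeff n s := by
    rw [binomCoeff, eq_div_iff (by exact_mod_cast n.factorial_ne_zero), mul_comm, ← nsmul_eq_mul,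
      ← Polynomial.ascPochhammer_smeval_eq_eval, ← Ring.factorial_nsmul_multichoose_eq_ascPochhammer,
      Ring.choose]
    congr 2
    ring
  simp [h1, mul_comm]

lemma one_sub_mem_slitPlane {z : ℂ} (hz : z ∈ spiralDomain c) :
    1 - z ∈ Complex.slitPlane := by
  rw [Complex.mem_slitPlane_iff_not_le_zero]
  intro h
  rw [Complex.le_def] at h
  have h1 : z = (z.re : ℂ) := Complex.ext (by simp) (by simpa using h.2)
  rw [h1] at hz
  refine real_notMem_spiralDomain ?_ hz
  simpa using h.1

lemma logScale_zero_continues (c : ℝ) (s : ℂ) :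
    Continues c (fun n => binomCoeff n s) (fun z => (1 - z) ^ s) := by
  refine ⟨fun z hz => DifferentiableAt.differentiableWithinAt ?_, fun z hz => hasSum_binomCoeff s hz⟩
  exact (by fun_prop : DifferentiableAt ℂ (fun z : ℂ => 1 - z) z).cpow_const
    (one_sub_mem_slitPlane hz)

/-- Substituting `t = e^{-x}` turns `(e^x - 1)^s e^{-nx} dx` into `t^{n-s-1} (1 - t)^s dt`. -/
lemma integral_expPowLog_mul (s : ℂ) (n : ℕ) :
    ∫ x in Ioi (0 : ℝ), expPowLog s 0 x * (Real.exp (-x) : ℂ) ^ n =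
      Complex.betaIntegral (n - s) (s + 1) := by
  have him : (fun x : ℝ => Real.exp (-x)) '' Ioi 0 = Ioo 0 1 := by
    ext t
    constructor
    · rintro ⟨x, hx, rfl⟩
      exact exp_neg_mem hx
    · rintro ⟨h0, h1⟩
      exact ⟨-Real.log t, by simpa using Real.log_neg h0 h1, by simp [Real.exp_log h0]⟩
  rw [Complex.betaIntegral, intervalIntegral.integral_of_le zero_le_one,
    integral_Ioc_eq_integral_Ioo, ← him,
    integral_image_eq_integral_abs_deriv_smul (f' := fun x => -Real.exp (-x)) measurableSet_Ioi
      (fun x _ => by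
        have := ((hasDerivAt_neg x).exp).hasDerivWithinAt (s := Ioi 0)
        simpa using this)
      (fun x _ y _ h => by simpa using h)]
  refine setIntegral_congr_fun measurableSet_Ioi fun x hx => ?_
  have hx' := exp_neg_mem hx
  have h1 : Real.exp x - 1 = Real.exp x * (1 - Real.exp (-x)) := by
    rw [mul_sub, ← Real.exp_add]; simp
  have h2 : ∀ (y : ℝ) (w : ℂ), (Real.exp y : ℂ) ^ w = Complex.exp (y * w) := fun y w => by
    rw [Complex.cpow_def_of_ne_zero (Complex.ofReal_ne_zero.2 (Real.exp_pos y).ne'),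
      ← Complex.ofReal_log (Real.exp_pos y).le, Real.log_exp]
  have h3 : (1 : ℂ) - (Real.exp (-x) : ℂ) = ((1 - Real.exp (-x) : ℝ) : ℂ) := by push_cast; rfl
  simp only [expPowLog, powLog, pow_zero, mul_one, abs_neg, abs_of_pos hx'.1, add_sub_cancel_right,
    Complex.real_smul]
  rw [h3, h1, Complex.ofReal_mul, Complex.mul_cpow_ofReal_nonneg (Real.exp_pos _).le
    (by linarith [hx'.2]), h2, h2, Complex.ofReal_exp, ← Complex.exp_nat_mul, mul_right_comm,
    ← Complex.exp_add, ← mul_assoc, ← Complex.exp_add]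
  congr 2
  push_cast
  ring

/-- The periodic factor in the reflection formula. -/
noncomputable def reflectionFactor (s : ℂ) : ℂ := -(Complex.sin (Real.pi * s) / Real.pi)

/-- The coefficient is `Γ(n-s) / (Γ(-s) n!)`, the beta integral is `Γ(n-s) Γ(s+1) / n!`, and the
reflection formula gives `1 / (Γ(-s) Γ(s+1)) = -sin (π s) / π`. When `s` is a natural number smaller
than `n`, both sides vanish. -/
lemma binomCoeff_eq_reflectionFactor_mul {s : ℂ} (hs : -1 < s.re) {n : ℕ} (hn : s.re < n) :
    binomCoeff n s = reflectionFactor s * Complex.betaIntegral (n - s) (s + 1) := by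
  have hpi : (Real.pi : ℂ) ≠ 0 := Complex.ofReal_ne_zero.2 Real.pi_ne_zero
  have hfac : (n.factorial : ℂ) ≠ 0 := by exact_mod_cast n.factorial_ne_zero
  have hB := Complex.Gamma_mul_Gamma_eq_betaIntegral (s := n - s) (t := s + 1)
    (by simpa using hn) (by simp; linarith)
  rw [show (n : ℂ) - s + (s + 1) = n + 1 by ring, Complex.Gamma_nat_eq_factorial] at hB
  rw [binomCoeff, div_eq_iff hfac, mul_assoc, mul_comm _ (n.factorial : ℂ), ← hB]
  by_cases hnat : ∃ m : ℕ, s = m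
  · obtain ⟨m, rfl⟩ := hnat
    have h1 : m < n := by simpa using hn
    rw [ascPochhammer_eval_neg_coe_nat_of_lt h1, reflectionFactor, mul_comm (Real.pi : ℂ),
      Complex.sin_nat_mul_pi]
    simp
  · push Not at hnat
    have hG : ∀ n : ℕ, Complex.Gamma (n - s) = (ascPochhammer ℂ n).eval (-s) * Complex.Gamma (-s) := by
      intro n
      induction n with
      | zero => simp
      | succ n ih =>
        rw [ascPochhammer_succ_eval, show ((n + 1 : ℕ) : ℂ) - s = (n - s) + 1 by push_cast; ring,
          Complex.Gamma_add_one _ (sub_ne_zero.2 (hnat n).symm), ih]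
        ring
    have hR := Complex.Gamma_mul_Gamma_one_sub (-s)
    rw [sub_neg_eq_add, mul_neg, Complex.sin_neg] at hR
    have hne : Complex.Gamma (-s) * Complex.Gamma (1 + s) ≠ 0 := by
      refine mul_ne_zero (Complex.Gamma_ne_zero fun m hm => hnat m (neg_inj.1 hm))
        (Complex.Gamma_ne_zero_of_re_pos (by simp; linarith))
    have hsin : Complex.sin (Real.pi * s) ≠ 0 := fun h0 => by
      rw [h0] at hR
      exact hne (by simpa using hR)
    rw [hG, add_comm s 1, mul_assoc, hR, reflectionFactor]
    have : -(Complex.sin (Real.pi * s) / Real.pi) * (Real.pi / -Complex.sin (Real.pi * s)) = 1 := by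
      field_simp
    rw [mul_left_comm, this, mul_one]

/-- The beta representation of the coefficients holds for `n > Re s` only, so the first `N` terms
are kept apart. Equality of power series in the disc extends by analytic continuation. -/
lemma one_sub_cpow_eq (hc : 0 < c) {s : ℂ} (hs : -1 < s.re) {N : ℕ} (hN : 1 ≤ N) (hsN : s.re < N)
    {z : ℂ} (hz : z ∈ spiralDomain c) :
    (1 - z) ^ s = ∑ n ∈ Finset.range N, binomCoeff n s * z ^ n +
      reflectionFactor s * laplaceSeries N (expPowLog s 0) z := by
  obtain ⟨M, rfl⟩ : ∃ M, N = M + 1 := ⟨N - 1, by omega⟩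
  -- Moving `M = N - 1` exponential factors into the weight reduces to the continuation of a Laplace
  -- series with `N = 1`.
  set w : ℝ → ℂ := fun x => expPowLog s 0 x * (Real.exp (-x) : ℂ) ^ M
  have hint := integrableOn_expPowLog_mul hs 0 hN hsN
  have hC := laplaceSeries_one_continues hc (w := w) (hint.congr_fun (fun x _ => by
    simp only [w]; ring) measurableSet_Ioi)
  have hL : ∀ z, laplaceSeries (M + 1) (expPowLog s 0) z = z ^ M * laplaceSeries 1 w z := by
    intro z
    simp only [laplaceSeries, ← integral_const_mul]
    refine integral_congr_ae (Eventually.of_forall fun x => ?_)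
    simp only [w, mul_pow]
    ring
  have hD1 := (logScale_zero_continues c s).1
  have hD2 : DifferentiableOn ℂ (fun z => ∑ n ∈ Finset.range (M + 1), binomCoeff n s * z ^ n +
      reflectionFactor s * (z ^ M * laplaceSeries 1 w z)) (spiralDomain c) :=
    DifferentiableOn.add (by fun_prop) ((DifferentiableOn.mul (by fun_prop) hC.1).const_mul _)
  have hU := isOpen_spiralDomain hc
  rw [hL]
  refine (hD1.analyticOnNhd hU).eqOn_of_preconnected_of_eventuallyEq (hD2.analyticOnNhd hU)
    (isPreconnected_spiralDomain c) (zero_mem_spiralDomain c) ?_ hz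
  filter_upwards [Metric.ball_mem_nhds (0 : ℂ) one_pos] with z hz
  rw [mem_ball_zero_iff] at hz
  have h1 := (hasSum_nat_add_iff' (M + 1)).2 (hasSum_binomCoeff s hz)
  have h2 := (hasSum_nat_add_iff' 1).2 (hC.2 z hz)
  simp only [Finset.range_one, Finset.sum_singleton, if_true, zero_mul, sub_zero] at h2
  have h3 : HasSum (fun n => binomCoeff (n + (M + 1)) s * z ^ (n + (M + 1))) _ :=
    ((h2.mul_left (z ^ M)).mul_left (reflectionFactor s)).congr_fun fun n => by
      have hlt : s.re < ((n + (M + 1) : ℕ) : ℝ) := by push_cast at hsN ⊢; linarith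
      rw [binomCoeff_eq_reflectionFactor_mul hs hlt, ← integral_expPowLog_mul]
      simp only [Nat.succ_ne_zero, if_false, w]
      have : ∀ x : ℝ, expPowLog s 0 x * (Real.exp (-x) : ℂ) ^ M * (Real.exp (-x) : ℂ) ^ (n + 1) =
          expPowLog s 0 x * (Real.exp (-x) : ℂ) ^ (n + (M + 1)) := fun x => by ring
      simp only [this]
      ring
  linear_combination h1.unique h3

/-! ### Differentiation in the exponent -/

lemma hasDerivAt_powLog (s : ℂ) (j : ℕ) {x : ℝ} (hx : 0 < x) :
    HasDerivAt (fun s => powLog s j x) (powLog s (j + 1) x) s := by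
  have h := ((hasDerivAt_id s).const_cpow (c := (x : ℂ))
    (Or.inl (Complex.ofReal_ne_zero.2 hx.ne'))).mul_const ((Real.log x : ℂ) ^ j)
  refine h.congr_deriv ?_
  rw [powLog, ← Complex.ofReal_log hx.le]
  simp only [id]
  ring

lemma hasDerivAt_laplaceSeries_expPowLog (hc : 0 < c) {z : ℂ} (hz : z ∈ spiralDomain c) {N : ℕ}
    (hN : 1 ≤ N) (j : ℕ) {s : ℂ} (hs : -1 < s.re) (hsN : s.re < N) :
    HasDerivAt (fun s => laplaceSeries N (expPowLog s j) z)
      (laplaceSeries N (expPowLog s (j + 1)) z) s := by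
  obtain ⟨C, hC0, hC⟩ := norm_one_sub_le_mul_norm_one_sub_mul hc
  have hK : ContinuousOn (fun x : ℝ => (Real.exp (-x) * z) ^ N / (1 - Real.exp (-x) * z)) (Ioi 0) :=
    ContinuousOn.div (by fun_prop) (by fun_prop) fun x hx => one_sub_exp_neg_mul_ne_zero hc hz hx
  have hder : ∀ x : ℝ, 0 < x → ∀ s : ℂ, HasDerivAt (fun s => expPowLog s j x *
      ((Real.exp (-x) * z) ^ N / (1 - Real.exp (-x) * z))) (expPowLog s (j + 1) x *
      ((Real.exp (-x) * z) ^ N / (1 - Real.exp (-x) * z))) s := fun x hx s =>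
    (hasDerivAt_powLog s j (exp_sub_one_pos hx)).mul_const _
  have h := hasDerivAt_integral_of_holomorphic (μ := volume.restrict (Ioi (0 : ℝ)))
    (U := {s : ℂ | -1 < s.re} ∩ {s : ℂ | s.re < N})
    (f := fun s x => expPowLog s j x * ((Real.exp (-x) * z) ^ N / (1 - Real.exp (-x) * z)))
    ((isOpen_lt continuous_const Complex.continuous_re).inter
      (isOpen_lt Complex.continuous_re continuous_const))
    (fun s _ => ((continuousOn_expPowLog s j).mul hK).aestronglyMeasurable measurableSet_Ioi)
    ((ae_restrict_mem measurableSet_Ioi).mono fun x hx s _ =>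
      (hder x hx s).differentiableAt.differentiableWithinAt) (z₀ := s) ⟨hs, hsN⟩ ?_
  · refine h.congr_deriv (setIntegral_congr_fun measurableSet_Ioi fun x hx => ?_)
    exact (hder x hx s).deriv
  · obtain ⟨σ, hσ, hσs⟩ := exists_between hs
    obtain ⟨τ, hsτ, hτ⟩ := exists_between hsN
    obtain ⟨g, hg, hgb⟩ := norm_expPowLog_mul_le j hN hσ (hσs.trans hsτ).le hτ
    refine ⟨{s : ℂ | σ < s.re} ∩ {s : ℂ | s.re < τ}, ((isOpen_lt continuous_const
      Complex.continuous_re).inter (isOpen_lt Complex.continuous_re continuous_const)).mem_nhds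
      ⟨hσs, hsτ⟩, fun x => g x * (‖z‖ ^ N * (C / ‖1 - z‖)), hg.mul_const _, ?_⟩
    filter_upwards [ae_restrict_mem measurableSet_Ioi] with x hx s' hs'
    rw [mul_pow, mul_div_assoc, ← mul_assoc, norm_mul, div_eq_mul_inv]
    have h1 := hgb s' (le_of_lt hs'.1) (le_of_lt hs'.2) x hx
    have h2 := norm_kernel_le (ne_one_of_mem_spiralDomain hz) (hC z hz) hx
    refine mul_le_mul h1 ?_ (norm_nonneg _) ((norm_nonneg _).trans h1)
    rw [norm_mul, norm_pow]
    gcongr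

lemma iteratedDeriv_laplaceSeries_expPowLog (hc : 0 < c) {z : ℂ} (hz : z ∈ spiralDomain c) {N : ℕ}
    (hN : 1 ≤ N) (k : ℕ) {s : ℂ} (hs : -1 < s.re) (hsN : s.re < N) :
    iteratedDeriv k (fun s => laplaceSeries N (expPowLog s 0) z) s =
      laplaceSeries N (expPowLog s k) z := by
  induction k generalizing s with
  | zero => simp
  | succ k ih =>
    have hev : iteratedDeriv k (fun s => laplaceSeries N (expPowLog s 0) z) =ᶠ[𝓝 s]
        fun s => laplaceSeries N (expPowLog s k) z := by
      filter_upwards [(isOpen_lt continuous_const Complex.continuous_re).mem_nhds hs,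
        (isOpen_lt Complex.continuous_re continuous_const).mem_nhds hsN] with s' h1 h2
      exact ih h1 h2
    rw [iteratedDeriv_succ, hev.deriv_eq]
    exact (hasDerivAt_laplaceSeries_expPowLog hc hz hN k hs hsN).deriv

lemma iteratedDeriv_one_sub_cpow {z : ℂ} (hz : z ≠ 1) (k : ℕ) (s : ℂ) :
    iteratedDeriv k (fun s => (1 - z) ^ s) s = logScale s k z := by
  induction k generalizing s with
  | zero => simp [logScale]
  | succ k ih =>
    rw [iteratedDeriv_succ, funext ih]
    have h := ((hasDerivAt_id s).const_cpow (c := 1 - z)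
      (Or.inl (sub_ne_zero.2 hz.symm))).mul_const (Complex.log (1 - z) ^ k)
    refine Eq.trans h.deriv ?_
    simp only [logScale, id]
    ring

lemma contDiff_binomCoeff (n : ℕ) {k : WithTop ℕ∞} : ContDiff ℂ k (binomCoeff n) := by
  have : Differentiable ℂ (binomCoeff n) := by
    unfold binomCoeff
    fun_prop
  exact this.contDiff

lemma contDiff_reflectionFactor {k : WithTop ℕ∞} : ContDiff ℂ k reflectionFactor := by
  have : Differentiable ℂ reflectionFactor := by
    unfold reflectionFactor
    fun_prop
  exact this.contDiff

/-- This is the `k`-th derivative in `s` of `one_sub_cpow_eq`: each differentiation brings down a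
logarithm on both sides, and Leibniz's rule distributes derivatives onto the reflection factor. -/
lemma logScale_eq_sum (hc : 0 < c) {s : ℂ} (hs : -1 < s.re) {N : ℕ} (hN : 1 ≤ N) (hsN : s.re < N)
    (k : ℕ) {z : ℂ} (hz : z ∈ spiralDomain c) :
    logScale s k z = ∑ n ∈ Finset.range N, iteratedDeriv k (binomCoeff n) s * z ^ n +
      ∑ i ∈ Finset.range (k + 1), (k.choose i : ℂ) * iteratedDeriv i reflectionFactor s *
        laplaceSeries N (expPowLog s (k - i)) z := by
  have hU : IsOpen ({s : ℂ | -1 < s.re} ∩ {s : ℂ | s.re < N}) :=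
    (isOpen_lt continuous_const Complex.continuous_re).inter
      (isOpen_lt Complex.continuous_re continuous_const)
  have hmem := hU.mem_nhds (x := s) ⟨hs, hsN⟩
  have hLd : DifferentiableOn ℂ (fun s => laplaceSeries N (expPowLog s 0) z)
      ({s : ℂ | -1 < s.re} ∩ {s : ℂ | s.re < N}) := fun s' hs' =>
    (hasDerivAt_laplaceSeries_expPowLog hc hz hN 0 hs'.1
      hs'.2).differentiableAt.differentiableWithinAt
  have hLc : ContDiffAt ℂ k (fun s => laplaceSeries N (expPowLog s 0) z) s :=
    (hLd.analyticAt hmem).contDiffAt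
  have hev : (fun s => (1 - z) ^ s) =ᶠ[𝓝 s] (fun s => ∑ n ∈ Finset.range N, binomCoeff n s * z ^ n) +
      fun s => reflectionFactor s * laplaceSeries N (expPowLog s 0) z := by
    filter_upwards [hmem] with s' hs'
    exact one_sub_cpow_eq hc hs'.1 hN hs'.2 hz
  have hP : ∀ n, ContDiffAt ℂ k (fun s => binomCoeff n s * z ^ n) s := fun n =>
    ((contDiff_binomCoeff n).mul contDiff_const).contDiffAt
  rw [← iteratedDeriv_one_sub_cpow (ne_one_of_mem_spiralDomain hz), hev.iteratedDeriv_eq k,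
    iteratedDeriv_add (ContDiffAt.sum fun n _ => hP n)
      (contDiff_reflectionFactor.contDiffAt.mul hLc),
    iteratedDeriv_fun_sum fun n _ => hP n]
  congr 1
  · simp only [iteratedDeriv_mul_const_field]
  · rw [iteratedDeriv_fun_mul contDiff_reflectionFactor.contDiffAt hLc]
    refine Finset.sum_congr rfl fun i _ => ?_
    rw [iteratedDeriv_laplaceSeries_expPowLog hc hz hN _ hs hsN]

/-! ### Polylogarithmic coefficients versus the logarithmic scale -/

/-- The span of the functions `(1 - z)^s (log (1 - z))^k`. -/
noncomputable def logScaleSpan : Submodule ℂ (ℂ → ℂ) :=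
  Submodule.span ℂ (range fun p : ℂ × ℕ => logScale p.1 p.2)

lemma logScale_mem_logScaleSpan (s : ℂ) (k : ℕ) : logScale s k ∈ logScaleSpan :=
  Submodule.subset_span ⟨(s, k), rfl⟩

lemma mem_sup_nearPoly_of_eqOn {S : Submodule ℂ (ℂ → ℂ)} (h : EqOn F G (spiralDomain c))
    (hG : G ∈ S ⊔ nearPoly c A) : F ∈ S ⊔ nearPoly c A := by
  have h1 : F - G ∈ nearPoly c A := nearPoly_congr (F := 0) (by
    filter_upwards [self_mem_nhdsWithin] with z hz
    simp [h hz]) (zero_mem _)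
  simpa using add_mem hG (Submodule.mem_sup_right (S := S) h1)

lemma reflectionFactor_or_deriv_ne_zero (s : ℂ) :
    reflectionFactor s ≠ 0 ∨ iteratedDeriv 1 reflectionFactor s ≠ 0 := by
  have hpi : (Real.pi : ℂ) ≠ 0 := Complex.ofReal_ne_zero.2 Real.pi_ne_zero
  by_contra! h
  have h1 : HasDerivAt reflectionFactor (-(Complex.cos (Real.pi * s) * Real.pi / Real.pi)) s := by
    exact ((((hasDerivAt_id s).const_mul (Real.pi : ℂ)).csin.div_const (Real.pi : ℂ)).neg).congr_deriv
      (by simp)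
  rw [iteratedDeriv_one, h1.deriv, mul_div_cancel_right₀ _ hpi, neg_eq_zero] at h
  have h2 : Complex.sin (Real.pi * s) = 0 := by
    simpa [reflectionFactor, hpi] using h.1
  have h3 := Complex.sin_sq_add_cos_sq (Real.pi * s)
  rw [h2, h.2] at h3
  norm_num at h3

/-- A triangular system is solved by induction on `j`. Its diagonal entry is the reflection factor;
if that vanishes, the next equation is used, with diagonal entry `j + 1` times the derivative,
because the zeros of the sine are simple. -/
lemma laplaceSeries_expPowLog_mem (hc : 0 < c) {s : ℂ} (hs : -1 < s.re) {N : ℕ} (hN : 1 ≤ N)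
    (hsN : s.re < N) (j : ℕ) :
    laplaceSeries N (expPowLog s j) ∈ logScaleSpan ⊔ nearPoly c A := by
  set X : Submodule ℂ (ℂ → ℂ) := logScaleSpan ⊔ nearPoly c A
  have hsum : ∀ k, (∑ i ∈ Finset.range (k + 1), ((k.choose i : ℂ) *
      iteratedDeriv i reflectionFactor s) • laplaceSeries N (expPowLog s (k - i))) ∈ X := by
    intro k
    refine mem_sup_nearPoly_of_eqOn (G := logScale s k - fun z => (∑ n ∈ Finset.range N,
      Polynomial.C (iteratedDeriv k (binomCoeff n) s) * Polynomial.X ^ n).eval z) (fun z hz => ?_)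
      (sub_mem (Submodule.mem_sup_left (logScale_mem_logScaleSpan s k))
        (Submodule.mem_sup_right (polynomial_mem_nearPoly _)))
    simp [logScale_eq_sum hc hs hN hsN k hz, Polynomial.eval_finsetSum, Finset.sum_apply]
  induction j using Nat.strong_induction_on with
  | _ j ih =>
    by_cases h0 : reflectionFactor s = 0
    · have h1 := (reflectionFactor_or_deriv_ne_zero s).resolve_left (not_not.2 h0)
      have h := hsum (j + 1)
      rw [Finset.sum_range_succ', Finset.sum_range_succ'] at h
      simp only [iteratedDeriv_zero, h0, mul_zero, zero_smul, add_zero, zero_add,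
        Nat.add_sub_cancel] at h
      have h2 := sub_mem h (Submodule.sum_mem X fun i (hi : i ∈ Finset.range j) =>
        Submodule.smul_mem X (((j + 1).choose (i + 1 + 1) : ℂ) *
          iteratedDeriv (i + 1 + 1) reflectionFactor s) (ih (j + 1 - (i + 1 + 1)) (by
            rw [Finset.mem_range] at hi; omega)))
      rw [add_sub_cancel_left] at h2
      refine (Submodule.smul_mem_iff X (mul_ne_zero ?_ h1)).1 h2
      rw [Nat.choose_one_right]
      exact_mod_cast Nat.succ_ne_zero j
    · have h := hsum j
      rw [Finset.sum_range_succ'] at h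
      have h2 := sub_mem h (Submodule.sum_mem X fun i (hi : i ∈ Finset.range j) =>
        Submodule.smul_mem X ((j.choose (i + 1) : ℂ) *
          iteratedDeriv (i + 1) reflectionFactor s) (ih (j - (i + 1)) (by
            rw [Finset.mem_range] at hi; omega)))
      rw [add_sub_cancel_left] at h2
      simpa using (Submodule.smul_mem_iff X (by simpa using h0)).1 h2

lemma exists_nat_one_le_lt (r : ℝ) : ∃ N : ℕ, 1 ≤ N ∧ r < N := by
  obtain ⟨N, hN⟩ := exists_nat_gt r
  exact ⟨N + 1, by omega, by push_cast; linarith⟩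

lemma expPowLog_mem_weightsInto (hc : 0 < c) {s : ℂ} (hs : -1 < s.re) (j : ℕ) :
    expPowLog s j ∈ weightsInto c hc A logScaleSpan := by
  obtain ⟨N, hN, hsN⟩ := exists_nat_one_le_lt s.re
  obtain ⟨h1, h2⟩ := laplaceSeries_sub_cutLaplaceSeries_mem_nearPoly (A := A) hc N
    (integrableOn_expPowLog_mul hs j hN hsN)
  refine ⟨h1, ?_⟩
  have h3 := sub_mem (laplaceSeries_expPowLog_mem (A := A) hc hs hN hsN j)
    (Submodule.mem_sup_right (S := logScaleSpan) h2)
  rwa [sub_sub_cancel] at h3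

lemma logScale_mem_of_expPowLog_mem (hc : 0 < c) {S : Submodule ℂ (ℂ → ℂ)} {s : ℂ} (hs : -1 < s.re)
    (h : ∀ j, expPowLog s j ∈ weightsInto c hc A S) (k : ℕ) :
    logScale s k ∈ S ⊔ nearPoly c A := by
  obtain ⟨N, hN, hsN⟩ := exists_nat_one_le_lt s.re
  have hL : ∀ j, laplaceSeries N (expPowLog s j) ∈ S ⊔ nearPoly c A := fun j => by
    have h2 := (laplaceSeries_sub_cutLaplaceSeries_mem_nearPoly (A := A) hc N
      (integrableOn_expPowLog_mul hs j hN hsN)).2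
    have h3 := add_mem (Submodule.mem_sup_right (S := S) h2) (h j).2
    rwa [sub_add_cancel] at h3
  refine mem_sup_nearPoly_of_eqOn (G := (fun z => (∑ n ∈ Finset.range N,
      Polynomial.C (iteratedDeriv k (binomCoeff n) s) * Polynomial.X ^ n).eval z) +
      ∑ i ∈ Finset.range (k + 1), ((k.choose i : ℂ) *
      iteratedDeriv i reflectionFactor s) • laplaceSeries N (expPowLog s (k - i)))
      (fun z hz => ?_) (add_mem (Submodule.mem_sup_right (polynomial_mem_nearPoly _))
        (Submodule.sum_mem _ fun i _ => Submodule.smul_mem _ _ (hL _)))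
  simp [logScale_eq_sum hc hs hN hsN k hz, Polynomial.eval_finsetSum, Finset.sum_apply]

lemma mem_weightsInto_of_isBigO (hc : 0 < c) {S : Submodule ℂ (ℂ → ℂ)} {w w' : ℝ → ℂ}
    (hw : IntegrableOn w (Ioc 0 1)) (hw' : w' ∈ weightsInto c hc A S)
    (hO : (fun x => w x - w' x) =O[𝓝[>] 0] fun x : ℝ => x ^ (A + 1)) :
    w ∈ weightsInto c hc A S := by
  have hint : IntegrableOn (w - w') (Ioc 0 1) := hw.sub hw'.1
  have h1 : w - w' ∈ weightsInto c hc A S :=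
    ⟨hint, Submodule.mem_sup_right (cutLaplaceSeries_mem_nearPoly hc hint hO)⟩
  simpa using add_mem h1 hw'

lemma neg_one_lt_re_add {s : ℂ} (hs : -1 < s.re) (m : ℕ) : -1 < (s + m).re := by
  have := m.cast_nonneg (α := ℝ)
  simp
  linarith

lemma powLog_mem_weightsInto_of_expPowLog (hc : 0 < c) {S : Submodule ℂ (ℂ → ℂ)}
    (h : ∀ s : ℂ, -1 < s.re → ∀ j, expPowLog s j ∈ weightsInto c hc A S) {s : ℂ} (hs : -1 < s.re)
    (j : ℕ) : powLog s j ∈ weightsInto c hc A S := by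
  obtain ⟨w, hw, hO⟩ := exists_expansion_powLog s j (A + 1)
  have hint := (laplaceSeries_sub_cutLaplaceSeries_mem_nearPoly (A := A) hc 1
    (by simpa using integrableOn_powLog_mul_exp hs j)).1
  refine mem_weightsInto_of_isBigO hc hint ((Submodule.span_le.2 ?_ :
    expPowLogSpan s ≤ weightsInto c hc A S) hw) hO
  rintro _ ⟨p, rfl⟩
  exact h _ (neg_one_lt_re_add hs p.1) p.2

lemma expPowLog_mem_weightsInto_of_powLog (hc : 0 < c) {S : Submodule ℂ (ℂ → ℂ)}
    (h : ∀ s : ℂ, -1 < s.re → ∀ j, powLog s j ∈ weightsInto c hc A S) {s : ℂ} (hs : -1 < s.re)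
    (j : ℕ) : expPowLog s j ∈ weightsInto c hc A S := by
  obtain ⟨w, hw, hO⟩ := exists_expansion_expPowLog s j (A + 1)
  obtain ⟨N, hN, hsN⟩ := exists_nat_one_le_lt s.re
  have hint := (laplaceSeries_sub_cutLaplaceSeries_mem_nearPoly (A := A) hc N
    (integrableOn_expPowLog_mul hs j hN hsN)).1
  refine mem_weightsInto_of_isBigO hc hint ((Submodule.span_le.2 ?_ :
    powLogSpan s ≤ weightsInto c hc A S) hw) hO
  rintro _ ⟨p, rfl⟩
  exact h _ (neg_one_lt_re_add hs p.1) p.2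

/-! ### Moments -/

/-- The coefficients `n^{-b} (log n)^k` of the generalized polylogarithms. -/
noncomputable def liCoeff (b : ℂ) (k : ℕ) (n : ℕ) : ℂ :=
  if n = 0 then 0 else (n : ℂ) ^ (-b) * (Real.log n : ℂ) ^ k

/-- The Laplace moments of `x^s log^j x`. -/
noncomputable def powLogMoment (s : ℂ) (j : ℕ) (n : ℕ) : ℂ :=
  if n = 0 then 0 else ∫ x in Ioi (0 : ℝ), powLog s j x * (Real.exp (-x) : ℂ) ^ n

/-- Rescale by `t = n x` and expand `(log t - log n)^j` by the binomial formula. -/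
lemma powLogMoment_eq_sum {s : ℂ} (hs : -1 < s.re) (j : ℕ) :
    powLogMoment s j = ∑ i ∈ Finset.range (j + 1), ((j.choose i : ℂ) * (-1) ^ i *
      ∫ x in Ioi (0 : ℝ), powLog s (j - i) x * (Real.exp (-x) : ℂ)) • liCoeff (s + 1) i := by
  ext n
  rw [Finset.sum_apply, powLogMoment]
  split_ifs with hn
  · simp [liCoeff, hn]
  have hn0 : (0 : ℝ) < n := by exact_mod_cast Nat.pos_of_ne_zero hn
  have hn0' : (n : ℂ) ≠ 0 := by exact_mod_cast hn
  have h1 := integral_comp_mul_left_Ioi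
    (fun t : ℝ => powLog s j (t / n) * (Real.exp (-t) : ℂ)) 0 hn0
  have h2 : ∫ x in Ioi (0 : ℝ), powLog s j x * (Real.exp (-x) : ℂ) ^ n =
      ∫ x in Ioi (0 : ℝ), powLog s j (n * x / n) * (Real.exp (-(n * x)) : ℂ) := by
    refine integral_congr_ae (Eventually.of_forall fun x => ?_)
    simp only
    rw [mul_div_cancel_left₀ x hn0.ne', ← Complex.ofReal_pow, ← Real.exp_nat_mul, mul_neg]
  have h3 : ∫ t in Ioi (0 : ℝ), powLog s j (t / n) * (Real.exp (-t) : ℂ) =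
      ∫ t in Ioi (0 : ℝ), ∑ i ∈ Finset.range (j + 1), ((n : ℂ) ^ (-s) * (j.choose i : ℂ) *
        (-(Real.log n : ℂ)) ^ i) * (powLog s (j - i) t * (Real.exp (-t) : ℂ)) := by
    refine setIntegral_congr_fun measurableSet_Ioi fun t ht => ?_
    have ht0 : (0 : ℝ) < t := ht
    simp only [powLog]
    rw [Real.log_div ht0.ne' hn0.ne', div_eq_mul_inv, Complex.ofReal_mul,
      Complex.mul_cpow_ofReal_nonneg ht0.le (inv_nonneg.2 hn0.le), Complex.ofReal_inv,
      Complex.ofReal_natCast, Complex.inv_cpow _ _ (by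
        rw [Complex.natCast_arg]; exact Real.pi_pos.ne), ← Complex.cpow_neg, sub_eq_neg_add, Complex.ofReal_add, add_pow,
      Finset.mul_sum, Finset.sum_mul]
    refine Finset.sum_congr rfl fun i _ => ?_
    push_cast
    ring
  rw [h2, h1, mul_zero, h3, integral_finsetSum _ fun i _ =>
    (integrableOn_powLog_mul_exp hs (j - i)).const_mul _]
  simp only [integral_const_mul, Finset.smul_sum, Complex.real_smul, Pi.smul_apply, smul_eq_mul]
  refine Finset.sum_congr rfl fun i _ => ?_
  rw [liCoeff, if_neg hn, neg_add, Complex.cpow_add _ _ hn0', Complex.cpow_neg_one, neg_pow]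
  push_cast
  ring

lemma integral_powLog_zero_ne_zero {s : ℂ} (hs : -1 < s.re) :
    ∫ x in Ioi (0 : ℝ), powLog s 0 x * (Real.exp (-x) : ℂ) ≠ 0 := by
  have h : ∫ x in Ioi (0 : ℝ), powLog s 0 x * (Real.exp (-x) : ℂ) = Complex.Gamma (s + 1) := by
    rw [Complex.Gamma_eq_integral (by simp; linarith), Complex.GammaIntegral]
    refine integral_congr_ae (Eventually.of_forall fun x => ?_)
    simp [powLog, mul_comm]
  rw [h]
  exact Complex.Gamma_ne_zero_of_re_pos (by simp; linarith)

/-- The system expressing moments through polylogarithmic coefficients is triangular, with diagonal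
entries `± Γ(s + 1) ≠ 0`. -/
lemma liCoeff_mem_of_powLogMoment_mem {E : Submodule ℂ (ℕ → ℂ)} {s : ℂ} (hs : -1 < s.re)
    (h : ∀ j, powLogMoment s j ∈ E) (k : ℕ) : liCoeff (s + 1) k ∈ E := by
  induction k using Nat.strong_induction_on with
  | _ k ih =>
    have h1 := h k
    rw [powLogMoment_eq_sum hs, Finset.sum_range_succ] at h1
    have h2 := sub_mem h1 (Submodule.sum_mem E fun i (hi : i ∈ Finset.range k) =>
      Submodule.smul_mem E ((k.choose i : ℂ) * (-1) ^ i *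
        ∫ x in Ioi (0 : ℝ), powLog s (k - i) x * (Real.exp (-x) : ℂ)) (ih i (Finset.mem_range.1 hi)))
    rw [add_sub_cancel_left] at h2
    refine (Submodule.smul_mem_iff E ?_).1 h2
    rw [Nat.sub_self, Nat.choose_self]
    exact mul_ne_zero (by simp) (integral_powLog_zero_ne_zero hs)

lemma laplaceSeries_powLog_continues (hc : 0 < c) {s : ℂ} (hs : -1 < s.re) (j : ℕ) :
    Continues c (powLogMoment s j) (laplaceSeries 1 (powLog s j)) :=
  laplaceSeries_one_continues hc (integrableOn_powLog_mul_exp hs j)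

lemma laplaceSeries_powLog_sub_cut_mem (hc : 0 < c) {s : ℂ} (hs : -1 < s.re) (j : ℕ) :
    IntegrableOn (powLog s j) (Ioc 0 1) ∧
    laplaceSeries 1 (powLog s j) - cutLaplaceSeries (powLog s j) ∈ nearPoly c A :=
  laplaceSeries_sub_cutLaplaceSeries_mem_nearPoly hc 1
    (by simpa using integrableOn_powLog_mul_exp hs j)

/-! ### Expansions of generalized polylogarithms -/

/-- The sequences whose generating functions continue to `spiralDomain c` and have an expansion
in the logarithmic scale to order `A`. -/
noncomputable def expandable (c : ℝ) (A : ℕ) : Submodule ℂ (ℕ → ℂ) where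
  carrier := {a | ∃ F, Continues c a F ∧ F ∈ logScaleSpan ⊔ nearPoly c A}
  zero_mem' := ⟨0, ⟨differentiableOn_const 0, fun z _ => by simp⟩, zero_mem _⟩
  add_mem' := by
    rintro a b ⟨F, hF, hF'⟩ ⟨G, hG, hG'⟩
    exact ⟨F + G, hF.add hG, add_mem hF' hG'⟩
  smul_mem' := by
    rintro k a ⟨F, hF, hF'⟩
    exact ⟨k • F, hF.smul k, Submodule.smul_mem _ k hF'⟩

lemma hasDerivAt_logScale (s : ℂ) (k : ℕ) {z : ℂ} (hz : z ∈ spiralDomain c) :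
    HasDerivAt (logScale s k) (-s * logScale (s - 1) k z - k * logScale (s - 1) (k - 1) z) z := by
  have h0 : HasDerivAt (fun z : ℂ => 1 - z) (-1) z := by
    simpa using (hasDerivAt_id z).const_sub 1
  have hs := one_sub_mem_slitPlane hz
  have hne : 1 - z ≠ 0 := Complex.slitPlane_ne_zero hs
  have h1 := (h0.cpow_const (c := s) hs).mul ((h0.clog hs).pow k)
  refine h1.congr_deriv ?_
  simp only [logScale, Complex.cpow_sub _ _ hne, Complex.cpow_one, Pi.pow_apply]
  ring

/-- Writing `z = 1 - (1 - z)` keeps the result in the span of the scale. For `k = 0` the truncated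
`k - 1` is harmless, its coefficient being `0`. -/
lemma id_mul_deriv_logScale (s : ℂ) (k : ℕ) {z : ℂ} (hz : z ∈ spiralDomain c) :
    z * deriv (logScale s k) z = s * logScale s k z - s * logScale (s - 1) k z +
      k * logScale s (k - 1) z - k * logScale (s - 1) (k - 1) z := by
  have hne : 1 - z ≠ 0 := Complex.slitPlane_ne_zero (one_sub_mem_slitPlane hz)
  rw [(hasDerivAt_logScale s k hz).deriv]
  simp only [logScale, Complex.cpow_sub _ _ hne, Complex.cpow_one]
  field_simp
  ring

lemma differentiableOn_and_id_mul_deriv_of_mem_logScaleSpan (hc : 0 < c) {S : ℂ → ℂ}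
    (hS : S ∈ logScaleSpan) : DifferentiableOn ℂ S (spiralDomain c) ∧
      ∃ S' ∈ logScaleSpan, EqOn (fun z => z * deriv S z) S' (spiralDomain c) := by
  have hU := isOpen_spiralDomain hc
  induction hS using Submodule.span_induction with
  | mem S h =>
    obtain ⟨⟨s, k⟩, rfl⟩ := h
    refine ⟨fun z hz => (hasDerivAt_logScale s k hz).differentiableAt.differentiableWithinAt,
      s • logScale s k - s • logScale (s - 1) k + (k : ℂ) • logScale s (k - 1) -
        (k : ℂ) • logScale (s - 1) (k - 1), ?_, fun z hz => id_mul_deriv_logScale s k hz⟩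
    have h := logScale_mem_logScaleSpan
    exact sub_mem (add_mem (sub_mem (Submodule.smul_mem _ _ (h _ _)) (Submodule.smul_mem _ _ (h _ _)))
      (Submodule.smul_mem _ _ (h _ _))) (Submodule.smul_mem _ _ (h _ _))
  | zero =>
    refine ⟨differentiableOn_const 0, 0, zero_mem _, fun z _ => ?_⟩
    have : deriv (0 : ℂ → ℂ) z = 0 := deriv_const z 0
    simp [this]
  | add S T _ _ hS hT =>
    obtain ⟨hS1, S', hS', hS2⟩ := hS
    obtain ⟨hT1, T', hT', hT2⟩ := hT
    refine ⟨hS1.add hT1, S' + T', add_mem hS' hT', fun z hz => ?_⟩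
    have h1 := hS2 hz
    have h2 := hT2 hz
    simp only at h1 h2 ⊢
    rw [deriv_add (hS1.differentiableAt (hU.mem_nhds hz)) (hT1.differentiableAt (hU.mem_nhds hz)),
      Pi.add_apply, ← h1, ← h2]
    ring
  | smul k S _ hS =>
    obtain ⟨hS1, S', hS', hS2⟩ := hS
    refine ⟨hS1.const_smul k, k • S', Submodule.smul_mem _ k hS', fun z hz => ?_⟩
    have h1 := hS2 hz
    simp only at h1 ⊢
    rw [deriv_const_smul k (hS1.differentiableAt (hU.mem_nhds hz)), Pi.smul_apply, ← h1,
      smul_eq_mul, smul_eq_mul]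
    ring

lemma id_mul_deriv_add (hc : 0 < c) (hF : DifferentiableOn ℂ F (spiralDomain c))
    (hG : DifferentiableOn ℂ G (spiralDomain c)) :
    EqOn (fun z => z * deriv (F + G) z) ((fun z => z * deriv F z) + fun z => z * deriv G z)
      (spiralDomain c) := by
  have hU := isOpen_spiralDomain hc
  intro z hz
  simp only [Pi.add_apply]
  rw [deriv_add (hF.differentiableAt (hU.mem_nhds hz)) (hG.differentiableAt (hU.mem_nhds hz)),
    mul_add]

lemma euler_mem_expandable (hc' : 0 < c') (hcc : c' < c) (h : a ∈ expandable c (A + 1)) :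
    (fun n => n * a n) ∈ expandable c' A := by
  have hc := hc'.trans hcc
  obtain ⟨F, hF, hF'⟩ := h
  refine ⟨_, (hF.euler hc).mono hcc.le, ?_⟩
  obtain ⟨S, hS, R, hR, rfl⟩ := Submodule.mem_sup.1 hF'
  obtain ⟨hS1, S', hS', hS2⟩ := differentiableOn_and_id_mul_deriv_of_mem_logScaleSpan hc hS
  have hR1 : DifferentiableOn ℂ R (spiralDomain c) := by
    simpa using hF.1.sub hS1
  refine mem_sup_nearPoly_of_eqOn (G := S' + fun z => z * deriv R z) (fun z hz => ?_)
    (add_mem (Submodule.mem_sup_left hS')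
      (Submodule.mem_sup_right (id_mul_deriv_mem_nearPoly hc' hcc hR1 hR)))
  have hz' := spiralDomain_mono hcc.le hz
  refine (id_mul_deriv_add hc hS1 hR1 hz').trans ?_
  rw [Pi.add_apply, Pi.add_apply, ← hS2 hz']

lemma nat_mul_liCoeff (b : ℂ) (k : ℕ) : (fun n : ℕ => n * liCoeff b k n) = liCoeff (b - 1) k := by
  ext n
  by_cases hn : n = 0
  · simp [liCoeff, hn]
  · have hn0 : (n : ℂ) ≠ 0 := by exact_mod_cast hn
    simp only [liCoeff, if_neg hn]
    rw [neg_sub, sub_eq_neg_add, Complex.cpow_add _ _ hn0, Complex.cpow_one]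
    ring

/-- For `Re b > 0` the moments of `x^{b-1} log^j x` converge and the Laplace dictionary applies.
Otherwise the Euler operator lowers `b` by one at a time. Each step costs one order of precision and
some room, so the induction starts from `A + 1` and `2 * c`. -/
lemma liCoeff_mem_expandable (hc : 0 < c) (b : ℂ) (k : ℕ) : liCoeff b k ∈ expandable c A := by
  have main : ∀ m : ℕ, ∀ c, 0 < c → ∀ (A : ℕ) (b : ℂ), 0 < b.re + m → liCoeff b k ∈ expandable c A := by
    intro m
    induction m with
    | zero =>
      intro c hc A b hb
      have hs : -1 < (b - 1).re := by simpa using hb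
      rw [show b = b - 1 + 1 by ring]
      refine liCoeff_mem_of_powLogMoment_mem hs (fun j => ?_) k
      refine ⟨_, laplaceSeries_powLog_continues hc hs j, ?_⟩
      have h1 := (laplaceSeries_powLog_sub_cut_mem (A := A) hc hs j).2
      have h2 := (powLog_mem_weightsInto_of_expPowLog (A := A) hc
        (fun s hs j => expPowLog_mem_weightsInto hc hs j) hs j).2
      have h3 := add_mem (Submodule.mem_sup_right (S := logScaleSpan) h1) h2
      rwa [sub_add_cancel] at h3
    | succ m ih =>
      intro c hc A b hb
      have h := ih (2 * c) (by linarith) (A + 1) (b + 1) (by push_cast at hb; simp; linarith)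
      have h1 := euler_mem_expandable hc (by linarith) h
      rwa [nat_mul_liCoeff, add_sub_cancel_right] at h1
  obtain ⟨m, hm⟩ := exists_nat_gt (-b.re)
  exact main m c hc A b (by linarith)

/-! ### Expansions in generalized polylogarithms -/

/-- The span of the polylogarithmic coefficient sequences. -/
noncomputable def liSpan : Submodule ℂ (ℕ → ℂ) :=
  Submodule.span ℂ (range fun p : ℂ × ℕ => liCoeff p.1 p.2)

lemma liCoeff_mem_liSpan (b : ℂ) (k : ℕ) : liCoeff b k ∈ liSpan := Submodule.subset_span ⟨(b, k), rfl⟩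

/-- The continuations to `spiralDomain c` of series with polylogarithmic coefficients. -/
noncomputable def liFunctions (c : ℝ) : Submodule ℂ (ℂ → ℂ) where
  carrier := {F | ∃ a ∈ liSpan, Continues c a F}
  zero_mem' := ⟨0, zero_mem _, differentiableOn_const 0, fun z _ => by simp⟩
  add_mem' := by
    rintro F G ⟨a, ha, hF⟩ ⟨b, hb, hG⟩
    exact ⟨a + b, add_mem ha hb, hF.add hG⟩
  smul_mem' := by
    rintro k F ⟨a, ha, hF⟩
    exact ⟨k • a, Submodule.smul_mem _ k ha, hF.smul k⟩

lemma nat_mul_mem_liSpan (h : a ∈ liSpan) : (fun n : ℕ => n * a n) ∈ liSpan := by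
  induction h using Submodule.span_induction with
  | mem a h =>
    obtain ⟨p, rfl⟩ := h
    rw [nat_mul_liCoeff]
    exact liCoeff_mem_liSpan _ _
  | zero =>
    convert zero_mem liSpan using 1
    ext n
    simp
  | add a b _ _ ha hb =>
    convert add_mem ha hb using 1
    ext n
    simp [mul_add]
  | smul k a _ ha =>
    convert Submodule.smul_mem liSpan k ha using 1
    ext n
    simp [mul_left_comm]

lemma liSpan_le_expandable (hc : 0 < c) : liSpan ≤ expandable c A :=
  Submodule.span_le.2 (by
    rintro _ ⟨p, rfl⟩
    exact liCoeff_mem_expandable hc _ _)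

lemma mul_mem_liSpan (ha : a ∈ liSpan) (hb : b ∈ liSpan) : a * b ∈ liSpan := by
  have h1 : ∀ (s t : ℂ) (k l : ℕ), liCoeff s k * liCoeff t l = liCoeff (s + t) (k + l) := by
    intro s t k l
    ext n
    by_cases hn : n = 0
    · simp [liCoeff, hn]
    · have hn0 : (n : ℂ) ≠ 0 := by exact_mod_cast hn
      simp only [Pi.mul_apply, liCoeff, if_neg hn]
      rw [neg_add, Complex.cpow_add _ _ hn0, pow_add]
      ring
  have h2 := Submodule.mul_mem_mul ha hb
  rw [liSpan, Submodule.span_mul_span] at h2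
  refine Submodule.span_mono ?_ h2
  rintro _ ⟨_, ⟨p, rfl⟩, _, ⟨q, rfl⟩, rfl⟩
  exact ⟨(p.1 + q.1, p.2 + q.2), (h1 _ _ _ _).symm⟩

lemma powLogMoment_mem_liSpan {s : ℂ} (hs : -1 < s.re) (j : ℕ) : powLogMoment s j ∈ liSpan := by
  rw [powLogMoment_eq_sum hs]
  exact Submodule.sum_mem _ fun i _ => Submodule.smul_mem _ _ (liCoeff_mem_liSpan _ _)

lemma id_mul_deriv_mem_liFunctions_sup (hc' : 0 < c') (hcc : c' < c)
    (hF : DifferentiableOn ℂ F (spiralDomain c)) (h : F ∈ liFunctions c ⊔ nearPoly c (A + 1)) :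
    (fun z => z * deriv F z) ∈ liFunctions c' ⊔ nearPoly c' A := by
  have hc := hc'.trans hcc
  obtain ⟨S, ⟨a, ha, hS⟩, R, hR, rfl⟩ := Submodule.mem_sup.1 h
  have hR1 : DifferentiableOn ℂ R (spiralDomain c) := by
    simpa using hF.sub hS.1
  refine mem_sup_nearPoly_of_eqOn (fun z hz =>
    id_mul_deriv_add hc hS.1 hR1 (spiralDomain_mono hcc.le hz))
    (add_mem (Submodule.mem_sup_left ⟨_, nat_mul_mem_liSpan ha, (hS.euler hc).mono hcc.le⟩)
      (Submodule.mem_sup_right (id_mul_deriv_mem_nearPoly hc' hcc hR1 hR)))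

/-- For `Re s > -1` the Laplace dictionary applies. Below that, the Euler operator applied at `s +
1` produces `(s + 1) logScale s k + k logScale s (k - 1)` modulo known terms. An induction on `k`
isolates the first function; if `s = -1`, its coefficient vanishes and the relation for `k + 1` is
used. -/
lemma logScale_mem_liFunctions_sup (hc : 0 < c) (s : ℂ) (k : ℕ) :
    logScale s k ∈ liFunctions c ⊔ nearPoly c A := by
  have main : ∀ m : ℕ, ∀ c, 0 < c → ∀ (A : ℕ) (s : ℂ), -1 < s.re + m → ∀ k,
      logScale s k ∈ liFunctions c ⊔ nearPoly c A := by
    intro m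
    induction m with
    | zero =>
      intro c hc A s hs k
      refine logScale_mem_of_expPowLog_mem hc (by simpa using hs) (fun j =>
        expPowLog_mem_weightsInto_of_powLog hc (fun s hs j => ?_) (by simpa using hs) j) k
      obtain ⟨h1, h2⟩ := laplaceSeries_powLog_sub_cut_mem (A := A) hc hs j
      refine ⟨h1, ?_⟩
      have h3 := sub_mem (Submodule.mem_sup_left (T := nearPoly c A)
        (⟨_, powLogMoment_mem_liSpan hs j, laplaceSeries_powLog_continues hc hs j⟩ :
          laplaceSeries 1 (powLog s j) ∈ liFunctions c))
        (Submodule.mem_sup_right (S := liFunctions c) h2)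
      rwa [sub_sub_cancel] at h3
    | succ m ih =>
      intro c hc A s hs k
      set X := liFunctions c ⊔ nearPoly c A
      have hs1 : -1 < (s + 1).re + m := by push_cast at hs; simp; linarith
      have h0 : ∀ k, logScale (s + 1) k ∈ X := ih c hc A (s + 1) hs1
      have h1 : ∀ k, (s + 1) • logScale s k + (k : ℂ) • logScale s (k - 1) ∈ X := by
        intro k
        have h2 := id_mul_deriv_mem_liFunctions_sup hc (by linarith : c < 2 * c)
          (differentiableOn_and_id_mul_deriv_of_mem_logScaleSpan (by linarith)
            (logScale_mem_logScaleSpan (s + 1) k)).1 (ih (2 * c) (by linarith) (A + 1) (s + 1) hs1 k)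
        have h3 := sub_mem (add_mem (Submodule.smul_mem X (s + 1) (h0 k))
          (Submodule.smul_mem X (k : ℂ) (h0 (k - 1)))) h2
        refine mem_sup_nearPoly_of_eqOn (fun z hz => ?_) h3
        have h4 := id_mul_deriv_logScale (s + 1) k hz
        rw [add_sub_cancel_right] at h4
        simp only [Pi.add_apply, Pi.sub_apply, Pi.smul_apply, smul_eq_mul, h4]
        ring
      by_cases hs0 : s + 1 = 0
      · have h2 := h1 (k + 1)
        rw [hs0, zero_smul, zero_add] at h2
        exact (Submodule.smul_mem_iff X (by exact_mod_cast Nat.succ_ne_zero k)).1 h2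
      · induction k with
        | zero => simpa [Submodule.smul_mem_iff X hs0] using h1 0
        | succ k ihk =>
          have h2 := sub_mem (h1 (k + 1)) (Submodule.smul_mem X ((k + 1 : ℕ) : ℂ) ihk)
          rw [Nat.add_sub_cancel, add_sub_cancel_right] at h2
          exact (Submodule.smul_mem_iff X hs0).1 h2
  obtain ⟨m, hm⟩ := exists_nat_gt (-1 - s.re)
  exact main m c hc A s (by linarith) k

/-! ### Comparison of the two scales -/

lemma eventually_ne_zero_nhds_one : ∀ᶠ z : ℂ in 𝓝[spiralDomain c] 1, z ≠ 0 :=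
  nhdsWithin_le_nhds (isOpen_ne.mem_nhds one_ne_zero)

lemma norm_cpow_le {w : ℂ} (hw : w ≠ 0) (s : ℂ) :
    ‖w ^ s‖ ≤ Real.exp (Real.pi * |s.im|) * ‖w‖ ^ s.re := by
  rw [Complex.norm_cpow_of_ne_zero hw, div_eq_mul_inv, ← Real.exp_neg, mul_comm]
  gcongr
  refine (neg_le_abs _).trans ?_
  rw [abs_mul]
  exact mul_le_mul_of_nonneg_right (Complex.abs_arg_le_pi w) (abs_nonneg _)

lemma le_norm_cpow {w : ℂ} (hw : w ≠ 0) (s : ℂ) :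
    Real.exp (-(Real.pi * |s.im|)) * ‖w‖ ^ s.re ≤ ‖w ^ s‖ := by
  rw [Complex.norm_cpow_of_ne_zero hw, div_eq_mul_inv, ← Real.exp_neg, mul_comm]
  refine mul_le_mul_of_nonneg_left (Real.exp_le_exp.2 (neg_le_neg ((le_abs_self _).trans ?_)))
    (by positivity)
  rw [abs_mul]
  exact mul_le_mul_of_nonneg_right (Complex.abs_arg_le_pi w) (abs_nonneg _)

lemma logScale_isBigO {s : ℂ} {r : ℝ} (hr : r < s.re) (k : ℕ) :
    logScale s k =O[𝓝[spiralDomain c] 1] fun z => ‖1 - z‖ ^ r := by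
  obtain ⟨C, hC, hlog⟩ := abs_log_pow_le k (sub_pos.2 hr)
  set K := Real.exp (Real.pi * |s.im|) * (2 ^ (k - 1) * (2 * C + Real.pi ^ k))
  have hpi := Real.pi_pos
  refine isBigO_nhdsWithin_one_iff.2 ⟨K, by positivity, 1, one_pos, fun z hz hz1 => ?_⟩
  have hw : 1 - z ≠ 0 := Complex.slitPlane_ne_zero (one_sub_mem_slitPlane hz)
  set x := ‖1 - z‖
  have hx : 0 < x := norm_pos_iff.2 hw
  have h1 : ‖Complex.log (1 - z)‖ ≤ |Real.log x| + Real.pi := by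
    refine (Complex.norm_le_abs_re_add_abs_im _).trans ?_
    rw [Complex.log_re, Complex.log_im]
    gcongr
    exact Complex.abs_arg_le_pi _
  have h2 : x ^ (s.re - r) ≤ x ^ (-(s.re - r)) :=
    Real.rpow_le_rpow_of_exponent_ge hx hz1.le (by linarith)
  have h3 : 1 ≤ x ^ (-(s.re - r)) := Real.one_le_rpow_of_pos_of_le_one_of_nonpos hx hz1.le (by linarith)
  have h4 : ‖Complex.log (1 - z)‖ ^ k ≤ 2 ^ (k - 1) * (2 * C + Real.pi ^ k) * x ^ (-(s.re - r)) := by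
    refine (pow_le_pow_left₀ (norm_nonneg _) h1 k).trans ((add_pow_le (abs_nonneg _) hpi.le k).trans ?_)
    rw [mul_assoc]
    gcongr
    have h5 := hlog x hx
    have h6 : Real.pi ^ k ≤ Real.pi ^ k * x ^ (-(s.re - r)) := le_mul_of_one_le_right (by positivity) h3
    nlinarith
  rw [logScale, norm_mul, norm_pow, Real.norm_of_nonneg (by positivity)]
  calc ‖(1 - z) ^ s‖ * ‖Complex.log (1 - z)‖ ^ k
      ≤ (Real.exp (Real.pi * |s.im|) * x ^ s.re) *
        (2 ^ (k - 1) * (2 * C + Real.pi ^ k) * x ^ (-(s.re - r))) := by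
        gcongr
        exact norm_cpow_le hw s
    _ = K * x ^ (s.re + -(s.re - r)) := by rw [Real.rpow_add hx]; ring
    _ = K * x ^ r := by congr 2; ring

lemma isBigO_scaleFun {D : Set ℂ} (α : ℂ) (k : ℕ) {A : ℕ} (hA : -α.re ≤ A) (hD : (1 : ℂ) ∉ D) :
    (fun z : ℂ => (1 - z) ^ A) =O[𝓝[D] 1] scaleFun α k := by
  -- Within `e^{-2}` of `1` one has `|log (1 - z)| ≥ 2 ≥ |z|`, so the logarithmic factor of
  -- `scaleFun` has norm at least `1`.
  refine isBigO_nhdsWithin_one_iff.2 ⟨Real.exp (Real.pi * |(-α).im|), by positivity,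
    Real.exp (-2), by positivity, fun z hz hz1 => ?_⟩
  have hw : 1 - z ≠ 0 := sub_ne_zero.2 fun h => hD (h ▸ hz)
  set x := ‖1 - z‖ with hxd
  have hx : 0 < x := norm_pos_iff.2 hw
  have hx1 : x ≤ 1 := hz1.le.trans (Real.exp_le_one_iff.2 (by norm_num))
  have h1 := le_norm_cpow hw (-α)
  have h2 : x ^ A ≤ x ^ (-α).re := by
    rw [← Real.rpow_natCast]
    exact Real.rpow_le_rpow_of_exponent_ge hx hx1 (by simpa using hA)
  have h3 : 2 ≤ ‖Complex.log ((1 - z)⁻¹)‖ := by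
    refine le_trans ?_ ((le_abs_self _).trans (Complex.abs_re_le_norm _))
    rw [Complex.log_re, norm_inv, Real.log_inv, ← hxd]
    linarith [(Real.log_lt_iff_lt_exp hx).2 hz1]
  have h4 : ‖z‖ ≤ 2 := by
    have : ‖z‖ ≤ ‖(1 : ℂ)‖ + ‖1 - z‖ := by simpa using norm_sub_le (1 : ℂ) (1 - z)
    rw [norm_one] at this
    linarith
  have h5 : 1 ≤ ‖(1 / z * Complex.log ((1 - z)⁻¹)) ^ (k : ℂ)‖ := by
    rw [Complex.cpow_natCast, norm_pow]
    refine one_le_pow₀ ?_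
    have hz0 : 0 < ‖z‖ := by
      refine norm_pos_iff.2 fun h0 => ?_
      rw [hxd, h0, sub_zero, norm_one] at hz1
      linarith [Real.exp_le_one_iff.2 (by norm_num : (-2 : ℝ) ≤ 0)]
    rw [norm_mul, norm_div, norm_one, div_mul_eq_mul_div, one_mul, one_le_div hz0]
    linarith
  rw [norm_pow, scaleFun, norm_mul]
  calc x ^ A ≤ x ^ (-α).re := h2
    _ = Real.exp (Real.pi * |(-α).im|) * (Real.exp (-(Real.pi * |(-α).im|)) * x ^ (-α).re) := by
        rw [← mul_assoc, ← Real.exp_add, add_neg_cancel, Real.exp_zero, one_mul]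
    _ ≤ Real.exp (Real.pi * |(-α).im|) * ‖(1 - z) ^ (-α)‖ := by gcongr
    _ ≤ _ := by
        gcongr
        exact le_mul_of_one_le_right (norm_nonneg _) h5

/-- A space of functions stable under multiplication by `z` is stable under multiplication by
polynomials. -/
lemma exists_eqOn_polynomial_mul {X : Submodule ℂ (ℂ → ℂ)} {D : Set ℂ}
    (hX : ∀ S ∈ X, ∃ S' ∈ X, EqOn (fun z => z * S z) S' D) (p : Polynomial ℂ) {S : ℂ → ℂ}
    (hS : S ∈ X) : ∃ S' ∈ X, EqOn (fun z => p.eval z * S z) S' D := by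
  induction p using Polynomial.induction_on' with
  | add p q hp hq =>
    obtain ⟨P, hP, hP'⟩ := hp
    obtain ⟨Q, hQ, hQ'⟩ := hq
    refine ⟨P + Q, add_mem hP hQ, fun z hz => ?_⟩
    rw [Pi.add_apply, ← hP' hz, ← hQ' hz]
    simp only [Polynomial.eval_add]
    ring
  | monomial n k =>
    induction n with
    | zero => exact ⟨k • S, Submodule.smul_mem _ k hS, fun z _ => by simp⟩
    | succ n ih =>
      obtain ⟨P, hP, hP'⟩ := ih
      obtain ⟨Q, hQ, hQ'⟩ := hX P hP
      refine ⟨Q, hQ, fun z hz => ?_⟩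
      rw [← hQ' hz]
      simp only
      rw [← hP' hz]
      simp only [Polynomial.eval_monomial]
      ring

/-- Stability under multiplication by `z` may be checked on generators. -/
lemma exists_eqOn_id_mul_of_span {s : Set (ℂ → ℂ)} {D : Set ℂ}
    (h : ∀ S ∈ s, ∃ S' ∈ Submodule.span ℂ s, EqOn (fun z => z * S z) S' D) {S : ℂ → ℂ}
    (hS : S ∈ Submodule.span ℂ s) :
    ∃ S' ∈ Submodule.span ℂ s, EqOn (fun z => z * S z) S' D := by
  induction hS using Submodule.span_induction with
  | mem S hS => exact h S hS
  | zero => exact ⟨0, zero_mem _, fun z _ => by simp⟩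
  | add S T _ _ hS hT =>
    obtain ⟨P, hP, hP'⟩ := hS
    obtain ⟨Q, hQ, hQ'⟩ := hT
    refine ⟨P + Q, add_mem hP hQ, fun z hz => ?_⟩
    rw [Pi.add_apply, ← hP' hz, ← hQ' hz]
    simp only [Pi.add_apply]
    ring
  | smul k S _ hS =>
    obtain ⟨P, hP, hP'⟩ := hS
    refine ⟨k • P, Submodule.smul_mem _ k hP, fun z hz => ?_⟩
    rw [Pi.smul_apply, ← hP' hz]
    simp only [Pi.smul_apply, smul_eq_mul]
    ring

lemma exists_polynomial_mul_logScaleSpan (p : Polynomial ℂ) {S : ℂ → ℂ} (hS : S ∈ logScaleSpan) :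
    ∃ S' ∈ logScaleSpan, EqOn (fun z => p.eval z * S z) S' {1}ᶜ := by
  refine exists_eqOn_polynomial_mul (fun S hS => exists_eqOn_id_mul_of_span ?_ hS) p hS
  rintro _ ⟨⟨s, k⟩, rfl⟩
  refine ⟨logScale s k - logScale (s + 1) k, sub_mem (logScale_mem_logScaleSpan s k)
    (logScale_mem_logScaleSpan (s + 1) k), fun z hz => ?_⟩
  have hne : 1 - z ≠ 0 := sub_ne_zero.2 (Ne.symm hz)
  simp only [Pi.sub_apply, logScale, Complex.cpow_add _ _ hne, Complex.cpow_one]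
  ring

lemma scaleFun_mem_span (α : ℂ) (k : ℕ) : scaleFun α k ∈ Submodule.span ℂ basicScale :=
  Submodule.subset_span ⟨α, k, rfl⟩

lemma exists_polynomial_mul_basicScale (p : Polynomial ℂ) {S : ℂ → ℂ}
    (hS : S ∈ Submodule.span ℂ basicScale) :
    ∃ S' ∈ Submodule.span ℂ basicScale, EqOn (fun z => p.eval z * S z) S' {1}ᶜ := by
  refine exists_eqOn_polynomial_mul (fun S hS => exists_eqOn_id_mul_of_span ?_ hS) p hS
  rintro _ ⟨α, k, rfl⟩
  refine ⟨scaleFun α k - scaleFun (α - 1) k, sub_mem (scaleFun_mem_span α k)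
    (scaleFun_mem_span (α - 1) k), fun z hz => ?_⟩
  have hne : 1 - z ≠ 0 := sub_ne_zero.2 (Ne.symm hz)
  simp only [Pi.sub_apply, scaleFun]
  rw [show -(α - 1) = -α + 1 by ring, Complex.cpow_add _ _ hne, Complex.cpow_one]
  ring

lemma scaleFun_eq (α : ℂ) (k : ℕ) {z : ℂ} (hz : z ∈ spiralDomain c) :
    scaleFun α k z = (-1) ^ k * (z⁻¹) ^ k * logScale (-α) k z := by
  rw [scaleFun, Complex.cpow_natCast, Complex.log_inv _ (Complex.slitPlane_arg_ne_pi
    (one_sub_mem_slitPlane hz)), logScale, one_div, mul_neg, neg_pow, mul_pow]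
  ring

lemma mem_compl_one_of_mem_spiralDomain {z : ℂ} (hz : z ∈ spiralDomain c) : z ∈ ({1} : Set ℂ)ᶜ :=
  ne_one_of_mem_spiralDomain hz

/-- The two scales differ by `z^{-k}`, which is analytic at `1` and may be replaced by a Taylor
polynomial. Its order exceeds `A` by enough to absorb the growth of `logScale (-α) k`. -/
lemma scaleFun_mem (α : ℂ) (k : ℕ) : scaleFun α k ∈ logScaleSpan ⊔ nearPoly c A := by
  obtain ⟨M, hM⟩ := exists_nat_ge (A - ((-α).re - 1))
  have hH : AnalyticAt ℂ (fun z : ℂ => (-1) ^ k * (z⁻¹) ^ k) 1 :=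
    analyticAt_const.mul ((analyticAt_id.inv one_ne_zero).pow k)
  obtain ⟨p, hp⟩ := hH.mem_nearPoly (c := c) (A := M)
  obtain ⟨S, hS, hS'⟩ := exists_polynomial_mul_logScaleSpan p (logScale_mem_logScaleSpan (-α) k)
  have h1 : (fun z => ((-1) ^ k * (z⁻¹) ^ k - p.eval z) * logScale (-α) k z) ∈ nearPoly c A := by
    refine mem_nearPoly_of_isBigO (isBigO_pow_iff_rpow.2 ?_)
    refine ((isBigO_pow_iff_rpow.1 hp).mul (logScale_isBigO (sub_one_lt (-α).re) k)).trans ?_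
    refine isBigO_nhdsWithin_one_iff.2 ⟨1, one_pos, 1, one_pos, fun z hz hz1 => ?_⟩
    have hx : 0 < ‖1 - z‖ := norm_pos_iff.2 (sub_ne_zero.2 (ne_one_of_mem_spiralDomain hz).symm)
    rw [one_mul, ← Real.rpow_add hx, Real.norm_of_nonneg (Real.rpow_nonneg hx.le _),
      Real.norm_of_nonneg (Real.rpow_nonneg hx.le _)]
    exact Real.rpow_le_rpow_of_exponent_ge hx hz1.le (by linarith)
  refine mem_sup_nearPoly_of_eqOn (fun z hz => ?_)
    (add_mem (Submodule.mem_sup_left hS) (Submodule.mem_sup_right h1))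
  rw [scaleFun_eq α k hz, Pi.add_apply, ← hS' (mem_compl_one_of_mem_spiralDomain hz)]
  ring

/-- In this direction the correcting factor `(-z)^k` is a polynomial, so the comparison is exact. -/
lemma exists_eventuallyEq_of_mem_logScaleSpan (c : ℝ) {S : ℂ → ℂ} (hS : S ∈ logScaleSpan) :
    ∃ S' ∈ Submodule.span ℂ basicScale, S =ᶠ[𝓝[spiralDomain c] 1] S' := by
  induction hS using Submodule.span_induction with
  | mem S h =>
    obtain ⟨⟨s, k⟩, rfl⟩ := h
    obtain ⟨S', hS', h'⟩ := exists_polynomial_mul_basicScale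
      (Polynomial.C ((-1) ^ k) * Polynomial.X ^ k) (scaleFun_mem_span (-s) k)
    refine ⟨S', hS', ?_⟩
    filter_upwards [self_mem_nhdsWithin, eventually_ne_zero_nhds_one] with z hz hz0
    rw [← h' (mem_compl_one_of_mem_spiralDomain hz)]
    simp only [Polynomial.eval_mul, Polynomial.eval_C, Polynomial.eval_pow, Polynomial.eval_X]
    rw [scaleFun_eq _ _ hz, neg_neg]
    have h1 : (-1 : ℂ) ^ k * (-1) ^ k = 1 := by rw [← mul_pow]; simp
    have h2 : z ^ k * (z⁻¹) ^ k = 1 := by rw [← mul_pow, mul_inv_cancel₀ hz0, one_pow]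
    linear_combination (-logScale s k z) * h1 - (-1) ^ k * (-1) ^ k * logScale s k z * h2
  | zero => exact ⟨0, zero_mem _, EventuallyEq.rfl⟩
  | add S T _ _ hS hT =>
    obtain ⟨P, hP, hP'⟩ := hS
    obtain ⟨Q, hQ, hQ'⟩ := hT
    exact ⟨P + Q, add_mem hP hQ, hP'.add hQ'⟩
  | smul k S _ hS =>
    obtain ⟨P, hP, hP'⟩ := hS
    exact ⟨k • P, Submodule.smul_mem _ k hP, hP'.const_smul k⟩

lemma hasSingularExpansion_of_mem {D : Set ℂ} (hD : D ⊆ spiralDomain c)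
    (h : ∀ A, F ∈ logScaleSpan ⊔ nearPoly c A) : HasSingularExpansion F D := by
  rintro _ ⟨α, k, rfl⟩
  obtain ⟨A, hA⟩ := exists_nat_ge (-α.re)
  obtain ⟨S, hS, R, ⟨p, hp⟩, rfl⟩ := Submodule.mem_sup.1 (h A)
  obtain ⟨P, hP, hP'⟩ := exists_eventuallyEq_of_mem_logScaleSpan c hS
  -- The polynomial part itself belongs to the scale, as a polynomial multiple of `σ_{0,0} = 1`.
  obtain ⟨Q, hQ, hQ'⟩ := exists_polynomial_mul_basicScale p (scaleFun_mem_span 0 0)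
  refine ⟨P + Q, add_mem hP hQ, IsBigO.trans ?_ (isBigO_scaleFun α k hA fun h1 =>
    one_notMem_spiralDomain _ (hD h1))⟩
  refine (hp.congr' ?_ EventuallyEq.rfl).mono (nhdsWithin_mono _ hD)
  filter_upwards [hP', self_mem_nhdsWithin] with z hz hzD
  have h1 := hQ' (mem_compl_one_of_mem_spiralDomain hzD)
  have h2 : scaleFun 0 ((0 : ℕ) : ℂ) z = 1 := by simp [scaleFun]
  simp only [h2, mul_one] at h1
  rw [Pi.add_apply, Pi.add_apply, hz, h1]
  ring

lemma mem_of_hasSingularExpansion {D : Set ℂ} (hD : spiralDomain c ⊆ D)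
    (h : HasSingularExpansion F D) (A : ℕ) : F ∈ logScaleSpan ⊔ nearPoly c A := by
  -- The test function `σ_{-A,0}` is `(1 - z)^A`.
  obtain ⟨S, hS, hO⟩ := h _ ⟨-A, 0, rfl⟩
  have hS' : S ∈ logScaleSpan ⊔ nearPoly c A := (Submodule.span_le.2 (by
    rintro _ ⟨α, k, rfl⟩
    exact scaleFun_mem α k) : Submodule.span ℂ basicScale ≤ logScaleSpan ⊔ nearPoly c A) hS
  have h1 : F - S ∈ nearPoly c A := mem_nearPoly_of_isBigO
    ((hO.mono (nhdsWithin_mono _ hD)).congr_right fun z => by simp [scaleFun])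
  simpa using add_mem (Submodule.mem_sup_right (S := logScaleSpan) h1) hS'

/-! ### Hadamard products -/

lemma exists_growth_of_mem_sup (h : F ∈ logScaleSpan ⊔ nearPoly c A) :
    ∃ r : ℝ, F =O[𝓝[spiralDomain c] 1] fun z => ‖1 - z‖ ^ (-r) := by
  have hmono : ∀ r r' : ℝ, r ≤ r' → (fun z : ℂ => ‖1 - z‖ ^ (-r)) =O[𝓝[spiralDomain c] 1]
      fun z : ℂ => ‖1 - z‖ ^ (-r') := by
    intro r r' hr
    refine isBigO_nhdsWithin_one_iff.2 ⟨1, one_pos, 1, one_pos, fun z hz hz1 => ?_⟩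
    have hx : 0 < ‖1 - z‖ := norm_pos_iff.2 (sub_ne_zero.2 (ne_one_of_mem_spiralDomain hz).symm)
    rw [one_mul, Real.norm_of_nonneg (Real.rpow_nonneg hx.le _),
      Real.norm_of_nonneg (Real.rpow_nonneg hx.le _)]
    exact Real.rpow_le_rpow_of_exponent_ge hx hz1.le (by linarith)
  have hadd : ∀ {S T : ℂ → ℂ}, (∃ r : ℝ, S =O[𝓝[spiralDomain c] 1] fun z => ‖1 - z‖ ^ (-r)) →
      (∃ r : ℝ, T =O[𝓝[spiralDomain c] 1] fun z => ‖1 - z‖ ^ (-r)) →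
      ∃ r : ℝ, (S + T) =O[𝓝[spiralDomain c] 1] fun z => ‖1 - z‖ ^ (-r) := by
    rintro S T ⟨r, hr⟩ ⟨r', hr'⟩
    exact ⟨max r r', (hr.trans (hmono _ _ (le_max_left _ _))).add
      (hr'.trans (hmono _ _ (le_max_right _ _)))⟩
  obtain ⟨S, hS, R, hR, rfl⟩ := Submodule.mem_sup.1 h
  refine hadd ?_ ⟨0, by simpa using (isBigO_one_of_mem_nearPoly hR).norm_right⟩
  clear h
  induction hS using Submodule.span_induction with
  | mem S h =>
    obtain ⟨⟨s, k⟩, rfl⟩ := h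
    exact ⟨-(s.re - 1), by simpa using logScale_isBigO (sub_one_lt s.re) k⟩
  | zero => exact ⟨0, isBigO_zero _ _⟩
  | add S T _ _ hS hT => exact hadd hS hT
  | smul k S _ hS =>
    obtain ⟨r, hr⟩ := hS
    exact ⟨r, hr.const_smul_left k⟩

lemma exists_nat_growth (h : F ∈ logScaleSpan ⊔ nearPoly c A) :
    ∃ m₀ : ℕ, ∀ m : ℕ, m₀ ≤ m →
      F =O[𝓝[spiralDomain c] 1] fun z => ‖1 - z‖ ^ (-(m / 2) : ℝ) := by
  obtain ⟨r, hr⟩ := exists_growth_of_mem_sup h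
  obtain ⟨m₀, hm₀⟩ := exists_nat_ge (2 * r)
  refine ⟨m₀, fun m hm => hr.trans (isBigO_nhdsWithin_one_iff.2 ⟨1, one_pos, 1, one_pos,
    fun z hz hz1 => ?_⟩)⟩
  have hx : 0 < ‖1 - z‖ := norm_pos_iff.2 (sub_ne_zero.2 (ne_one_of_mem_spiralDomain hz).symm)
  have hm' : (m₀ : ℝ) ≤ m := by exact_mod_cast hm
  rw [one_mul, Real.norm_of_nonneg (Real.rpow_nonneg hx.le _),
    Real.norm_of_nonneg (Real.rpow_nonneg hx.le _)]
  exact Real.rpow_le_rpow_of_exponent_ge hx hz1.le (by linarith)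

/-- Splitting into a series with polylogarithmic coefficients, a polynomial and a remainder. -/
lemma exists_decomposition (hc : 0 < c) (hF : Continues c a F)
    (h : F ∈ logScaleSpan ⊔ nearPoly c A) :
    ∃ ℓ ∈ liSpan, ∃ (p : Polynomial ℂ) (r : ℕ → ℂ) (L R : ℂ → ℂ), a = ℓ + p.coeff + r ∧
      Continues c ℓ L ∧ Continues c r R ∧ (∀ z, F z = L z + p.eval z + R z) ∧
      R =O[𝓝[spiralDomain c] 1] fun z => (1 - z) ^ A := by
  have h1 : F ∈ liFunctions c ⊔ nearPoly c A := by
    refine (sup_le (Submodule.span_le.2 ?_) le_sup_right :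
      logScaleSpan ⊔ nearPoly c A ≤ liFunctions c ⊔ nearPoly c A) h
    rintro _ ⟨q, rfl⟩
    exact logScale_mem_liFunctions_sup hc _ _
  obtain ⟨L, ⟨ℓ, hℓ, hL⟩, R, ⟨p, hp⟩, rfl⟩ := Submodule.mem_sup.1 h1
  refine ⟨ℓ, hℓ, p, a - ℓ - p.coeff, L, L + R - L - (fun z => p.eval z), by abel, hL,
    (hF.sub hL).sub (Continues.polynomial p), fun z => ?_, ?_⟩
  · simp only [Pi.add_apply, Pi.sub_apply]
    ring
  · refine hp.congr_left fun z => ?_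
    simp only [Pi.add_apply, Pi.sub_apply]
    ring

lemma coeff_mul_mem_expandable (p : Polynomial ℂ) (a : ℕ → ℂ) : p.coeff * a ∈ expandable c A := by
  set q : Polynomial ℂ := ∑ n ∈ p.support, Polynomial.monomial n (p.coeff n * a n)
  have hq : p.coeff * a = q.coeff := by
    ext n
    simp only [q, Pi.mul_apply, Polynomial.finsetSum_coeff, Polynomial.coeff_monomial,
      Finset.sum_ite_eq', Polynomial.mem_support_iff]
    split_ifs with h
    · rfl
    · rw [not_not.1 h, zero_mul]
  rw [hq]
  exact ⟨_, Continues.polynomial q, Submodule.mem_sup_right (polynomial_mem_nearPoly q)⟩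

/-- With `a = ℓ + p + r` and `b = ℓ' + p' + r'`, the product is grouped as `ℓ ℓ' + p' ℓ + r' ℓ + p b
+ r b`. The terms with a remainder fall under `Continues.exists_hadamard_nearPoly`, which needs only
moderate growth of the other factor. -/
lemma mul_mem_expandable (hc' : 0 < c') (hcc : c' < c) (hF : Continues c a F)
    (hG : Continues c b G) (hFe : ∀ A, F ∈ logScaleSpan ⊔ nearPoly c A)
    (hGe : ∀ A, G ∈ logScaleSpan ⊔ nearPoly c A) {K : ℕ} (hK : 0 < K) : a * b ∈ expandable c' K := by
  have hc := hc'.trans hcc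
  obtain ⟨m₁, hm₁⟩ := exists_nat_growth (hFe 0)
  obtain ⟨m₂, hm₂⟩ := exists_nat_growth (hGe 0)
  -- The growth exponent is fixed before decomposing, since the remainders must have order `m + K`.
  obtain ⟨m, hm⟩ : ∃ m, m = m₁ + m₂ + 1 := ⟨_, rfl⟩
  have hFm := hm₁ m (by omega)
  have hGm := hm₂ m (by omega)
  obtain ⟨ℓ, hℓ, p, r, L, R, rfl, hL, hR, hFeq, hRO⟩ := exists_decomposition hc hF (hFe (m + K))
  obtain ⟨ℓ', hℓ', p', r', L', R', rfl, hL', hR', hGeq, hRO'⟩ :=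
    exists_decomposition hc hG (hGe (m + K))
  have hone : (fun _ : ℂ => (1 : ℂ)) =O[𝓝[spiralDomain c] 1]
      fun z => ‖1 - z‖ ^ (-(m / 2) : ℝ) := by
    refine isBigO_nhdsWithin_one_iff.2 ⟨1, one_pos, 1, one_pos, fun z hz hz1 => ?_⟩
    have hx : 0 < ‖1 - z‖ := norm_pos_iff.2 (sub_ne_zero.2 (ne_one_of_mem_spiralDomain hz).symm)
    rw [one_mul, norm_one, Real.norm_of_nonneg (Real.rpow_nonneg hx.le _)]
    exact Real.one_le_rpow_of_pos_of_le_one_of_nonpos hx hz1.le (by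
      have := m.cast_nonneg (α := ℝ); linarith)
  have hR1 : R =O[𝓝[spiralDomain c] 1] fun _ => (1 : ℂ) :=
    isBigO_one_of_mem_nearPoly (mem_nearPoly_of_isBigO hRO)
  have hLm : L =O[𝓝[spiralDomain c] 1] fun z => ‖1 - z‖ ^ (-(m / 2) : ℝ) := by
    refine ((hFm.sub ((polynomial_isBigO_one _ p).trans hone)).sub (hR1.trans hone)).congr_left
      fun z => ?_
    rw [hFeq]
    ring
  have h1 : ℓ * ℓ' ∈ expandable c' K := liSpan_le_expandable hc' (mul_mem_liSpan hℓ hℓ')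
  have h2 : p'.coeff * ℓ ∈ expandable c' K := coeff_mul_mem_expandable _ _
  have h3 : p.coeff * (ℓ' + p'.coeff + r') ∈ expandable c' K := coeff_mul_mem_expandable _ _
  have h4 : r * (ℓ' + p'.coeff + r') ∈ expandable c' K := by
    obtain ⟨H, hH, hHn⟩ := Continues.exists_hadamard_nearPoly hc' hcc (by omega : 0 < m) hK hR hG
      hRO hGm
    exact ⟨H, hH, Submodule.mem_sup_right hHn⟩
  have h5 : r' * ℓ ∈ expandable c' K := by
    obtain ⟨H, hH, hHn⟩ := Continues.exists_hadamard_nearPoly hc' hcc (by omega : 0 < m) hK hR' hL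
      hRO' hLm
    exact ⟨H, hH, Submodule.mem_sup_right hHn⟩
  have h6 := add_mem (add_mem (add_mem (add_mem h1 h2) h5) h3) h4
  convert h6 using 1
  ring

/-- Each order of expansion comes with its own continuation; uniqueness of analytic continuation
identifies them all. -/
lemma exists_hadamard_expandable (hc' : 0 < c') (hcc : c' < c) (hF : Continues c a F)
    (hG : Continues c b G) (hFe : ∀ A, F ∈ logScaleSpan ⊔ nearPoly c A)
    (hGe : ∀ A, G ∈ logScaleSpan ⊔ nearPoly c A) :
    ∃ H, Continues c' (a * b) H ∧ ∀ A, H ∈ logScaleSpan ⊔ nearPoly c' A := by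
  have h := fun K : ℕ => mul_mem_expandable hc' hcc hF hG hFe hGe K.succ_pos
  obtain ⟨H, hH, -⟩ := h 0
  refine ⟨H, hH, fun A => ?_⟩
  obtain ⟨H', hH', hHe⟩ := h A
  exact mem_sup_nearPoly_of_eqOn (hH.eqOn hc' hH')
    (sup_le_sup_left (nearPoly_anti A.le_succ) _ hHe)

/-! ### S.A. type on spiral domains and conclusion -/

lemma IsSAType.exists_continues {f : PowerSeries ℂ} (hf : IsSAType f) : ∃ c₀ > 0, ∀ c, 0 < c → c ≤ c₀ →
    ∃ F, Continues c (fun n => PowerSeries.coeff n f) F ∧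
      ∀ A, F ∈ logScaleSpan ⊔ nearPoly c A := by
  obtain ⟨ϑ, r, h0, h1, hr, F, hF, hFe⟩ := hf
  obtain ⟨c₀, hc₀, h⟩ := exists_spiralDomain_subset_deltaDomain h0 h1 hr
  exact ⟨c₀, hc₀, fun c hc hcc => ⟨F, ⟨hF.1.mono (h c hc hcc), hF.2⟩,
    mem_of_hasSingularExpansion (h c hc hcc) hFe⟩⟩

lemma isSAType_of_continues {f : PowerSeries ℂ} (hc : 0 < c)
    (hF : Continues c (fun n => PowerSeries.coeff n f) F)
    (hFe : ∀ A, F ∈ logScaleSpan ⊔ nearPoly c A) : IsSAType f := by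
  obtain ⟨ϑ, r, h0, h1, hr, hsub⟩ := exists_deltaDomain_subset_spiralDomain hc
  exact ⟨ϑ, r, h0, h1, hr, F, ⟨hF.1.mono hsub, hF.2⟩, hasSingularExpansion_of_mem hsub hFe⟩

end SingularityAnalysis

theorem theorem5 (f g : PowerSeries ℂ)
    (hf : SingularityAnalysis.IsSAType f) (hg : SingularityAnalysis.IsSAType g) :
    SingularityAnalysis.IsSAType (SingularityAnalysis.hadamardProduct f g) := by
  obtain ⟨c₁, hc₁, h₁⟩ := hf.exists_continues
  obtain ⟨c₂, hc₂, h₂⟩ := hg.exists_continues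
  have hc : 0 < min c₁ c₂ := lt_min hc₁ hc₂
  obtain ⟨F, hF, hFe⟩ := h₁ _ hc (min_le_left _ _)
  obtain ⟨G, hG, hGe⟩ := h₂ _ hc (min_le_right _ _)
  obtain ⟨H, hH, hHe⟩ := SingularityAnalysis.exists_hadamard_expandable (half_pos hc)
    (half_lt_self hc) hF hG hFe hGe
  refine SingularityAnalysis.isSAType_of_continues (half_pos hc) (hH.congr_fun_zero_series
    fun n => ?_) hHe
  simp [SingularityAnalysis.hadamardProduct]
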